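/- Let $n\ge 1$ and $D=2n+1$, with local coordinates $(x_1,\dots,x_n,\psi_0,\dots,\psi_n)$, and let $X_\mu,N_\mu$ ($\mu=1,\dots,n$) be arbitrary smooth functions of one variable, evaluated at $x_\mu$. Put $U_\mu=\prod_{\nu\ne\mu}(x_\mu-x_\nu)$, $Q_\mu=X_\mu/U_\mu$, $H=\sum_\mu N_\mu/U_\mu$, let $\sigma^{(k)}$ be the $k$-th elementary symmetric polynomial in $x_1,\dots,x_n$ and $\sigma^{(k)}_\mu$ the one in the $x_\nu$ with $\nu\neq\mu$ (so $\sigma_\mu^{(n)}=0$). Let $\theta_\mu=\sum_{k=1}^n\sigma_\mu^{(k-1)}d\psi_k$ and $A=\sum_\mu\frac{N_\mu}{U_\mu}\theta_\mu$. On an open set $M$ of coordinate space on which $x_\mu>0$, the $x_\mu$ are pairwise distinct and $Q_\mu>0$, consider the metric $$g=\sum_{\mu=1}^n\frac{dx_\mu^2}{Q_\mu}+\sum_{\mu=1}^nQ_\mu\theta_\mu^2+4\Big(\sum_{k=0}^n\sigma^{(k)}d\psi_k+A\Big)^2$$ with the orthonormal coframe $$e^\mu=\frac{dx_\mu}{\sqrt{Q_\mu}},\qquad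 e^{\hat\mu}=\sqrt{Q_\mu}\,\theta_\mu,\qquad e^0=2\Big(\sum_{k=0}^n\sigma^{(k)}d\psi_k+A\Big),$$ and the forms $$\hat h=\sum_{\mu}\sqrt{x_\mu}\,e^\mu\wedge e^{\hat\mu},\qquad G=\sum_{\mu\neq\nu}\frac{1}{\sqrt{x_\mu}+\sqrt{x_\nu}}\sqrt{\frac{Q_\nu}{x_\nu}}\;e^\mu\wedge e^{\hat\mu}\wedge e^{\hat\nu}+\sum_\mu 2\Big(1+\frac{\partial H}{\partial x_\mu}\Big)e^\mu\wedge e^{\hat\mu}\wedge e^0 .$$ For a 3-form $T$ let $\nabla^T$ be the connection with $g(\nabla^T_XY,Z)=g(\nabla_XY,Z)+\frac12T(X,Y,Z)$, where $\nabla$ is the Levi-Civita connection, and put $d^T\Psi=\sum_ae^a\wedge\nabla^T_{e_a}\Psi$ and $\delta^T\Psi=-\sum_ae_a\lrcorner\nabla^T_{e_a}\Psi$. A smooth $p$-form $k$ is a *generalized conformal Killing-Yano* (GCKY) tensor with respect to $T$ if $\nabla^T_Xk=\frac1{p+1}X\lrcorner d^Tk-\frac1{D-p+1}X^\flat\wedge\delta^Tk$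 for all vector fields $X$; it is *generalized Killing-Yano* (GKY) if moreover $\delta^Tk=0$, and *generalized closed conformal Killing-Yano* (GCCKY) if moreover $d^Tk=0$. A symmetric 2-tensor $K$ is a *Killing tensor* if $\nabla_{(a}K_{bc)}=0$. Then for every $j=1,\dots,n$: 1. the $(2j+1)$-form $h^{(j)}=e^0\wedge\hat h^{\,j}=e^0\wedge\hat h\wedge\cdots\wedge\hat h$ is a GCCKY tensor with respect to the torsion $G$; 2. its Hodge dual $f^{(j)}=*h^{(j)}$, a $(2n-2j)$-form, is a GKY tensor with respect to $G$; 3. $$\frac{1}{(j!)^2\,(2n-2j-1)!}\;f^{(j)}{}_{ac_1\cdots c_{2n-2j-1}}\,f^{(j)}{}_b{}^{c_1\cdots c_{2n-2j-1}}=K^{(j)}_{ab},\qquad K^{(j)}=\sum_{\mu=1}^n\sigma_\mu^{(j)}\,(e^\mu\otimes e^\mu+e^{\hat\mu}\otimes e^{\hat\mu});$$ for $j=n$, where $f^{(n)}$ is a function, the left-hand side is read as $0$, and $K^{(n)}=0$; 4. $K^{(j)}$ is a rank-2 Killing tensor of $g$. -/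

import Mathlib

open scoped ContDiff Nat

namespace KillingYano

noncomputable section

/-! Riemannian geometry in a chart. Points and tangent vectors of a `D`-dimensional coordinate
domain are elements of `Fin D → ℝ`. -/

/-- Covectors (values of 1-forms) at a point. -/
abbrev Covector (D : ℕ) := Module.Dual ℝ (Fin D → ℝ)

/-- Alternating `p`-forms at a point. -/
abbrev Form (D p : ℕ) := (Fin D → ℝ) [⋀^Fin p]→ₗ[ℝ] ℝ

/-- Fields of `p`-forms. -/
abbrev FormField (D p : ℕ) := (Fin D → ℝ) → Form D p

/-- Fields of covariant 2-tensors; a metric is a particular one. -/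
abbrev TwoTensorField (D : ℕ) := (Fin D → ℝ) → LinearMap.BilinForm ℝ (Fin D → ℝ)

/-- Coefficients of a connection: `∇_u v = D_u v + Γ x u v`. -/
abbrev ConnCoeff (D : ℕ) := (Fin D → ℝ) → (Fin D → ℝ) → (Fin D → ℝ) → (Fin D → ℝ)

/-- The coordinate vector field `∂_a`. -/
def coordVec {D : ℕ} (a : Fin D) : Fin D → ℝ := Pi.single a 1

/-- The coordinate 1-form `dx^a`. -/
def coordForm {D : ℕ} (a : Fin D) : Covector D := LinearMap.proj a

/-- The tensor product `α ⊗ β` of two covectors: `(u, v) ↦ α u * β v`. -/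
def tensor {D : ℕ} (α β : Covector D) : LinearMap.BilinForm ℝ (Fin D → ℝ) :=
  LinearMap.smulRight α β

/-- A covector as a form of degree one. -/
def oneForm {D : ℕ} (α : Covector D) : Form D 1 :=
  AlternatingMap.ofSubsingleton ℝ (Fin D → ℝ) ℝ (0 : Fin 1) α

/-- The exterior product, normalized by `(α ∧ β)(u, v) = α u * β v - α v * β u` on 1-forms. -/
def wedge {D p q r : ℕ} (h : p + q = r) (α : Form D p) (β : Form D q) : Form D r :=
  ((LinearMap.mul' ℝ ℝ).compAlternatingMap (α.domCoprod β)).domDomCongr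
    (finSumFinEquiv.trans (finCongr h))

/-- The exterior power `β ∧ ⋯ ∧ β` (`j` factors) of a 2-form. -/
def wedgePow {D : ℕ} (β : Form D 2) : (j : ℕ) → Form D (2 * j)
  | 0 => (AlternatingMap.constOfIsEmpty ℝ (Fin D → ℝ) (Fin 0) 1 : Form D 0)
  | j + 1 => wedge (by omega) (wedgePow β j) β

/-- `α ∧ β` for a 1-form `α` and a `p`-form `β`, evaluated on vectors. -/
def wedgeOne {D p : ℕ} (α : (Fin D → ℝ) → ℝ) (β : (Fin p → Fin D → ℝ) → ℝ) :
    (Fin (p + 1) → Fin D → ℝ) → ℝ :=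
  fun v => ∑ i : Fin (p + 1), (-1) ^ (i : ℕ) * α (v i) * β (fun k => v (i.succAbove k))

/-- The components `g_{ab}` of the metric. -/
def gram {D : ℕ} (g : TwoTensorField D) (x : Fin D → ℝ) : Matrix (Fin D) (Fin D) ℝ :=
  Matrix.of fun a b => g x (coordVec a) (coordVec b)

/-- The vector `θ^♯` with components `g^{ab} θ_b`. -/
def sharp {D : ℕ} (g : TwoTensorField D) (x : Fin D → ℝ) (θ : Fin D → ℝ) : Fin D → ℝ :=
  (gram g x)⁻¹.mulVec θ

/-- The Levi-Civita connection (Christoffel symbols) of the metric `g`. -/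
def leviCivita {D : ℕ} (g : TwoTensorField D) : ConnCoeff D := fun x u v =>
  sharp g x fun c =>
    (1 / 2) * (fderiv ℝ (fun y => g y v (coordVec c)) x u
      + fderiv ℝ (fun y => g y u (coordVec c)) x v
      - fderiv ℝ (fun y => g y u v) x (coordVec c))

/-- The metric connection with totally skew-symmetric torsion `T`:
`g(∇^T_X Y, Z) = g(∇_X Y, Z) + T(X, Y, Z) / 2`. -/
def torsionConn {D : ℕ} (g : TwoTensorField D) (T : FormField D 3) : ConnCoeff D := fun x u v =>
  leviCivita g x u v + (1 / 2 : ℝ) • sharp g x fun c => T x ![u, v, coordVec c]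

/-- The covariant derivative `(∇_u β)(v_1, …, v_p)` of a `p`-form. -/
def covDeriv {D p : ℕ} (Γ : ConnCoeff D) (β : FormField D p) (x u : Fin D → ℝ)
    (v : Fin p → Fin D → ℝ) : ℝ :=
  fderiv ℝ (fun y => β y v) x u - ∑ i : Fin p, β x (Function.update v i (Γ x u (v i)))

/-- `d^∇ β = ∑_a e^a ∧ ∇_{e_a} β` (the sum does not depend on the frame). -/
def covExt {D p : ℕ} (Γ : ConnCoeff D) (β : FormField D p) (x : Fin D → ℝ) :
    (Fin (p + 1) → Fin D → ℝ) → ℝ :=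
  fun v => ∑ a : Fin D, wedgeOne (coordForm a) (covDeriv Γ β x (coordVec a)) v

/-- `δ^∇ β = -∑_a e_a ⌟ ∇_{e_a} β` (`e_a` orthonormal), written in coordinates with the inverse
metric; it is zero on functions. -/
def codiff {D : ℕ} (g : TwoTensorField D) (Γ : ConnCoeff D) :
    (p : ℕ) → FormField D p → (Fin D → ℝ) → (Fin (p - 1) → Fin D → ℝ) → ℝ
  | 0, _, _ => fun _ => 0
  | _ + 1, β, x => fun v =>
      -∑ a : Fin D, ∑ b : Fin D,
        (gram g x)⁻¹ a b * covDeriv Γ β x (coordVec a) (Fin.cons (coordVec b) v)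

/-- The `p`-form `X^♭ ∧ δ^∇ β` for a `p`-form `β`. -/
def flatWedgeCodiff {D : ℕ} (g : TwoTensorField D) (Γ : ConnCoeff D) :
    (p : ℕ) → FormField D p → (Fin D → ℝ) → (Fin D → ℝ) → (Fin p → Fin D → ℝ) → ℝ
  | 0, _, _, _ => fun _ => 0
  | p + 1, β, x, X => wedgeOne (g x X) (codiff g Γ (p + 1) β x)

/-- Smoothness of a field of `p`-forms on `M`. -/
def SmoothForm {D p : ℕ} (M : Set (Fin D → ℝ)) (β : FormField D p) : Prop :=
  ∀ v : Fin p → Fin D → ℝ, ContDiffOn ℝ ∞ (fun x => β x v) M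

/-- Generalized conformal Killing-Yano `p`-forms on `M` for the metric `g` and the torsion `T`. -/
structure IsGCKY {D p : ℕ} (M : Set (Fin D → ℝ)) (g : TwoTensorField D) (T : FormField D 3)
    (k : FormField D p) : Prop where
  smooth : SmoothForm M k
  eqn : ∀ x ∈ M, ∀ (X : Fin D → ℝ) (v : Fin p → Fin D → ℝ),
    covDeriv (torsionConn g T) k x X v =
      1 / ((p : ℝ) + 1) * covExt (torsionConn g T) k x (Fin.cons X v)
      - 1 / ((D : ℝ) - p + 1) * flatWedgeCodiff g (torsionConn g T) p k x X v

/-- Generalized Killing-Yano forms: GCKY and `δ^T f = 0`. -/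
structure IsGKY {D p : ℕ} (M : Set (Fin D → ℝ)) (g : TwoTensorField D) (T : FormField D 3)
    (f : FormField D p) : Prop extends IsGCKY M g T f where
  coclosed : ∀ x ∈ M, ∀ v, codiff g (torsionConn g T) p f x v = 0

/-- Generalized closed conformal Killing-Yano forms: GCKY and `d^T h = 0`. -/
structure IsGCCKY {D p : ℕ} (M : Set (Fin D → ℝ)) (g : TwoTensorField D) (T : FormField D 3)
    (h : FormField D p) : Prop extends IsGCKY M g T h where
  closed : ∀ x ∈ M, ∀ v, covExt (torsionConn g T) h x v = 0

/-- `(∇_u K)(v, w)` for a covariant 2-tensor and the Levi-Civita connection. -/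
def covDerivTwo {D : ℕ} (g K : TwoTensorField D) (x u v w : Fin D → ℝ) : ℝ :=
  fderiv ℝ (fun y => K y v w) x u - K x (leviCivita g x u v) w - K x v (leviCivita g x u w)

/-- Rank-2 Killing tensors: smooth symmetric `K` with `∇_{(a} K_{bc)} = 0`. -/
structure IsKillingTensor {D : ℕ} (M : Set (Fin D → ℝ)) (g K : TwoTensorField D) : Prop where
  smooth : ∀ v w, ContDiffOn ℝ ∞ (fun x => K x v w) M
  symm : ∀ x ∈ M, ∀ v w, K x v w = K x w v
  eqn : ∀ x ∈ M, ∀ u v w,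
    covDerivTwo g K x u v w + covDerivTwo g K x v w u + covDerivTwo g K x w u v = 0

/-- The Riemannian volume form `√(det g) dx^1 ∧ ⋯ ∧ dx^D`. -/
def volForm {D : ℕ} (g : TwoTensorField D) : FormField D D := fun x =>
  Real.sqrt (gram g x).det • (Matrix.detRowAlternating : Form D D)

theorem append_update_natAdd {D p q : ℕ} (u : Fin p → Fin D → ℝ) (v : Fin q → Fin D → ℝ)
    (i : Fin q) (c : Fin D → ℝ) : Fin.append u (Function.update v i c)
      = Function.update (Fin.append u v) (Fin.natAdd p i) c := by
  funext k
  refine Fin.addCases (fun k => ?_) (fun k => ?_) k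
  · have hk : Fin.castAdd q k ≠ Fin.natAdd p i := by
      intro h
      have := congrArg Fin.val h
      simp at this
      omega
    simp [Function.update_of_ne hk]
  · by_cases hk : k = i
    · subst hk; simp
    · simp [Function.update_of_ne, hk]

/-- The interior product of a form with `u_1, …, u_p` put into its first `p` slots. -/
def insertFirst {D p q r : ℕ} (h : p + q = r) (θ : Form D r) (u : Fin p → Fin D → ℝ) :
    Form D q where
  toFun v := θ (fun i => Fin.append u v ((finCongr h).symm i))
  map_update_add' := by
    subst h
    intro _ v i a b
    obtain rfl : ‹DecidableEq (Fin q)› = instDecidableEqFin q := Subsingleton.elim _ _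
    have key := append_update_natAdd u v i
    simp [key]
  map_update_smul' := by
    subst h
    intro _ v i a b
    obtain rfl : ‹DecidableEq (Fin q)› = instDecidableEqFin q := Subsingleton.elim _ _
    have key := append_update_natAdd u v i
    simp [key]
  map_eq_zero_of_eq' := by
    subst h
    intro v i j hv hij
    refine θ.map_eq_zero_of_eq (i := Fin.natAdd p i) (j := Fin.natAdd p j) _ ?_ ?_
    · simpa using hv
    · simpa using hij

/-- The Hodge dual,
`(*β)(v_1, …, v_q) = (1/p!) β^{a_1 ⋯ a_p} vol(∂_{a_1}, …, ∂_{a_p}, v_1, …, v_q)`. -/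
def hodge {D p q : ℕ} (g : TwoTensorField D) (h : p + q = D) (β : FormField D p) :
    FormField D q := fun x =>
  (1 / (p ! : ℝ)) • ∑ a : Fin p → Fin D,
    β x (fun i => sharp g x (coordForm (a i) ∘ coordVec)) •
      insertFirst h (volForm g x) (fun i => coordVec (a i))

/-- The contraction `f_{a c_1 ⋯ c_{p-1}} f_b{}^{c_1 ⋯ c_{p-1}} u^a v^b` for a `p`-form `f`; it is
zero for functions, which have no index to leave free. -/
def formSquare {D : ℕ} (g : TwoTensorField D) :
    (p : ℕ) → FormField D p → (Fin D → ℝ) → (Fin D → ℝ) → (Fin D → ℝ) → ℝ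
  | 0, _, _ => fun _ _ => 0
  | p + 1, f, x => fun u v =>
      ∑ c : Fin p → Fin D,
        f x (Fin.cons u fun i => coordVec (c i)) *
          f x (Fin.cons v fun i => sharp g x (coordForm (c i) ∘ coordVec))

/-! The metric: coordinates `(x_1, …, x_n, ψ_0, …, ψ_n)` on `ℝ^{n+(n+1)}`, functions `X μ` and
`N μ` of one variable. -/

variable {n : ℕ}

/-- The index of the coordinate `x_μ`. -/
def xIdx (μ : Fin n) : Fin (n + (n + 1)) := Fin.castAdd (n + 1) μ

/-- The index of the coordinate `ψ_k`. -/
def psiIdx (k : Fin (n + 1)) : Fin (n + (n + 1)) := Fin.natAdd n k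

/-- `U_μ = ∏_{ν ≠ μ} (x_μ - x_ν)`. -/
def U (μ : Fin n) (x : Fin (n + (n + 1)) → ℝ) : ℝ :=
  ∏ ν ∈ Finset.univ.erase μ, (x (xIdx μ) - x (xIdx ν))

/-- `Q_μ = X_μ(x_μ) / U_μ`. -/
def Q (X : Fin n → ℝ → ℝ) (μ : Fin n) (x : Fin (n + (n + 1)) → ℝ) : ℝ :=
  X μ (x (xIdx μ)) / U μ x

/-- `σ^{(k)}`: the `k`-th elementary symmetric polynomial in `x_1, …, x_n`. -/
def sigma (k : ℕ) (x : Fin (n + (n + 1)) → ℝ) : ℝ :=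
  ∑ t ∈ (Finset.univ : Finset (Fin n)).powersetCard k, ∏ ν ∈ t, x (xIdx ν)

/-- `σ_μ^{(k)}`: the `k`-th elementary symmetric polynomial in the `x_ν` with `ν ≠ μ`. -/
def sigmaErase (μ : Fin n) (k : ℕ) (x : Fin (n + (n + 1)) → ℝ) : ℝ :=
  ∑ t ∈ (Finset.univ.erase μ : Finset (Fin n)).powersetCard k, ∏ ν ∈ t, x (xIdx ν)

/-- The 1-form `∑_{k=1}^n σ_μ^{(k-1)} dψ_k` (`k : Fin n` below stands for the summation index minus one). -/
def theta (μ : Fin n) (x : Fin (n + (n + 1)) → ℝ) : Covector (n + (n + 1)) :=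
  ∑ k : Fin n, sigmaErase μ k x • coordForm (psiIdx k.succ)

/-- The 1-form `A = ∑_μ (N_μ / U_μ) ∑_{k=1}^n σ_μ^{(k-1)} dψ_k`. -/
def potentialA (N : Fin n → ℝ → ℝ) (x : Fin (n + (n + 1)) → ℝ) : Covector (n + (n + 1)) :=
  ∑ μ : Fin n, (N μ (x (xIdx μ)) / U μ x) • theta μ x

/-- The 1-form `∑_{k=0}^n σ^{(k)} dψ_k + A`. -/
def contact (N : Fin n → ℝ → ℝ) (x : Fin (n + (n + 1)) → ℝ) : Covector (n + (n + 1)) :=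
  ∑ k : Fin (n + 1), sigma k x • coordForm (psiIdx k) + potentialA N x

/-- The metric `g`. -/
def stMetric (X N : Fin n → ℝ → ℝ) : TwoTensorField (n + (n + 1)) := fun x =>
  ∑ μ : Fin n, (1 / Q X μ x) • tensor (coordForm (xIdx μ)) (coordForm (xIdx μ))
    + ∑ μ : Fin n, Q X μ x • tensor (theta μ x) (theta μ x)
    + (4 : ℝ) • tensor (contact N x) (contact N x)

/-- `e^μ = dx_μ / √Q_μ`. -/
def frameX (X : Fin n → ℝ → ℝ) (μ : Fin n) (x : Fin (n + (n + 1)) → ℝ) :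
    Covector (n + (n + 1)) :=
  (1 / Real.sqrt (Q X μ x)) • coordForm (xIdx μ)

/-- `e^μ̂ = √Q_μ ∑_{k=1}^n σ_μ^{(k-1)} dψ_k`. -/
def frameHat (X : Fin n → ℝ → ℝ) (μ : Fin n) (x : Fin (n + (n + 1)) → ℝ) :
    Covector (n + (n + 1)) :=
  Real.sqrt (Q X μ x) • theta μ x

/-- `e^0 = 2 (∑_{k=0}^n σ^{(k)} dψ_k + A)`. -/
def frameZero (N : Fin n → ℝ → ℝ) (x : Fin (n + (n + 1)) → ℝ) : Covector (n + (n + 1)) :=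
  (2 : ℝ) • contact N x

/-- `H = ∑_μ N_μ / U_μ`. -/
def H (N : Fin n → ℝ → ℝ) (x : Fin (n + (n + 1)) → ℝ) : ℝ :=
  ∑ μ : Fin n, N μ (x (xIdx μ)) / U μ x

/-- The 2-form `e^μ ∧ e^μ̂`. -/
def plane (X : Fin n → ℝ → ℝ) (μ : Fin n) : FormField (n + (n + 1)) 2 := fun x =>
  wedge rfl (oneForm (frameX X μ x)) (oneForm (frameHat X μ x))

/-- The torsion 3-form
`G = ∑_{μ≠ν} (√x_μ + √x_ν)⁻¹ √(Q_ν/x_ν) e^μ ∧ e^μ̂ ∧ e^ν̂ + ∑_μ 2 (1 + ∂_μ H) e^μ ∧ e^μ̂ ∧ e^0`. -/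
def torsionG (X N : Fin n → ℝ → ℝ) : FormField (n + (n + 1)) 3 := fun x =>
  ∑ μ : Fin n, ∑ ν ∈ Finset.univ.erase μ,
      (1 / (Real.sqrt (x (xIdx μ)) + Real.sqrt (x (xIdx ν)))
          * Real.sqrt (Q X ν x / x (xIdx ν))) •
        wedge rfl (plane X μ x) (oneForm (frameHat X ν x))
    + ∑ μ : Fin n, (2 * (1 + fderiv ℝ (H N) x (coordVec (xIdx μ)))) •
        wedge rfl (plane X μ x) (oneForm (frameZero N x))

/-- The 2-form `ĥ = ∑_μ √x_μ e^μ ∧ e^μ̂`. -/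
def hHat (X : Fin n → ℝ → ℝ) : FormField (n + (n + 1)) 2 := fun x =>
  ∑ μ : Fin n, Real.sqrt (x (xIdx μ)) • plane X μ x

/-- The `(2j+1)`-form `h^{(j)} = e^0 ∧ ĥ ∧ ⋯ ∧ ĥ`. -/
def hForm (X N : Fin n → ℝ → ℝ) (j : ℕ) : FormField (n + (n + 1)) (2 * j + 1) := fun x =>
  wedge (by omega) (oneForm (frameZero N x)) (wedgePow (hHat X x) j)

/-- The Hodge dual `f^{(j)} = *h^{(j)}`, a form of degree `2n - 2j`. -/
def fForm (X N : Fin n → ℝ → ℝ) (j : ℕ) (hj : j ≤ n) : FormField (n + (n + 1)) (2 * n - 2 * j) :=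
  hodge (stMetric X N) (by omega) (hForm X N j)

/-- `K^{(j)} = ∑_μ σ_μ^{(j)} (e^μ ⊗ e^μ + e^μ̂ ⊗ e^μ̂)`. -/
def KTensor (X : Fin n → ℝ → ℝ) (j : ℕ) : TwoTensorField (n + (n + 1)) := fun x =>
  ∑ μ : Fin n, sigmaErase μ j x •
    (tensor (frameX X μ x) (frameX X μ x) + tensor (frameHat X μ x) (frameHat X μ x))

end

end KillingYano

open scoped ContDiff Nat

namespace KillingYano

noncomputable section

section
/-! ### Exterior products of covectors -/

/-! Everything is computed in the given orthonormal coframe, where the connection ∇ = ∇^G is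
explicit. It is recognised rather than derived: candidate derivatives of the coframe (`connX`,
`connHat`, and zero for e^0) are skew and satisfy the first structure equation with torsion G
(`structure_equations`), and a metric connection is determined by its torsion
(`coframe_torsionConn`).

Put ξ = Σ_ν ξ_ν e^ν̂ with ξ_ν = √Q_ν / (2√x_ν). Two facts carry the theorem. The form e^0 is
parallel, because the last sum in G is de^0 ∧ e^0. And ∇_u ĥ = (u^♭ − e^0(u) e^0) ∧ ξ
(`sum_conn_pair`). Multiplying by e^0 removes the e^0 component, so ∇_u h^{(j)} = j e^0 ∧ u^♭ ∧ ξ ∧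
ĥ^{j−1}; in particular it is divisible by u^♭ (`exists_hasCovForm_hForm`).

Claim 1: divisibility gives u^♭ ∧ ∇_u h = 0 for all u. Summing over a frame gives d^G h = 0;
polarizing in u and then contracting gives the conformal equation (`gccky_of_wedge`).

Claim 2: the Hodge star commutes with a metric connection (`starLin_split_update`,
`hasCovForm_dualForm`), and the star of a form divisible by u^♭ vanishes once u is among its
arguments. Hence ∇f is totally skew, which is the Killing-Yano equation (`gky_of_skew`).

Claim 3: h^{(j)} is j! times the sum over j-element sets S of ∏_{μ∈S} √x_μ times the product of e^0
and the planes in S. Its dual is, up to signs, the same sum with the complementary planes. Two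
distinct complements differ by a whole plane, so no cross terms survive the contraction
(`formSquare_eq`). The plane μ receives the sum of ∏_{ν∈S} x_ν over all S not containing μ, which is
σ_μ^{(j)} (`sum_subsets_compl`).

Claim 4 is verified directly and not through f. The torsion drops out of the cyclic sum of
derivatives of a symmetric tensor, so ∇^G may replace the Levi-Civita connection, and the rest is
algebra in the frame (`cyclic_sum_eq_zero`).

The algebraic identities concern sums over ordered pairs μ ≠ ν; `sum_erase_eq_zero` reduces each to
a polynomial identity in two indices. -/

/-- `α_0 ∧ ⋯ ∧ α_{p-1}`. -/
def covWedge {D p : ℕ} (α : Fin p → Covector D) : Form D p :=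
  Matrix.detRowAlternating.compLinearMap (LinearMap.pi α)

theorem covWedge_apply {D p : ℕ} (α : Fin p → Covector D) (v : Fin p → Fin D → ℝ) :
    covWedge α v = (Matrix.of fun k i => α i (v k)).det := rfl

theorem covWedge_apply' {D p : ℕ} (α : Fin p → Covector D) (v : Fin p → Fin D → ℝ) :
    covWedge α v = (Matrix.of fun i k => α i (v k)).det := by
  rw [covWedge_apply, ← Matrix.det_transpose]; rfl

theorem covWedge_eq_detRow {D p : ℕ} (α : Fin p → Covector D) (v : Fin p → Fin D → ℝ) :
    covWedge α v = Matrix.detRowAlternating (fun i k => α i (v k)) :=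
  covWedge_apply' α v

theorem covWedge_eq_sum {D p : ℕ} (α : Fin p → Covector D) (v : Fin p → Fin D → ℝ) :
    covWedge α v = ∑ σ : Equiv.Perm (Fin p), Equiv.Perm.sign σ • ∏ i, α i (v (σ i)) := by
  rw [covWedge_apply, Matrix.det_apply]; rfl

/-- The exterior product of covectors as an alternating map of the covectors. -/
def covWedgeAlt (D p : ℕ) : Covector D [⋀^Fin p]→ₗ[ℝ] Form D p where
  toFun := covWedge
  map_update_add' := by
    intro _ α i a b
    obtain rfl : ‹DecidableEq (Fin p)› = instDecidableEqFin p := Subsingleton.elim _ _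
    ext v
    have h (c : Covector D) : (fun l k => (Function.update α i c) l (v k))
        = Function.update (fun l k => α l (v k)) i (fun k => c (v k)) := by
      funext l
      by_cases hl : l = i
      · subst hl; simp
      · simp [hl]
    simp only [AlternatingMap.add_apply, covWedge_eq_detRow, h]
    exact Matrix.detRowAlternating.map_update_add _ i (fun k => a (v k)) (fun k => b (v k))
  map_update_smul' := by
    intro _ α i r a
    obtain rfl : ‹DecidableEq (Fin p)› = instDecidableEqFin p := Subsingleton.elim _ _
    ext v
    have h (c : Covector D) : (fun l k => (Function.update α i c) l (v k))
        = Function.update (fun l k => α l (v k)) i (fun k => c (v k)) := by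
      funext l
      by_cases hl : l = i
      · subst hl; simp
      · simp [hl]
    simp only [AlternatingMap.smul_apply, covWedge_eq_detRow, h]
    exact Matrix.detRowAlternating.map_update_smul _ i r (fun k => a (v k))
  map_eq_zero_of_eq' := by
    intro α i j hα hij
    ext v
    rw [covWedge_apply']
    exact Matrix.det_zero_of_row_eq hij (by funext k; simp [hα])

@[simp] theorem covWedgeAlt_apply {D p : ℕ} (α : Fin p → Covector D) :
    covWedgeAlt D p α = covWedge α := rfl

theorem covWedge_eq_alternatization {D p : ℕ} (α : Fin p → Covector D) :
    covWedge α = MultilinearMap.alternatization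
      ((MultilinearMap.mkPiAlgebra ℝ (Fin p) ℝ).compLinearMap α) := by
  ext v
  rw [covWedge_eq_sum, MultilinearMap.alternatization_apply]
  rfl

/-- Both factors are alternatizations of a product of covectors, and the exterior product of two
alternatizations is the alternatization of the tensor product. What remains is to transport the sum
over permutations from `Fin p ⊕ Fin q` to `Fin (p + q)`. -/
theorem wedge_covWedge {D p q r : ℕ} (h : p + q = r) (α : Fin p → Covector D)
    (β : Fin q → Covector D) :
    wedge h (covWedge α) (covWedge β) = covWedge (fun k => Fin.append α β ((finCongr h).symm k)) := by
  subst h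
  rw [wedge, covWedge_eq_alternatization α, covWedge_eq_alternatization β,
    ← MultilinearMap.domCoprod_alternization]
  ext v
  rw [AlternatingMap.domDomCongr_apply, LinearMap.compAlternatingMap_apply,
    MultilinearMap.alternatization_apply, covWedge_eq_sum, map_sum]
  refine Eq.trans ?_ (Equiv.sum_comp (finSumFinEquiv (m := p) (n := q)).permCongr _)
  refine Finset.sum_congr rfl fun σ _ => ?_
  rw [Units.smul_def, Units.smul_def, map_zsmul, Equiv.Perm.sign_permCongr]
  congr 1
  rw [← finSumFinEquiv.prod_comp]
  simp [MultilinearMap.domCoprod_apply, Fintype.prod_sum_type]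

/-- The exterior product as a linear map on the tensor product. -/
def wedgeLin {D p q r : ℕ} (h : p + q = r) : TensorProduct ℝ (Form D p) (Form D q) →ₗ[ℝ] Form D r where
  toFun t := ((LinearMap.mul' ℝ ℝ).compAlternatingMap (AlternatingMap.domCoprod' t)).domDomCongr
    (finSumFinEquiv.trans (finCongr h))
  map_add' s t := by ext v; simp
  map_smul' c t := by ext v; simp

theorem wedge_eq {D p q r : ℕ} (h : p + q = r) (α : Form D p) (β : Form D q) :
    wedge h α β = wedgeLin h (α ⊗ₜ β) := rfl

theorem wedge_sum_left {D p q r : ℕ} (h : p + q = r) {ι : Type*} (s : Finset ι)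
    (α : ι → Form D p) (β : Form D q) :
    wedge h (∑ i ∈ s, α i) β = ∑ i ∈ s, wedge h (α i) β := by
  simp only [wedge_eq, TensorProduct.sum_tmul, map_sum]

theorem wedge_sum_right {D p q r : ℕ} (h : p + q = r) {ι : Type*} (s : Finset ι)
    (α : Form D p) (β : ι → Form D q) :
    wedge h α (∑ i ∈ s, β i) = ∑ i ∈ s, wedge h α (β i) := by
  simp only [wedge_eq, TensorProduct.tmul_sum, map_sum]

theorem oneForm_eq_covWedge {D : ℕ} (α : Covector D) : oneForm α = covWedge ![α] := by
  ext v
  rw [covWedge_apply, Matrix.det_fin_one]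
  rfl

/-- `(a_0, b_0, a_1, b_1, …)`. -/
def interleave {T : Type*} {j q : ℕ} (hq : q = 2 * j) (a b : Fin j → T) : Fin q → T := fun k =>
  if (k : ℕ) % 2 = 0 then a ⟨k / 2, by omega⟩ else b ⟨k / 2, by omega⟩

theorem comp_interleave {T T' : Type*} {j q : ℕ} (hq : q = 2 * j) (f : T → T') (a b : Fin j → T)
    (k : Fin q) : f (interleave hq a b k) = interleave hq (f ∘ a) (f ∘ b) k := by
  simp only [interleave]; split_ifs <;> rfl

/-- The function `m` records the plane chosen in each factor. Indexing by functions instead of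
subsets lets the Leibniz rule be applied slot by slot. -/
theorem wedgePow_sum {D n : ℕ} (a b : Fin n → Covector D) (j : ℕ) :
    wedgePow (∑ μ, covWedge ![a μ, b μ]) j
      = ∑ m : Fin j → Fin n, covWedge (interleave rfl (a ∘ m) (b ∘ m)) := by
  induction j with
  | zero =>
    ext v
    simp [wedgePow, covWedge_apply]
  | succ j ih =>
    rw [wedgePow, ih, wedge_sum_left, ← (Fin.snocEquiv (fun _ => Fin n)).sum_comp,
      Fintype.sum_prod_type_right]
    refine Finset.sum_congr rfl fun m _ => ?_
    rw [wedge_sum_right]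
    refine Finset.sum_congr rfl fun μ _ => ?_
    rw [wedge_covWedge]
    congr 1
    funext k
    obtain ⟨k, rfl⟩ := (finCongr (show 2 * j + 2 = 2 * (j + 1) by omega)).surjective k
    refine Fin.addCases (fun k => ?_) (fun k => ?_) k
    · simp only [Equiv.symm_apply_apply, Fin.append_left, interleave]
      have : (k : ℕ) / 2 < j := by omega
      simp [Fin.snocEquiv, Fin.snoc, this]
    · have h1 : ¬ (2 * j + 1) / 2 < j := by omega
      have h2 : (2 * j + 1) % 2 = 1 := by omega
      rw [Equiv.symm_apply_apply, Fin.append_right]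
      fin_cases k <;>
      simp [Fin.snocEquiv, Fin.snoc, interleave, h1, h2]

end

section
/-! ### Sums over enumerations of subsets -/

/-- The increasing enumeration of a subset with `j` elements. -/
def enum {n j : ℕ} (S : {S : Finset (Fin n) // S.card = j}) : Fin j → Fin n :=
  S.1.orderEmbOfFin S.2

theorem enum_injective {n j : ℕ} (S : {S : Finset (Fin n) // S.card = j}) :
    Function.Injective (enum S) := (S.1.orderEmbOfFin S.2).injective

theorem range_enum {n j : ℕ} (S : {S : Finset (Fin n) // S.card = j}) :
    Set.range (enum S) = S.1 := S.1.range_orderEmbOfFin S.2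

/-- An injective `m` equals `enum S ∘ σ` for exactly one set `S`, its range, and one permutation
`σ`; each subset is therefore counted `j !` times. -/
theorem sum_functions_eq_sum_subsets {n j : ℕ} {W : Type*} [AddCommGroup W] [Module ℝ W]
    (F : (Fin j → Fin n) → W) (h0 : ∀ m, ¬ Function.Injective m → F m = 0)
    (hF : ∀ m (σ : Equiv.Perm (Fin j)), F (m ∘ σ) = F m) :
    ∑ m, F m = (j ! : ℝ) • ∑ S : {S : Finset (Fin n) // S.card = j}, F (enum S) := by
  have key : ∑ p : {S : Finset (Fin n) // S.card = j} × Equiv.Perm (Fin j), F (enum p.1)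
      = ∑ m, F m := by
    refine Fintype.sum_of_injective (fun p => enum p.1 ∘ p.2) ?_ _ _ ?_ ?_
    · rintro ⟨S, σ⟩ ⟨S', σ'⟩ h
      have h' : enum S ∘ σ = enum S' ∘ σ' := h
      have hS : S = S' := by
        have := congrArg Set.range h'
        rw [σ.surjective.range_comp, σ'.surjective.range_comp, range_enum, range_enum] at this
        exact Subtype.ext (Finset.coe_injective this)
      subst hS
      congr 1
      ext i : 1
      exact enum_injective S (congrFun h' i)
    · intro m hm
      apply h0
      intro hinj
      apply hm
      let S : {S : Finset (Fin n) // S.card = j} :=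
        ⟨Finset.univ.image m, by rw [Finset.card_image_of_injective _ hinj]; simp⟩
      have hr (i : Fin j) : ∃ k, enum S k = m i := by
        have : m i ∈ Set.range (enum S) := by rw [range_enum]; simp [S]
        exact this
      choose f hf using hr
      have hfi : Function.Injective f := fun a b hab => hinj (by rw [← hf, ← hf, hab])
      refine ⟨(S, Equiv.ofBijective f (Finite.injective_iff_bijective.1 hfi)), ?_⟩
      funext i
      exact hf i
    · rintro ⟨S, σ⟩
      exact (hF _ σ).symm
  rw [← key, Fintype.sum_prod_type]
  simp only [Finset.sum_const, Finset.card_univ, Fintype.card_perm, Fintype.card_fin,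
    ← Finset.smul_sum]
  exact (Nat.cast_smul_eq_nsmul ℝ _ _).symm

/-- Moving whole pairs acts on `Fin j × Fin 2` by `σ` on each of two copies of `Fin j`, and the sign
of this permutation is a square. -/
theorem map_interleave_perm {T W : Type*} [AddCommGroup T] [Module ℝ T] [AddCommGroup W]
    [Module ℝ W] {j q : ℕ} (hq : q = 2 * j) (f : T [⋀^Fin q]→ₗ[ℝ] W) (a b : Fin j → T)
    (σ : Equiv.Perm (Fin j)) :
    f (interleave hq (a ∘ σ) (b ∘ σ)) = f (interleave hq a b) := by
  let ε : Fin j × Fin 2 ≃ Fin q := finProdFinEquiv.trans (finCongr (by omega))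
  have h1 : (interleave hq (a ∘ σ) (b ∘ σ))
      = interleave hq a b ∘ (ε.permCongr (Equiv.prodCongrLeft fun _ => σ)) := by
    funext k
    obtain ⟨⟨k, l⟩, rfl⟩ := ε.surjective k
    fin_cases l <;>
    simp [interleave, ε, finProdFinEquiv, Equiv.prodCongrLeft, Nat.add_mod, Nat.add_div] <;>
    refine congrArg _ (congrArg _ (Fin.ext ?_)) <;>
    simp only [Fin.divNat] <;> omega
  rw [h1, f.map_perm, Equiv.Perm.sign_permCongr, Equiv.Perm.sign_prodCongrLeft]
  simp

theorem sum_interleave {T W : Type*} [AddCommGroup T] [Module ℝ T] [AddCommGroup W]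
    [Module ℝ W] {n j q : ℕ} (hq : q = 2 * j) (f : T [⋀^Fin q]→ₗ[ℝ] W) (a b : Fin n → T) :
    ∑ m : Fin j → Fin n, f (interleave hq (a ∘ m) (b ∘ m))
      = (j ! : ℝ) • ∑ S : {S : Finset (Fin n) // S.card = j},
          f (interleave hq (a ∘ enum S) (b ∘ enum S)) := by
  refine sum_functions_eq_sum_subsets (fun m => f (interleave hq (a ∘ m) (b ∘ m))) ?_ ?_
  · intro m hm
    simp only [Function.Injective, not_forall] at hm
    obtain ⟨k, l, hkl, hne⟩ := hm
    refine f.map_eq_zero_of_eq (i := ⟨2 * k, by omega⟩) (j := ⟨2 * l, by omega⟩) _ ?_ ?_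
    · simp [interleave, hkl]
    · intro h
      apply hne
      ext
      have := congrArg Fin.val h
      simp at this
      omega
  · intro m σ
    exact map_interleave_perm hq f (a ∘ m) (b ∘ m) σ

/-! ### Expansions -/

theorem covWedge_cons_left {D p : ℕ} (θ : Covector D) (α : Fin p → Covector D)
    (v : Fin (p + 1) → Fin D → ℝ) :
    wedgeOne θ (covWedge α) v = covWedge (Fin.cons θ α) v := by
  rw [covWedge_apply, Matrix.det_succ_column_zero]
  rfl

theorem covWedge_apply_cons {D p : ℕ} (α : Fin (p + 1) → Covector D) (u : Fin D → ℝ)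
    (v : Fin p → Fin D → ℝ) :
    covWedge α (Fin.cons u v)
      = ∑ i : Fin (p + 1), (-1) ^ (i : ℕ) * α i u * covWedge (fun k => α (i.succAbove k)) v := by
  rw [covWedge_apply', Matrix.det_succ_column_zero]
  refine Finset.sum_congr rfl fun i _ => ?_
  rw [covWedge_apply']
  congr 1

/-- For each permutation in the determinant, multilinearity absorbs the sum over `a` into the
arguments of `η`, and the sign from reordering these cancels the sign in the determinant; the `p !`
terms are thus equal. This evaluates the index contractions both in the Hodge dual and in
`formSquare`. -/
theorem sum_covWedge_mul {D p : ℕ} {κ : Type*} [Fintype κ] [DecidableEq κ] (w z : κ → Fin D → ℝ)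
    (α : Fin p → Covector D) (η : Form D p) :
    ∑ a : Fin p → κ, covWedge α (fun i => w (a i)) * η (fun i => z (a i))
      = (p ! : ℝ) * η (fun i => ∑ a, α i (w a) • z a) := by
  have h (σ : Equiv.Perm (Fin p)) :
      ∑ a : Fin p → κ, (Equiv.Perm.sign σ • ∏ i, α i (w (a (σ i)))) * η (fun i => z (a i))
        = η (fun i => ∑ a, α i (w a) • z a) := by
    have h1 : η ((fun i => ∑ a, α i (w a) • z a) ∘ σ.symm)
        = ∑ a : Fin p → κ, (∏ i, α i (w (a (σ i)))) * η (fun i => z (a i)) := by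
      have := η.toMultilinearMap.map_sum (fun i a => α (σ.symm i) (w a) • z a)
      refine this.trans (Finset.sum_congr rfl fun a _ => ?_)
      rw [MultilinearMap.map_smul_univ, ← Equiv.prod_comp σ]
      simp
    rw [η.map_perm, Equiv.Perm.sign_symm] at h1
    simp only [smul_mul_assoc]
    rw [← Finset.smul_sum, ← h1, smul_smul]
    simp
  simp only [covWedge_eq_sum, Finset.sum_mul]
  rw [Finset.sum_comm]
  simp only [h]
  simp [Fintype.card_perm]

/-- By `h0` the matrix of pairings is block triangular. -/
theorem covWedge_append {D p q r : ℕ} (h : p + q = r) (α : Fin p → Covector D)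
    (β : Fin q → Covector D) (u : Fin p → Fin D → ℝ) (v : Fin q → Fin D → ℝ)
    (h0 : ∀ i k, β i (u k) = 0) :
    covWedge (fun k => Fin.append α β ((finCongr h).symm k))
      (fun k => Fin.append u v ((finCongr h).symm k)) = covWedge α u * covWedge β v := by
  subst h
  rw [covWedge_apply', covWedge_apply', covWedge_apply',
    ← Matrix.det_submatrix_equiv_self finSumFinEquiv]
  rw [← Matrix.det_fromBlocks_zero₂₁ _ (Matrix.of fun i k => α i (v k))]
  congr 1
  ext i k
  rcases i with i | i <;> rcases k with k | k <;> simp [h0]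

end

section
theorem form_sum_apply {D p : ℕ} {ι : Type*} (s : Finset ι) (α : ι → Form D p)
    (v : Fin p → Fin D → ℝ) : (∑ i ∈ s, α i) v = ∑ i ∈ s, α i v :=
  map_sum (AddMonoidHom.mk' (fun β : Form D p => β v) fun _ _ => rfl) α s

/-! ### Orthonormal frames at a point -/

/-- `E` is the frame dual to the coframe `e`. -/
def IsDualFrame {D : ℕ} (e : Fin D → Covector D) (E : Fin D → Fin D → ℝ) : Prop :=
  ∀ a b, e a (E b) = if a = b then 1 else 0

/-- `e` is an orthonormal coframe of `g` at `x`. -/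
def IsOrthonormalCoframe {D : ℕ} (g : TwoTensorField D) (x : Fin D → ℝ)
    (e : Fin D → Covector D) : Prop :=
  ∀ u v, g x u v = ∑ a, e a u * e a v

theorem vec_eq_sum_coordVec {D : ℕ} (v : Fin D → ℝ) : v = ∑ a, v a • coordVec a := by
  funext b
  simp [coordVec, Pi.single_apply]

theorem apply_eq_sum_coordVec {D : ℕ} (θ : Covector D) (v : Fin D → ℝ) :
    θ v = ∑ a, θ (coordVec a) * v a := by
  conv_lhs => rw [vec_eq_sum_coordVec v]
  simp [mul_comm]

namespace IsDualFrame

variable {D : ℕ} {e : Fin D → Covector D} {E : Fin D → Fin D → ℝ}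

theorem coframe_mul_frame (hE : IsDualFrame e E) :
    (Matrix.of fun a k => e a (coordVec k)) * (Matrix.of fun k b => E b k) = 1 := by
  ext a b
  rw [Matrix.mul_apply, Matrix.one_apply, ← hE a b, apply_eq_sum_coordVec]
  rfl

theorem frame_mul_coframe (hE : IsDualFrame e E) :
    (Matrix.of fun k b => E b k) * (Matrix.of fun a k => e a (coordVec k)) = 1 :=
  mul_eq_one_comm.1 hE.coframe_mul_frame

theorem sum_smul (hE : IsDualFrame e E) (v : Fin D → ℝ) : ∑ a, e a v • E a = v := by
  funext k
  have h : ((Matrix.of fun k b => E b k) * (Matrix.of fun a k => e a (coordVec k))).mulVec v k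
      = v k := by rw [hE.frame_mul_coframe, Matrix.one_mulVec]
  rw [← Matrix.mulVec_mulVec] at h
  rw [← h]
  simp only [Matrix.mulVec, dotProduct, Finset.sum_apply, Pi.smul_apply, smul_eq_mul,
    Matrix.of_apply]
  refine Finset.sum_congr rfl fun a _ => ?_
  rw [← apply_eq_sum_coordVec, mul_comm]

theorem covector_sum (hE : IsDualFrame e E) (θ : Covector D) : ∑ a, θ (E a) • e a = θ := by
  refine LinearMap.ext fun v => ?_
  conv_rhs => rw [← hE.sum_smul v]
  simp [mul_comm]

variable {g : TwoTensorField D} {x : Fin D → ℝ}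

theorem gram_eq (he : IsOrthonormalCoframe g x e) :
    gram g x = (Matrix.of fun a k => e a (coordVec k)).transpose
      * (Matrix.of fun a k => e a (coordVec k)) := by
  ext a b
  rw [gram, Matrix.of_apply, he, Matrix.mul_apply]
  rfl

/-- If A is the matrix of the coframe in coordinates, the Gram matrix is AᵀA and the frame is A⁻¹,
so the inverse is A⁻¹(A⁻¹)ᵀ. This turns coordinate contractions into sums over the frame. -/
theorem gram_inv (hE : IsDualFrame e E) (he : IsOrthonormalCoframe g x e) (a b : Fin D) :
    (gram g x)⁻¹ a b = ∑ c, E c a * E c b := by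
  have : (gram g x)⁻¹ = (Matrix.of fun k b => E b k) * (Matrix.of fun k b => E b k).transpose := by
    apply Matrix.inv_eq_right_inv
    rw [gram_eq he, Matrix.mul_assoc, ← Matrix.mul_assoc _ (Matrix.of fun k b => E b k),
      hE.coframe_mul_frame, Matrix.one_mul, ← Matrix.transpose_mul, hE.frame_mul_coframe,
      Matrix.transpose_one]
  rw [this, Matrix.mul_apply]
  rfl

theorem sharp_eq (hE : IsDualFrame e E) (he : IsOrthonormalCoframe g x e) (θ : Covector D) :
    sharp g x (fun b => θ (coordVec b)) = ∑ c, θ (E c) • E c := by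
  funext a
  simp only [sharp, Matrix.mulVec, dotProduct, hE.gram_inv he, Finset.sum_mul, Finset.sum_apply,
    Pi.smul_apply, smul_eq_mul]
  rw [Finset.sum_comm]
  refine Finset.sum_congr rfl fun c _ => ?_
  rw [apply_eq_sum_coordVec θ, Finset.sum_mul]
  exact Finset.sum_congr rfl fun _ _ => by ring

theorem sharp_coordForm (hE : IsDualFrame e E) (he : IsOrthonormalCoframe g x e) (a : Fin D) :
    sharp g x (coordForm a ∘ coordVec) = ∑ c, E c a • E c :=
  hE.sharp_eq he (coordForm a)

theorem metric_frame (hE : IsDualFrame e E) (he : IsOrthonormalCoframe g x e) (a : Fin D) :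
    g x (E a) = e a := by
  refine LinearMap.ext fun v => ?_
  rw [he]
  simp [hE _ a]

theorem det_ne_zero (hE : IsDualFrame e E) :
    (Matrix.of fun a k => e a (coordVec k)).det ≠ 0 := by
  intro h
  have := congrArg Matrix.det hE.coframe_mul_frame
  rw [Matrix.det_mul, h] at this
  simp at this

/-- The square root of det(AᵀA) is |det A|, whereas `covWedge e` carries det A itself; the two
volume forms differ by the sign of det A. -/
theorem volForm_eq (he : IsOrthonormalCoframe g x e) :
    (Matrix.of fun a k => e a (coordVec k)).det • volForm g x
      = |(Matrix.of fun a k => e a (coordVec k)).det| • covWedge e := by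
  ext v
  have h1 : covWedge e v = (Matrix.of fun a k => e a (coordVec k)).det * Matrix.det v := by
    rw [covWedge_apply', ← Matrix.det_transpose v, ← Matrix.det_mul]
    congr 1
    ext a k
    rw [Matrix.mul_apply, Matrix.of_apply, apply_eq_sum_coordVec]
    rfl
  rw [AlternatingMap.smul_apply, AlternatingMap.smul_apply, h1, volForm, gram_eq he,
    Matrix.det_mul, Matrix.det_transpose, Real.sqrt_mul_self_eq_abs]
  simp only [AlternatingMap.smul_apply, smul_eq_mul]
  change _ * (_ * Matrix.det v) = _
  ring

end IsDualFrame

theorem sum_smul_sum_coordVec {D : ℕ} {E : Fin D → Fin D → ℝ} (θ : Covector D) :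
    ∑ a, θ (∑ c, E c a • E c) • coordVec a = ∑ c, θ (E c) • E c := by
  funext b
  simp [coordVec, Pi.single_apply, mul_comm]

theorem sum_coordVec_smul_sum {D : ℕ} {E : Fin D → Fin D → ℝ} (θ : Covector D) :
    ∑ a, θ (coordVec a) • (∑ c, E c a • E c) = ∑ c, θ (E c) • E c := by
  simp only [Finset.smul_sum]
  rw [Finset.sum_comm]
  refine Finset.sum_congr rfl fun c _ => ?_
  rw [apply_eq_sum_coordVec θ, Finset.sum_smul]
  simp [smul_smul]

theorem insertFirst_apply {D p q r : ℕ} (h : p + q = r) (θ : Form D r) (u : Fin p → Fin D → ℝ)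
    (v : Fin q → Fin D → ℝ) :
    insertFirst h θ u v = θ (fun i => Fin.append u v ((finCongr h).symm i)) := rfl

theorem append_update_castAdd {D p q : ℕ} (u : Fin p → Fin D → ℝ) (v : Fin q → Fin D → ℝ)
    (i : Fin p) (c : Fin D → ℝ) : Fin.append (Function.update u i c) v
      = Function.update (Fin.append u v) (Fin.castAdd q i) c := by
  funext k
  refine Fin.addCases (fun k => ?_) (fun k => ?_) k
  · by_cases hk : k = i
    · subst hk; simp
    · simp [Function.update_of_ne, hk]
  · have hk : Fin.natAdd p k ≠ Fin.castAdd q i := by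
      intro h
      have := congrArg Fin.val h
      simp at this
      omega
    simp [Function.update_of_ne hk]

/-- The interior product with `p` vectors is alternating in these vectors. -/
def insertLast {D p q r : ℕ} (h : p + q = r) (θ : Form D r) (v : Fin q → Fin D → ℝ) :
    Form D p where
  toFun u := θ (fun i => Fin.append u v ((finCongr h).symm i))
  map_update_add' := by
    subst h
    intro _ u i a b
    obtain rfl : ‹DecidableEq (Fin p)› = instDecidableEqFin p := Subsingleton.elim _ _
    have key (c : Fin D → ℝ) := append_update_castAdd u v i c
    simp [key]
  map_update_smul' := by
    subst h
    intro _ u i a b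
    obtain rfl : ‹DecidableEq (Fin p)› = instDecidableEqFin p := Subsingleton.elim _ _
    have key (c : Fin D → ℝ) := append_update_castAdd u v i c
    simp [key]
  map_eq_zero_of_eq' := by
    subst h
    intro u i j hu hij
    refine θ.map_eq_zero_of_eq (i := Fin.castAdd q i) (j := Fin.castAdd q j) _ ?_ ?_
    · simpa using hu
    · simpa using hij

/-- The Hodge dual with respect to the volume form `e_1 ∧ ⋯ ∧ e_D`. -/
def starLin {D p q : ℕ} (h : p + q = D) (e : Fin D → Covector D) (E : Fin D → Fin D → ℝ) :
    Form D p →ₗ[ℝ] Form D q where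
  toFun β := (1 / (p ! : ℝ)) • ∑ a : Fin p → Fin D, β (fun i => ∑ c, E c (a i) • E c) •
      insertFirst h (covWedge e) (fun i => coordVec (a i))
  map_add' β γ := by
    simp only [AlternatingMap.add_apply, add_smul, Finset.sum_add_distrib, smul_add]
  map_smul' c β := by
    simp only [AlternatingMap.smul_apply, smul_eq_mul, mul_smul, ← Finset.smul_sum,
      RingHom.id_apply]
    rw [smul_comm]

/-- `sum_covWedge_mul` is applied to the volume form viewed as alternating in its first `p` slots,
and its factor `p !` cancels the normalization of the dual. -/
theorem starLin_covWedge {D p q : ℕ} (h : p + q = D) (e : Fin D → Covector D)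
    (E : Fin D → Fin D → ℝ) (α : Fin p → Covector D) :
    starLin h e E (covWedge α)
      = insertFirst h (covWedge e) (fun k => ∑ c, α k (E c) • E c) := by
  ext v
  have := sum_covWedge_mul (fun a => ∑ c, E c a • E c) coordVec α
    (insertLast h (covWedge e) v)
  simp only [sum_smul_sum_coordVec] at this
  have h2 (u : Fin p → Fin D → ℝ) : insertLast h (covWedge e) v u
    = insertFirst h (covWedge e) u v := rfl
  simp only [h2] at this
  have hp : (p ! : ℝ) ≠ 0 := by positivity
  simp only [starLin, LinearMap.coe_mk, AddHom.coe_mk, AlternatingMap.smul_apply, form_sum_apply,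
    smul_eq_mul, this]
  field_simp

theorem hodge_eq {D p q : ℕ} {e : Fin D → Covector D} {E : Fin D → Fin D → ℝ}
    {g : TwoTensorField D} {x : Fin D → ℝ} (hE : IsDualFrame e E)
    (he : IsOrthonormalCoframe g x e) (h : p + q = D) (β : FormField D p) :
    hodge g h β x = (|(Matrix.of fun a k => e a (coordVec k)).det| /
      (Matrix.of fun a k => e a (coordVec k)).det) • starLin h e E (β x) := by
  have hvol : volForm g x = (|(Matrix.of fun a k => e a (coordVec k)).det| /
      (Matrix.of fun a k => e a (coordVec k)).det) • covWedge e := by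
    have := IsDualFrame.volForm_eq he
    rw [div_eq_inv_mul, ← smul_smul, ← this, smul_smul, inv_mul_cancel₀ hE.det_ne_zero, one_smul]
  have h3 (u : Fin p → Fin D → ℝ) (r : ℝ) : (insertFirst h (r • covWedge e) u : Form D q)
    = r • insertFirst h (covWedge e) u := rfl
  simp only [hodge, hvol, h3, hE.sharp_coordForm he, starLin, LinearMap.coe_mk, AddHom.coe_mk]
  ext v
  simp only [AlternatingMap.smul_apply, form_sum_apply, smul_eq_mul, Finset.mul_sum]
  exact Finset.sum_congr rfl fun a _ => by ring

end

/-! ### The Hodge star on products of coframe elements. -/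

section
/-- The sign of a splitting of the index set into two ordered blocks. -/
def splitSign {D p q : ℕ} (h : p + q = D) (τ : Fin p ⊕ Fin q ≃ Fin D) : ℝ :=
  ((Equiv.Perm.sign ((finSumFinEquiv.trans (finCongr h)).symm.trans τ) : ℤ) : ℝ)

theorem splitSign_sq {D p q : ℕ} (h : p + q = D) (τ : Fin p ⊕ Fin q ≃ Fin D) :
    splitSign h τ ^ 2 = 1 := by
  rw [splitSign, ← Int.cast_pow, ← Units.val_pow_eq_pow_val, Int.units_sq]
  simp

theorem splitSign_swap {D p q : ℕ} (h : p + q = D) (τ : Fin p ⊕ Fin q ≃ Fin D)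
    {i k : Fin p ⊕ Fin q} (hik : i ≠ k) :
    splitSign h ((Equiv.swap i k).trans τ) = - splitSign h τ := by
  have : (finSumFinEquiv.trans (finCongr h)).symm.trans ((Equiv.swap i k).trans τ)
      = ((finSumFinEquiv.trans (finCongr h)).symm.trans τ)
        * (Equiv.swap ((finSumFinEquiv.trans (finCongr h)) i)
            ((finSumFinEquiv.trans (finCongr h)) k)) := by
    rw [← Equiv.symm_trans_swap_trans]
    ext l
    simp
  rw [splitSign, this, Equiv.Perm.sign_mul, Equiv.Perm.sign_swap (by simpa using hik)]
  simp [splitSign]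

/-- Reordering the coframe along `τ` costs `splitSign`; afterwards the covectors of the second block
vanish on the vectors of the first, and the determinant factors. -/
theorem insertFirst_split {D p q : ℕ} (h : p + q = D) {e : Fin D → Covector D}
    {E : Fin D → Fin D → ℝ} (hE : IsDualFrame e E) (τ : Fin p ⊕ Fin q ≃ Fin D) :
    (insertFirst h (covWedge e) (fun i => E (τ (Sum.inl i))) : Form D q)
      = splitSign h τ • covWedge (fun k => e (τ (Sum.inr k))) := by
  set ρ : Equiv.Perm (Fin D) := (finSumFinEquiv.trans (finCongr h)).symm.trans τ with hρ
  have h1 : covWedge (e ∘ ρ) = splitSign h τ • covWedge e := by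
    have := (covWedgeAlt D D).map_perm e ρ
    simp only [covWedgeAlt_apply] at this
    rw [this, splitSign, Units.smul_def, ← Int.cast_smul_eq_zsmul ℝ]
  have h2 : covWedge e = splitSign h τ • covWedge (e ∘ ρ) := by
    rw [h1, smul_smul, ← sq, splitSign_sq, one_smul]
  have h3 : e ∘ ρ = fun k => Fin.append (fun i => e (τ (Sum.inl i)))
      (fun i => e (τ (Sum.inr i))) ((finCongr h).symm k) := by
    funext k
    obtain ⟨k, rfl⟩ := (finCongr h).surjective k
    refine Fin.addCases (fun k => ?_) (fun k => ?_) k <;> simp [hρ]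
  ext v
  rw [insertFirst_apply, h2, h3, AlternatingMap.smul_apply, covWedge_append h]
  · have : covWedge (fun i => e (τ (Sum.inl i))) (fun i => E (τ (Sum.inl i))) = 1 := by
      rw [covWedge_apply']
      convert Matrix.det_one (R := ℝ) (n := Fin p)
      ext i k
      simp [hE _ _, Matrix.one_apply]
    rw [this, one_mul]
    rfl
  · intro i k
    simp [hE _ _]

theorem starLin_split {D p q : ℕ} (h : p + q = D) {e : Fin D → Covector D}
    {E : Fin D → Fin D → ℝ} (hE : IsDualFrame e E) (τ : Fin p ⊕ Fin q ≃ Fin D) :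
    starLin h e E (covWedge (fun i => e (τ (Sum.inl i))))
      = splitSign h τ • covWedge (fun k => e (τ (Sum.inr k))) := by
  rw [starLin_covWedge, ← insertFirst_split h hE]
  congr 1
  funext k
  simp [hE _ _]

/-- Invariance of the star under infinitesimal rotations: the skew matrix `A` acts as a derivation
on both sides. With `A` the connection matrix, this is why the star commutes with ∇. -/
theorem starLin_split_update {D p q : ℕ} (h : p + q = D) {e : Fin D → Covector D}
    {E : Fin D → Fin D → ℝ} (hE : IsDualFrame e E) (τ : Fin p ⊕ Fin q ≃ Fin D)
    (A : Fin D → Fin D → ℝ) (hA : ∀ a b, A a b = - A b a) :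
    starLin h e E (∑ i, covWedge (Function.update (fun i => e (τ (Sum.inl i))) i
        (∑ b, A (τ (Sum.inl i)) b • e b)))
      = splitSign h τ • ∑ k, covWedge (Function.update (fun i => e (τ (Sum.inr i))) k
        (∑ b, A (τ (Sum.inr k)) b • e b)) := by
  have hself (a : Fin D) : A a a = 0 := by linarith [hA a a]
  -- Replacements inside the block contribute nothing: the diagonal ones by skewness, the others
  -- because a factor is repeated. Each remaining one exchanges an index with the other block, so it
  -- is a transposition of `τ`. The sign change of `splitSign` and that of `A` cancel at the end.
  have hl (i : Fin p) : covWedge (Function.update (fun i => e (τ (Sum.inl i))) i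
        (∑ b, A (τ (Sum.inl i)) b • e b))
      = ∑ k, A (τ (Sum.inl i)) (τ (Sum.inr k)) •
          covWedge (fun l => e (τ (Equiv.swap (Sum.inl i) (Sum.inr k) (Sum.inl l)))) := by
    rw [← covWedgeAlt_apply, AlternatingMap.map_update_sum]
    simp only [AlternatingMap.map_update_smul]
    rw [← τ.sum_comp, Fintype.sum_sum_type]
    have h0 : ∑ i', A (τ (Sum.inl i)) (τ (Sum.inl i')) •
        (covWedgeAlt D p) (Function.update (fun i => e (τ (Sum.inl i))) i (e (τ (Sum.inl i')))) = 0 := by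
      refine Finset.sum_eq_zero fun i' _ => ?_
      by_cases hi : i' = i
      · subst hi; simp [hself]
      · rw [AlternatingMap.map_update_self _ _ (Ne.symm hi), smul_zero]
    rw [h0, zero_add]
    refine Finset.sum_congr rfl fun k _ => ?_
    rw [covWedgeAlt_apply]
    congr 2
    funext l
    by_cases hl : l = i
    · subst hl; simp
    · rw [Function.update_of_ne hl, Equiv.swap_apply_of_ne_of_ne (by simpa using hl) (by simp)]
  have hr (k : Fin q) : covWedge (Function.update (fun i => e (τ (Sum.inr i))) k
        (∑ b, A (τ (Sum.inr k)) b • e b))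
      = ∑ i, A (τ (Sum.inr k)) (τ (Sum.inl i)) •
          covWedge (fun l => e (τ (Equiv.swap (Sum.inl i) (Sum.inr k) (Sum.inr l)))) := by
    rw [← covWedgeAlt_apply, AlternatingMap.map_update_sum]
    simp only [AlternatingMap.map_update_smul]
    rw [← τ.sum_comp, Fintype.sum_sum_type]
    have h0 : ∑ k', A (τ (Sum.inr k)) (τ (Sum.inr k')) •
        (covWedgeAlt D q) (Function.update (fun i => e (τ (Sum.inr i))) k (e (τ (Sum.inr k')))) = 0 := by
      refine Finset.sum_eq_zero fun i' _ => ?_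
      by_cases hi : i' = k
      · subst hi; simp [hself]
      · rw [AlternatingMap.map_update_self _ _ (Ne.symm hi), smul_zero]
    rw [h0, add_zero]
    refine Finset.sum_congr rfl fun i _ => ?_
    rw [covWedgeAlt_apply]
    congr 2
    funext l
    by_cases hl : l = k
    · subst hl; simp
    · rw [Function.update_of_ne hl, Equiv.swap_apply_of_ne_of_ne (by simp) (by simpa using hl)]
  simp only [hl, hr, map_sum, map_smul, Finset.smul_sum]
  rw [Finset.sum_comm]
  refine Finset.sum_congr rfl fun k _ => Finset.sum_congr rfl fun i _ => ?_
  have := starLin_split h hE ((Equiv.swap (Sum.inl i) (Sum.inr k)).trans τ)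
  simp only [Equiv.trans_apply] at this
  rw [this, splitSign_swap h τ (by simp), hA, smul_smul, smul_smul]
  congr 1
  ring

/-! ### The two types of Killing-Yano equation at a point -/

/-- Frame independence of the exterior derivative; it is used for the coordinate basis and for the
orthonormal frame. -/
theorem sum_wedgeOne {D p : ℕ} {θ : Fin D → Covector D} {w : Fin D → Fin D → ℝ}
    (hw : ∀ v, ∑ a, θ a v • w a = v) (B : (Fin D → ℝ) →ₗ[ℝ] Form D p)
    (v : Fin (p + 1) → Fin D → ℝ) :
    ∑ a, wedgeOne (θ a) (B (w a)) v = AlternatingMap.alternatizeUncurryFin B v := by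
  simp only [wedgeOne, AlternatingMap.alternatizeUncurryFin_apply]
  rw [Finset.sum_comm]
  refine Finset.sum_congr rfl fun i _ => ?_
  conv_rhs => rw [← hw (v i)]
  rw [map_sum, form_sum_apply, Finset.smul_sum]
  refine Finset.sum_congr rfl fun a _ => ?_
  rw [map_smul, AlternatingMap.smul_apply]
  simp only [smul_eq_mul, zsmul_eq_mul, mul_assoc]
  push_cast
  rfl

theorem covExt_eq {D p : ℕ} {Γ : ConnCoeff D} {f : FormField D p} {x : Fin D → ℝ}
    {B : (Fin D → ℝ) →ₗ[ℝ] Form D p} (hB : ∀ u v, covDeriv Γ f x u v = B u v)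
    (v : Fin (p + 1) → Fin D → ℝ) :
    covExt Γ f x v = AlternatingMap.alternatizeUncurryFin B v := by
  rw [← sum_wedgeOne (θ := coordForm) (w := coordVec) (fun v => (vec_eq_sum_coordVec v).symm) B v]
  refine Finset.sum_congr rfl fun a _ => ?_
  congr 1
  funext v
  exact hB _ v

theorem codiff_eq {D p : ℕ} {e : Fin D → Covector D} {E : Fin D → Fin D → ℝ}
    {g : TwoTensorField D} {x : Fin D → ℝ} (hE : IsDualFrame e E)
    (he : IsOrthonormalCoframe g x e) {Γ : ConnCoeff D} {f : FormField D (p + 1)}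
    {B : (Fin D → ℝ) →ₗ[ℝ] Form D (p + 1)} (hB : ∀ u v, covDeriv Γ f x u v = B u v)
    (v : Fin p → Fin D → ℝ) :
    codiff g Γ (p + 1) f x v = - ∑ c, B (E c) (Fin.cons (E c) v) := by
  simp only [codiff, hE.gram_inv he, hB, Finset.sum_mul]
  congr 1
  have h (c : Fin D) : B (E c) (Fin.cons (E c) v)
      = ∑ a, ∑ b, E c a * E c b * B (coordVec a) (Fin.cons (coordVec b) v) := by
    have h1 (u : Fin D → ℝ) : B u (Fin.cons (E c) v)
        = ∑ b, E c b * B u (Fin.cons (coordVec b) v) := by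
      have := map_sum (B u).curryLeft (fun b => E c b • coordVec b) Finset.univ
      rw [← vec_eq_sum_coordVec] at this
      have h2 := congrArg (fun β : Form D p => β v) this
      simp only [form_sum_apply, map_smul, AlternatingMap.smul_apply, smul_eq_mul] at h2
      exact h2
    simp only [mul_assoc, ← Finset.mul_sum, ← h1]
    conv_lhs => rw [vec_eq_sum_coordVec (E c), map_sum, form_sum_apply, ← vec_eq_sum_coordVec]
    simp
  simp only [h]
  rw [Finset.sum_comm]
  conv_rhs => rw [Finset.sum_comm]
  rw [Finset.sum_comm]
  refine Finset.sum_congr rfl fun a _ => ?_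
  exact Finset.sum_comm

/-- If `∇_u f` vanishes whenever `u` is among its arguments, `∇f` is totally skew-symmetric. -/
theorem gky_of_skew {D p : ℕ} {e : Fin D → Covector D} {E : Fin D → Fin D → ℝ}
    {g : TwoTensorField D} {x : Fin D → ℝ} (hE : IsDualFrame e E)
    (he : IsOrthonormalCoframe g x e) {Γ : ConnCoeff D} {f : FormField D p}
    {B : (Fin D → ℝ) →ₗ[ℝ] Form D p} (hB : ∀ u v, covDeriv Γ f x u v = B u v)
    (h0 : ∀ u v i, v i = u → B u v = 0) :
    (∀ v, codiff g Γ p f x v = 0) ∧ ∀ X v, covDeriv Γ f x X v =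
      1 / ((p : ℝ) + 1) * covExt Γ f x (Fin.cons X v)
      - 1 / ((D : ℝ) - p + 1) * flatWedgeCodiff g Γ p f x X v := by
  have hδ : ∀ v, codiff g Γ p f x v = 0 := by
    rcases p with _ | p
    · intro v; rfl
    · intro v
      rw [codiff_eq hE he hB]
      rw [Finset.sum_eq_zero fun c _ => h0 (E c) (Fin.cons (E c) v) 0 rfl, neg_zero]
  refine ⟨hδ, fun X v => ?_⟩
  have hfl : flatWedgeCodiff g Γ p f x X v = 0 := by
    rcases p with _ | p
    · rfl
    · simp only [flatWedgeCodiff, wedgeOne, hδ, mul_zero, Finset.sum_const_zero]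
  have hskew (k : Fin p) : (-1 : ℝ) ^ ((k.succ : Fin (p + 1)) : ℕ) *
      B (v k) (fun l => (Fin.cons X v : Fin (p + 1) → _) (k.succ.succAbove l)) = B X v := by
    rcases p with _ | p
    · exact k.elim0
    · have h1 : (fun l => (Fin.cons X v : Fin (p + 2) → Fin D → ℝ) (k.succ.succAbove l))
          = Fin.cons X (k.removeNth v) := by
        funext l
        refine Fin.cases ?_ (fun l => ?_) l
        · simp
        · simp [Fin.removeNth]
      -- Polarization of `h0`: the expansion at `v k + X` makes `B` skew under exchange of the
      -- direction of differentiation with an argument. Hence the `p + 1` terms of the exterior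
      -- derivative are all equal to `B X v`.
      have hadd := h0 (v k + X) (Fin.cons (v k + X) (k.removeNth v)) 0 rfl
      have hc (w u : Fin D → ℝ) : B w (Fin.cons u (k.removeNth v))
        = (B w).curryLeft u (k.removeNth v) := rfl
      have e1 := h0 (v k) (Fin.cons (v k) (k.removeNth v)) 0 rfl
      have e2 := h0 X (Fin.cons X (k.removeNth v)) 0 rfl
      rw [hc] at hadd e1 e2
      simp only [map_add, AlternatingMap.add_apply, AlternatingMap.curryLeft_add,
        LinearMap.add_apply] at hadd
      rw [h1, hc]
      have h3 : (B X).curryLeft (v k) (k.removeNth v) = (-1) ^ (k : ℕ) * B X v := by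
        have := AlternatingMap.neg_one_pow_smul_map_insertNth (B X) k (v k) (k.removeNth v)
        rw [Fin.insertNth_removeNth, Function.update_eq_self] at this
        rw [← hc]
        refine Eq.trans this.symm ?_
        simp
      have h4 : (B (v k)).curryLeft X (k.removeNth v) = - ((-1) ^ (k : ℕ) * B X v) := by
        rw [← h3]; linarith
      rw [h4, Fin.val_succ, pow_succ]
      have : (-1 : ℝ) ^ (k : ℕ) * (-1) ^ (k : ℕ) = 1 := by
        rw [← mul_pow]; simp
      linear_combination (B X v) * this
  have hd : covExt Γ f x (Fin.cons X v) = ((p : ℝ) + 1) * B X v := by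
    rw [covExt_eq hB, AlternatingMap.alternatizeUncurryFin_apply, Fin.sum_univ_succ]
    have h2 : ∑ k : Fin p, (-1 : ℤ) ^ ((k.succ : Fin (p + 1)) : ℕ) •
        B ((Fin.cons X v : Fin (p + 1) → Fin D → ℝ) k.succ)
          (k.succ.removeNth (Fin.cons X v : Fin (p + 1) → Fin D → ℝ))
        = ∑ k : Fin p, B X v := by
      refine Finset.sum_congr rfl fun k _ => ?_
      rw [← hskew k]
      simp only [zsmul_eq_mul]
      push_cast
      rfl
    rw [h2]
    simp
    ring
  rw [hfl, hd, hB]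
  have : (p : ℝ) + 1 ≠ 0 := by positivity
  field_simp
  ring

theorem wedgeOne_cons {D p : ℕ} (θ : Covector D) (β : Form D (p + 1)) (w : Fin D → ℝ)
    (v : Fin (p + 1) → Fin D → ℝ) :
    wedgeOne θ β (Fin.cons w v) = θ w * β v - wedgeOne θ (fun r => β (Fin.cons w r)) v := by
  simp only [wedgeOne]
  rw [Fin.sum_univ_succ]
  simp only [Fin.val_zero, pow_zero, Fin.cons_zero, one_mul, Fin.succAbove_zero, Fin.cons_succ]
  rw [sub_eq_add_neg, ← Finset.sum_neg_distrib]
  congr 1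
  refine Finset.sum_congr rfl fun i _ => ?_
  have : (fun k => (Fin.cons w v : Fin (p + 2) → Fin D → ℝ) (i.succ.succAbove k))
      = Fin.cons w fun k => v (i.succAbove k) := by
    funext l
    refine Fin.cases ?_ (fun l => ?_) l <;> simp
  rw [this, Fin.val_succ, pow_succ]
  ring

/-- If `X^♭ ∧ ∇_X h = 0` for all `X`, then `h` satisfies the closed conformal equation. -/
theorem gccky_of_wedge {D p : ℕ} {e : Fin D → Covector D} {E : Fin D → Fin D → ℝ}
    {g : TwoTensorField D} {x : Fin D → ℝ} (hE : IsDualFrame e E)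
    (he : IsOrthonormalCoframe g x e) (hp : p + 1 ≤ D) {Γ : ConnCoeff D}
    {h : FormField D (p + 1)}
    {B : (Fin D → ℝ) →ₗ[ℝ] Form D (p + 1)} (hB : ∀ u v, covDeriv Γ h x u v = B u v)
    (h0 : ∀ u v, wedgeOne (g x u) (B u) v = 0) :
    (∀ v, covExt Γ h x v = 0) ∧ ∀ X v, covDeriv Γ h x X v =
      1 / (((p + 1 : ℕ) : ℝ) + 1) * covExt Γ h x (Fin.cons X v)
      - 1 / ((D : ℝ) - ((p + 1 : ℕ) : ℝ) + 1) * flatWedgeCodiff g Γ (p + 1) h x X v := by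
  have hd : ∀ v, covExt Γ h x v = 0 := by
    intro v
    rw [covExt_eq hB, ← sum_wedgeOne hE.sum_smul]
    refine Finset.sum_eq_zero fun a _ => ?_
    rw [← hE.metric_frame he a]
    exact h0 _ _
  refine ⟨hd, fun X v => ?_⟩
  have hpol (Y : Fin D → ℝ) (w) : wedgeOne (g x X) (B Y) w + wedgeOne (g x Y) (B X) w = 0 := by
    have h1 := h0 (X + Y) w
    have h2 := h0 X w
    have h3 := h0 Y w
    simp only [wedgeOne, map_add, AlternatingMap.add_apply, LinearMap.add_apply, mul_add, add_mul,
      Finset.sum_add_distrib] at h1 h2 h3 ⊢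
    linarith
  -- The polarized identity is contracted with the frame. In the first summand, inserting `E a`
  -- yields `B X` minus X^♭ times the trace, and the trace is minus the codifferential. In the
  -- second, it multiplies `B X` by D − (p + 1), because a form of degree p + 1 uses that many
  -- directions. Together they give the constant D − (p + 1) + 1 of the conformal equation.
  have hsum : ∑ a, (wedgeOne (g x X) (B (E a)) (Fin.cons (E a) v)
      + wedgeOne (g x (E a)) (B X) (Fin.cons (E a) v)) = 0 :=
    Finset.sum_eq_zero fun a _ => hpol _ _
  have hA : ∑ a, wedgeOne (g x X) (B (E a)) (Fin.cons (E a) v)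
      = B X v + flatWedgeCodiff g Γ (p + 1) h x X v := by
    simp only [wedgeOne_cons, Finset.sum_sub_distrib]
    rw [sub_eq_add_neg]
    congr 1
    · have h1 : X = ∑ a, g x X (E a) • E a := by
        conv_lhs => rw [← hE.sum_smul X]
        refine Finset.sum_congr rfl fun a _ => ?_
        rw [he]
        simp [hE _ a]
      conv_rhs => rw [h1]
      simp [form_sum_apply]
    · simp only [flatWedgeCodiff, wedgeOne]
      rw [Finset.sum_comm, ← Finset.sum_neg_distrib]
      refine Finset.sum_congr rfl fun i _ => ?_
      rw [codiff_eq hE he hB, mul_neg, Finset.mul_sum]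
  have hC : ∑ a, wedgeOne (g x (E a)) (B X) (Fin.cons (E a) v) = ((D : ℝ) - (p + 1)) * B X v := by
    simp only [wedgeOne_cons, Finset.sum_sub_distrib, hE.metric_frame he]
    have h1 : ∑ a, (e a) (E a) * B X v = D * B X v := by
      simp [hE _ _]
    have h2 : ∑ a, wedgeOne (e a) (fun r => B X (Fin.cons (E a) r)) v = ((p : ℝ) + 1) * B X v := by
      have := sum_wedgeOne hE.sum_smul (B X).curryLeft v
      rw [AlternatingMap.alternatizeUncurryFin_curryLeft] at this
      refine Eq.trans this ?_
      simp
    rw [h1, h2]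
    ring
  rw [Finset.sum_add_distrib, hA, hC] at hsum
  have hne : (D : ℝ) - ((p + 1 : ℕ) : ℝ) + 1 ≠ 0 := by
    have : ((p + 1 : ℕ) : ℝ) ≤ D := by exact_mod_cast hp
    linarith
  rw [hd, hB]
  push_cast at hne hsum ⊢
  field_simp
  linear_combination ((p : ℝ) + 1 + 1) * hsum

end

section
/-! ### Directional derivatives -/

/-- `f` is differentiable at `x` and `D_u f (x) = c`. -/
def HasDirDeriv {D : ℕ} (f : (Fin D → ℝ) → ℝ) (x u : Fin D → ℝ) (c : ℝ) : Prop :=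
  DifferentiableAt ℝ f x ∧ fderiv ℝ f x u = c

namespace HasDirDeriv

variable {D : ℕ} {f f' : (Fin D → ℝ) → ℝ} {x u : Fin D → ℝ} {c c' : ℝ}

theorem of_hasFDerivAt {L : (Fin D → ℝ) →L[ℝ] ℝ} (h : HasFDerivAt f L x) (hc : L u = c) :
    HasDirDeriv f x u c := ⟨h.differentiableAt, by rw [h.fderiv, hc]⟩

theorem of_differentiableAt (h : DifferentiableAt ℝ f x) : HasDirDeriv f x u (fderiv ℝ f x u) :=
  ⟨h, rfl⟩

theorem congr_deriv (h : HasDirDeriv f x u c) (hc : c = c') : HasDirDeriv f x u c' := hc ▸ h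

theorem congr_of_eventuallyEq (h : HasDirDeriv f x u c) (hf : f' =ᶠ[nhds x] f) :
    HasDirDeriv f' x u c :=
  ⟨h.1.congr_of_eventuallyEq hf, by rw [hf.fderiv_eq, h.2]⟩

theorem const (r : ℝ) : HasDirDeriv (fun _ => r) x u 0 :=
  of_hasFDerivAt (hasFDerivAt_const r x) rfl

theorem add (h : HasDirDeriv f x u c) (h' : HasDirDeriv f' x u c') :
    HasDirDeriv (fun y => f y + f' y) x u (c + c') :=
  of_hasFDerivAt (h.1.hasFDerivAt.add h'.1.hasFDerivAt) (by simp [h.2, h'.2])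

theorem sub (h : HasDirDeriv f x u c) (h' : HasDirDeriv f' x u c') :
    HasDirDeriv (fun y => f y - f' y) x u (c - c') :=
  of_hasFDerivAt (h.1.hasFDerivAt.sub h'.1.hasFDerivAt) (by simp [h.2, h'.2])

theorem mul (h : HasDirDeriv f x u c) (h' : HasDirDeriv f' x u c') :
    HasDirDeriv (fun y => f y * f' y) x u (c * f' x + f x * c') :=
  of_hasFDerivAt (h.1.hasFDerivAt.mul h'.1.hasFDerivAt) (by simp [h.2, h'.2]; ring)

theorem const_mul (r : ℝ) (h : HasDirDeriv f x u c) :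
    HasDirDeriv (fun y => r * f y) x u (r * c) :=
  ((const r).mul h).congr_deriv (by ring)

theorem sum {ι : Type*} {s : Finset ι} {f : ι → (Fin D → ℝ) → ℝ} {c : ι → ℝ}
    (h : ∀ i ∈ s, HasDirDeriv (f i) x u (c i)) :
    HasDirDeriv (fun y => ∑ i ∈ s, f i y) x u (∑ i ∈ s, c i) :=
  of_hasFDerivAt (HasFDerivAt.fun_sum fun i hi => (h i hi).1.hasFDerivAt) (by
    rw [_root_.sum_apply]
    exact Finset.sum_congr rfl fun i hi => (h i hi).2)

theorem prod {ι : Type*} [DecidableEq ι] {s : Finset ι} {f : ι → (Fin D → ℝ) → ℝ} {c : ι → ℝ}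
    (h : ∀ i ∈ s, HasDirDeriv (f i) x u (c i)) :
    HasDirDeriv (fun y => ∏ i ∈ s, f i y) x u (∑ i ∈ s, c i * ∏ k ∈ s.erase i, f k x) :=
  of_hasFDerivAt (HasFDerivAt.finsetProd fun i hi => (h i hi).1.hasFDerivAt) (by
    rw [_root_.sum_apply]
    refine Finset.sum_congr rfl fun i hi => ?_
    simp [(h i hi).2, mul_comm])

theorem comp {w : ℝ → ℝ} {d : ℝ} (hw : HasDerivAt w d (f x)) (h : HasDirDeriv f x u c) :
    HasDirDeriv (fun y => w (f y)) x u (d * c) :=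
  of_hasFDerivAt (hw.comp_hasFDerivAt x h.1.hasFDerivAt) (by simp [h.2])

theorem inv (h : HasDirDeriv f x u c) (h0 : f x ≠ 0) :
    HasDirDeriv (fun y => (f y)⁻¹) x u (-c / f x ^ 2) :=
  (comp (hasDerivAt_inv h0) h).congr_deriv (by ring)

theorem sqrt (h : HasDirDeriv f x u c) (h0 : 0 < f x) :
    HasDirDeriv (fun y => Real.sqrt (f y)) x u (c / (2 * Real.sqrt (f x))) :=
  (comp (Real.hasDerivAt_sqrt h0.ne') h).congr_deriv (by ring)

theorem coord (a : Fin D) : HasDirDeriv (fun y => y a) x u (u a) :=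
  of_hasFDerivAt (hasFDerivAt_apply a x) rfl

end HasDirDeriv

/-! ### Covariant derivatives of covector fields and of forms -/

/-- `∇_u α = β` at `x`, where `G v = ∇_u v` for constant vector fields `v`. -/
def HasCov {D : ℕ} (G : (Fin D → ℝ) → Fin D → ℝ) (x u : Fin D → ℝ)
    (α : (Fin D → ℝ) → Covector D) (β : Covector D) : Prop :=
  ∀ v, HasDirDeriv (fun y => α y v) x u (β v + α x (G v))

/-- `∇_u θ = η` at `x`, where `G v = ∇_u v` for constant vector fields `v`. -/
def HasCovForm {D p : ℕ} (G : (Fin D → ℝ) → Fin D → ℝ) (x u : Fin D → ℝ)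
    (θ : FormField D p) (η : Form D p) : Prop :=
  ∀ v, HasDirDeriv (fun y => θ y v) x u (η v + ∑ i, θ x (Function.update v i (G (v i))))

variable {D p : ℕ} {x u : Fin D → ℝ}

theorem HasCov.smul {G : (Fin D → ℝ) → Fin D → ℝ} {α : (Fin D → ℝ) → Covector D} {β : Covector D}
    {f : (Fin D → ℝ) → ℝ} {c : ℝ} (hf : HasDirDeriv f x u c) (h : HasCov G x u α β) :
    HasCov G x u (fun y => f y • α y) (c • α x + f x • β) := fun v =>
  (hf.mul (h v)).congr_deriv (by simp; ring)

theorem HasCovForm.covDeriv_eq {Γ : ConnCoeff D} {θ : FormField D p} {η : Form D p}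
    (h : HasCovForm (Γ x u) x u θ η) (v : Fin p → Fin D → ℝ) : covDeriv Γ θ x u v = η v := by
  rw [covDeriv, (h v).2]; ring

theorem HasCovForm.congr_of_eventuallyEq {G : (Fin D → ℝ) → Fin D → ℝ} {θ θ' : FormField D p}
    {η : Form D p} (h : HasCovForm G x u θ η) (hθ : θ' =ᶠ[nhds x] θ) : HasCovForm G x u θ' η :=
  fun v => by
    rw [hθ.self_of_nhds]
    exact (h v).congr_of_eventuallyEq (hθ.fun_comp fun β => β v)

theorem HasCovForm.smul {G : (Fin D → ℝ) → Fin D → ℝ} {θ : FormField D p} {η : Form D p}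
    {f : (Fin D → ℝ) → ℝ} {c : ℝ} (hf : HasDirDeriv f x u c) (h : HasCovForm G x u θ η) :
    HasCovForm G x u (fun y => f y • θ y) (c • θ x + f x • η) := fun v =>
  (hf.mul (h v)).congr_deriv (by
    simp only [AlternatingMap.add_apply, AlternatingMap.smul_apply, smul_eq_mul, ← Finset.mul_sum]
    ring)

theorem HasCovForm.const_smul {G : (Fin D → ℝ) → Fin D → ℝ} {θ : FormField D p} {η : Form D p}
    (r : ℝ) (h : HasCovForm G x u θ η) :
    HasCovForm G x u (fun y => r • θ y) (r • η) := by
  simpa using HasCovForm.smul (HasDirDeriv.const r) h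

theorem HasCovForm.sum {G : (Fin D → ℝ) → Fin D → ℝ} {ι : Type*} {s : Finset ι}
    {θ : ι → FormField D p} {η : ι → Form D p} (h : ∀ i ∈ s, HasCovForm G x u (θ i) (η i)) :
    HasCovForm G x u (fun y => ∑ i ∈ s, θ i y) (∑ i ∈ s, η i) := fun v => by
  simp only [form_sum_apply]
  refine (HasDirDeriv.sum fun i hi => h i hi v).congr_deriv ?_
  rw [Finset.sum_add_distrib]
  congr 1
  exact Finset.sum_comm

/-- The Leibniz rule for ∇_u on a product of covectors, obtained by differentiating the determinant
term by term. -/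
theorem HasCovForm.covWedge {G : (Fin D → ℝ) → Fin D → ℝ} {α : Fin p → (Fin D → ℝ) → Covector D}
    {β : Fin p → Covector D} (h : ∀ i, HasCov G x u (α i) (β i)) :
    HasCovForm G x u (fun y => covWedge fun i => α i y)
      (∑ i, KillingYano.covWedge (Function.update (fun i => α i x) i (β i))) := fun v => by
  simp only [covWedge_eq_sum, form_sum_apply]
  refine (HasDirDeriv.sum fun σ _ => ?_ : HasDirDeriv _ x u (∑ σ : Equiv.Perm (Fin p),
    Equiv.Perm.sign σ • ∑ i, (β i (v (σ i)) + α i x (G (v (σ i)))) *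
      ∏ k ∈ Finset.univ.erase i, α k x (v (σ k)))).congr_deriv ?_
  · have := HasDirDeriv.const_mul ((Equiv.Perm.sign σ : ℤ) : ℝ)
      (HasDirDeriv.prod (s := Finset.univ) fun i _ => h i (v (σ i)))
    simp only [Units.smul_def, zsmul_eq_mul]
    exact this
  · have hup {T : Type} (a : Fin p → T) (i : Fin p) (t : T) (F : Fin p → T → ℝ) :
        ∏ k, F k (Function.update a i t k) = F i t * ∏ k ∈ Finset.univ.erase i, F k (a k) := by
      rw [← Finset.mul_prod_erase _ _ (Finset.mem_univ i)]
      simp only [Function.update_self]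
      congr 1
      refine Finset.prod_congr rfl fun k hk => ?_
      rw [Function.update_of_ne (Finset.ne_of_mem_erase hk)]
    have h1 (i : Fin p) (σ : Equiv.Perm (Fin p)) :
        ∏ k, (Function.update (fun i => α i x) i (β i)) k (v (σ k))
          = β i (v (σ i)) * ∏ k ∈ Finset.univ.erase i, α k x (v (σ k)) :=
      hup (fun i => α i x) i (β i) fun k θ => θ (v (σ k))
    have h2 (i : Fin p) (σ : Equiv.Perm (Fin p)) :
        ∏ k, α k x (Function.update v (σ i) (G (v (σ i))) (σ k))
          = α i x (G (v (σ i))) * ∏ k ∈ Finset.univ.erase i, α k x (v (σ k)) := by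
      have := hup (v ∘ σ) i (G (v (σ i))) fun k w => α k x w
      simp only [Function.comp_apply] at this
      rw [← this]
      refine Finset.prod_congr rfl fun k _ => ?_
      by_cases hk : k = i
      · subst hk; simp
      · rw [Function.update_of_ne hk, Function.update_of_ne (fun h => hk (σ.injective h))]
        rfl
    rw [Finset.sum_comm, Finset.sum_comm (s := (Finset.univ : Finset (Fin p))) (t := Finset.univ)
      (f := fun i σ => Equiv.Perm.sign σ • ∏ k, α k x (Function.update v i (G (v i)) (σ k))),
      ← Finset.sum_add_distrib]
    refine Finset.sum_congr rfl fun σ _ => ?_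
    -- The corrections in `G` are indexed by vector slots and the derivatives by covector slots;
    -- within one term of the determinant `σ` matches them.
    rw [← Equiv.sum_comp σ (fun i => Equiv.Perm.sign σ •
      ∏ k, α k x (Function.update v i (G (v i)) (σ k))), ← Finset.smul_sum, ← Finset.smul_sum, ← smul_add,
      ← Finset.sum_add_distrib]
    congr 1
    refine Finset.sum_congr rfl fun i _ => ?_
    rw [h1, h2, add_mul]

/-- If `∇_u` depends linearly on `u`, so does `∇_u θ`. -/
theorem exists_linear_covDeriv {Γ : ConnCoeff D} {θ : FormField D p}
    (hadd : ∀ u u' v, Γ x (u + u') v = Γ x u v + Γ x u' v)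
    (hsmul : ∀ (r : ℝ) u v, Γ x (r • u) v = r • Γ x u v)
    (η : (Fin D → ℝ) → Form D p) (h : ∀ u, HasCovForm (Γ x u) x u θ (η u)) :
    ∃ B : (Fin D → ℝ) →ₗ[ℝ] Form D p, (∀ u, B u = η u) ∧ ∀ u v, covDeriv Γ θ x u v = B u v := by
  refine ⟨{ toFun := η, map_add' := fun u u' => ?_, map_smul' := fun r u => ?_ },
    fun u => rfl, fun u v => (h u).covDeriv_eq v⟩
  · ext v
    rw [AlternatingMap.add_apply, ← (h _).covDeriv_eq, ← (h _).covDeriv_eq, ← (h _).covDeriv_eq]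
    simp only [covDeriv, hadd, map_add, AlternatingMap.map_update_add, Finset.sum_add_distrib]
    ring
  · ext v
    rw [RingHom.id_apply, AlternatingMap.smul_apply, ← (h _).covDeriv_eq, ← (h _).covDeriv_eq]
    simp only [covDeriv, hsmul, map_smul, AlternatingMap.map_update_smul, ← Finset.smul_sum,
      smul_sub]

end

section
/-! ### Elementary symmetric polynomials in the coordinates `x_μ` -/

variable {n : ℕ}

/-- The `k`-th elementary symmetric polynomial in the `x_ν` with `ν ∈ s`. -/
def esym (s : Finset (Fin n)) (k : ℕ) (x : Fin (n + (n + 1)) → ℝ) : ℝ :=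
  ∑ t ∈ s.powersetCard k, ∏ ν ∈ t, x (xIdx ν)

theorem esym_zero (s : Finset (Fin n)) (x : Fin (n + (n + 1)) → ℝ) : esym s 0 x = 1 := by
  simp [esym]

theorem esym_insert {s : Finset (Fin n)} {a : Fin n} (ha : a ∉ s) (k : ℕ)
    (x : Fin (n + (n + 1)) → ℝ) :
    esym (insert a s) (k + 1) x = esym s (k + 1) x + x (xIdx a) * esym s k x := by
  have hd : Disjoint (s.powersetCard (k + 1)) ((s.powersetCard k).image (insert a)) := by
    rw [Finset.disjoint_left]
    intro t ht ht'
    obtain ⟨t', -, rfl⟩ := Finset.mem_image.1 ht'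
    exact ha ((Finset.mem_powersetCard.1 ht).1 (Finset.mem_insert_self _ _))
  have hnot {t : Finset (Fin n)} (ht : t ∈ s.powersetCard k) : a ∉ t :=
    fun h => ha ((Finset.mem_powersetCard.1 ht).1 h)
  rw [esym, Finset.powersetCard_succ_insert ha, Finset.sum_union hd, Finset.sum_image, esym, esym,
    Finset.mul_sum]
  · congr 1
    exact Finset.sum_congr rfl fun t ht => Finset.prod_insert (hnot ht)
  · intro t ht t' ht' h
    rw [← Finset.erase_insert (hnot ht), ← Finset.erase_insert (hnot ht'), h]

theorem hasDirDeriv_esym (s : Finset (Fin n)) (k : ℕ) (x u : Fin (n + (n + 1)) → ℝ) :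
    HasDirDeriv (esym s (k + 1)) x u (∑ ν ∈ s, u (xIdx ν) * esym (s.erase ν) k x) := by
  induction s using Finset.induction generalizing k with
  | empty =>
    have : esym (∅ : Finset (Fin n)) (k + 1) = fun _ => 0 := by
      funext y; rw [esym, Finset.powersetCard_eq_empty.2 (by simp), Finset.sum_empty]
    rw [this]
    simpa using HasDirDeriv.const 0
  | insert a s ha ih =>
    have h1 : esym (insert a s) (k + 1)
        = fun y => esym s (k + 1) y + y (xIdx a) * esym s k y := by
      funext y; exact esym_insert ha k y
    have h2 : ∑ ν ∈ s, u (xIdx ν) * esym ((insert a s).erase ν) k x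
        = ∑ ν ∈ s, u (xIdx ν) * esym (insert a (s.erase ν)) k x := by
      refine Finset.sum_congr rfl fun ν hν => ?_
      rw [Finset.erase_insert_of_ne (fun h => ha (by rw [h]; exact hν))]
    rw [h1, Finset.sum_insert ha, Finset.erase_insert ha, h2]
    rcases k with _ | k
    · have h3 : esym s 0 = fun _ => 1 := by funext y; exact esym_zero s y
      refine ((ih 0).add ((HasDirDeriv.coord _).mul (c' := 0) ?_)).congr_deriv ?_
      · rw [h3]; exact HasDirDeriv.const 1
      · simp only [esym_zero]; ring
    · refine ((ih (k + 1)).add ((HasDirDeriv.coord _).mul (ih k))).congr_deriv ?_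
      have (ν : Fin n) : esym (insert a (s.erase ν)) (k + 1) x
          = esym (s.erase ν) (k + 1) x + x (xIdx a) * esym (s.erase ν) k x :=
        esym_insert (fun h => ha (Finset.mem_of_mem_erase h)) k x
      simp only [this, mul_add, Finset.sum_add_distrib, Finset.mul_sum]
      have h4 : ∑ i ∈ s, x (xIdx a) * (u (xIdx i) * esym (s.erase i) k x)
          = ∑ i ∈ s, u (xIdx i) * (x (xIdx a) * esym (s.erase i) k x) :=
        Finset.sum_congr rfl fun _ _ => by ring
      rw [h4]
      ring

theorem prod_sub_eq_sum_esym (s : Finset (Fin n)) (t : ℝ) (x : Fin (n + (n + 1)) → ℝ) :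
    ∏ ρ ∈ s, (t - x (xIdx ρ))
      = ∑ k ∈ Finset.range (s.card + 1), (-1) ^ k * esym s k x * t ^ (s.card - k) := by
  have h : ∏ ρ ∈ s, (t - x (xIdx ρ)) = ∏ ρ ∈ s, (-x (xIdx ρ) + t) :=
    Finset.prod_congr rfl fun _ _ => by ring
  rw [h, Finset.prod_add, Finset.sum_powerset]
  refine Finset.sum_congr rfl fun k _ => ?_
  rw [esym, Finset.mul_sum, Finset.sum_mul]
  refine Finset.sum_congr rfl fun a ha => ?_
  obtain ⟨ha, hk⟩ := Finset.mem_powersetCard.1 ha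
  rw [Finset.prod_const, Finset.card_sdiff_of_subset ha, Finset.prod_neg, hk]

theorem esym_erase_erase {μ ν : Fin n} (h : μ ≠ ν) (k : ℕ) (x : Fin (n + (n + 1)) → ℝ) :
    sigmaErase ν (k + 1) x - sigmaErase μ (k + 1) x
      = (x (xIdx μ) - x (xIdx ν)) * esym ((Finset.univ.erase μ).erase ν) k x := by
  have h1 := esym_insert (s := (Finset.univ.erase μ).erase ν) (a := ν) (by simp) k x
  have h2 := esym_insert (s := (Finset.univ.erase ν).erase μ) (a := μ) (by simp) k x
  rw [Finset.insert_erase (by simp [h.symm])] at h1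
  rw [Finset.insert_erase (by simp [h]), Finset.erase_right_comm] at h2
  change esym (Finset.univ.erase ν) (k + 1) x - esym (Finset.univ.erase μ) (k + 1) x = _
  rw [h1, h2]
  ring

/-- Both polynomials are expanded over the set with μ and ν removed, so the partial derivative is a
divided difference. In this form it is linear in the σ's with coefficients independent of `k`, and
passes at once to `theta` and to the Killing tensors. -/
theorem hasDirDeriv_sigmaErase (μ : Fin n) (k : ℕ) {x : Fin (n + (n + 1)) → ℝ}
    (hne : ∀ μ ν : Fin n, μ ≠ ν → x (xIdx μ) ≠ x (xIdx ν)) (u : Fin (n + (n + 1)) → ℝ) :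
    HasDirDeriv (sigmaErase μ k) x u (∑ ν ∈ Finset.univ.erase μ,
      u (xIdx ν) * ((sigmaErase ν k x - sigmaErase μ k x) / (x (xIdx μ) - x (xIdx ν)))) := by
  rcases k with _ | k
  · have h (ρ : Fin n) : sigmaErase ρ 0 = fun _ => 1 := by funext y; exact esym_zero _ y
    simp only [h, sub_self, zero_div, mul_zero, Finset.sum_const_zero]
    exact HasDirDeriv.const 1
  · refine (hasDirDeriv_esym (Finset.univ.erase μ) k x u).congr_deriv ?_
    refine Finset.sum_congr rfl fun ν hν => ?_
    have hμν : μ ≠ ν := (Finset.ne_of_mem_erase hν).symm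
    rw [esym_erase_erase hμν, mul_div_cancel_left₀ _ (sub_ne_zero.2 (hne μ ν hμν))]

/-! ### The coframe and its derivatives -/

/-- The conditions on a point under which the coframe is defined and differentiable. -/
structure IsRegularPoint (X N : Fin n → ℝ → ℝ) (x : Fin (n + (n + 1)) → ℝ) : Prop where
  pos : ∀ μ : Fin n, 0 < x (xIdx μ)
  ne : ∀ μ ν : Fin n, μ ≠ ν → x (xIdx μ) ≠ x (xIdx ν)
  Q_pos : ∀ μ : Fin n, 0 < Q X μ x
  diffX : ∀ μ : Fin n, DifferentiableAt ℝ (X μ) (x (xIdx μ))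
  diffN : ∀ μ : Fin n, DifferentiableAt ℝ (N μ) (x (xIdx μ))

/-- The index of the coordinate `ψ_{k+1}`. -/
def hatIdx (μ : Fin n) : Fin (n + (n + 1)) := psiIdx μ.succ

/-- The orthonormal coframe, indexed by `e^μ`, `e^0`, `e^μ̂` in this order. -/
def coframe (X N : Fin n → ℝ → ℝ) (x : Fin (n + (n + 1)) → ℝ) :
    Fin (n + (n + 1)) → Covector (n + (n + 1)) :=
  Fin.append (fun μ => frameX X μ x) (Fin.cons (frameZero N x) fun μ => frameHat X μ x)

@[simp] theorem coframe_xIdx (X N : Fin n → ℝ → ℝ) (x : Fin (n + (n + 1)) → ℝ) (μ : Fin n) :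
    coframe X N x (xIdx μ) = frameX X μ x := by simp [coframe, xIdx]

@[simp] theorem coframe_psiIdx_zero (X N : Fin n → ℝ → ℝ) (x : Fin (n + (n + 1)) → ℝ) :
    coframe X N x (psiIdx 0) = frameZero N x := by
  rw [coframe, psiIdx, Fin.append_right, Fin.cons_zero]

@[simp] theorem coframe_hatIdx (X N : Fin n → ℝ → ℝ) (x : Fin (n + (n + 1)) → ℝ) (μ : Fin n) :
    coframe X N x (hatIdx μ) = frameHat X μ x := by
  rw [coframe, hatIdx, psiIdx, Fin.append_right, Fin.cons_succ]

theorem sum_frame_index {W : Type*} [AddCommMonoid W] (f : Fin (n + (n + 1)) → W) :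
    ∑ a, f a = ∑ μ, f (xIdx μ) + (f (psiIdx 0) + ∑ μ, f (hatIdx μ)) := by
  rw [Fin.sum_univ_add, Fin.sum_univ_succ]
  rfl

theorem forall_frame_index {P : Fin (n + (n + 1)) → Prop} (h1 : ∀ μ, P (xIdx μ))
    (h2 : P (psiIdx 0)) (h3 : ∀ μ, P (hatIdx μ)) (a : Fin (n + (n + 1))) : P a := by
  refine Fin.addCases h1 (fun k => ?_) a
  exact Fin.cases h2 h3 k

@[simp] theorem xIdx_inj {μ ν : Fin n} : xIdx μ = xIdx ν ↔ μ = ν := by simp [xIdx]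

@[simp] theorem hatIdx_inj {μ ν : Fin n} : hatIdx μ = hatIdx ν ↔ μ = ν := by
  simp [hatIdx, psiIdx]

@[simp] theorem xIdx_ne_psiIdx (μ : Fin n) (k : Fin (n + 1)) : xIdx μ ≠ psiIdx k := by
  intro h
  have := congrArg Fin.val h
  simp [xIdx, psiIdx] at this
  omega

@[simp] theorem xIdx_ne_hatIdx (μ ν : Fin n) : xIdx μ ≠ hatIdx ν := xIdx_ne_psiIdx _ _

@[simp] theorem psiIdx_zero_ne_hatIdx (μ : Fin n) : psiIdx 0 ≠ hatIdx μ := by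
  simp [hatIdx, psiIdx, Fin.ext_iff]

theorem U_ne_zero {x : Fin (n + (n + 1)) → ℝ}
    (hne : ∀ μ ν : Fin n, μ ≠ ν → x (xIdx μ) ≠ x (xIdx ν)) (μ : Fin n) : U μ x ≠ 0 :=
  Finset.prod_ne_zero_iff.2 fun ν hν => sub_ne_zero.2 (hne μ ν (Finset.ne_of_mem_erase hν).symm)

/-- Used with `X μ` for Q_μ and with `N μ` for the potential. Only the derivatives in the other
coordinates are needed explicitly; `c` collects everything proportional to dx_μ, including the
derivative of `f`. -/
theorem hasDirDeriv_div_U {x : Fin (n + (n + 1)) → ℝ}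
    (hne : ∀ μ ν : Fin n, μ ≠ ν → x (xIdx μ) ≠ x (xIdx ν)) (μ : Fin n) {f : ℝ → ℝ}
    (hf : DifferentiableAt ℝ f (x (xIdx μ))) :
    ∃ c : ℝ, ∀ u, HasDirDeriv (fun y => f (y (xIdx μ)) / U μ y) x u
      (c * u (xIdx μ) + ∑ ν ∈ Finset.univ.erase μ,
        f (x (xIdx μ)) / U μ x * (u (xIdx ν) / (x (xIdx μ) - x (xIdx ν)))) := by
  have hU := U_ne_zero hne μ
  refine ⟨deriv f (x (xIdx μ)) / U μ x - f (x (xIdx μ)) / U μ x *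
    ∑ ν ∈ Finset.univ.erase μ, 1 / (x (xIdx μ) - x (xIdx ν)), fun u => ?_⟩
  have h1 : HasDirDeriv (U μ) x u (∑ ν ∈ Finset.univ.erase μ,
      U μ x * ((u (xIdx μ) - u (xIdx ν)) / (x (xIdx μ) - x (xIdx ν)))) := by
    refine (HasDirDeriv.prod (s := Finset.univ.erase μ) (fun ν _ =>
      (HasDirDeriv.coord (xIdx μ)).sub (HasDirDeriv.coord (xIdx ν)))).congr_deriv ?_
    refine Finset.sum_congr rfl fun ν hν => ?_
    have hx := sub_ne_zero.2 (hne μ ν (Finset.ne_of_mem_erase hν).symm)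
    rw [U, ← Finset.mul_prod_erase _ _ hν]
    field_simp
  have h2 := (HasDirDeriv.comp hf.hasDerivAt (HasDirDeriv.coord (xIdx μ) (u := u))).mul (h1.inv hU)
  simp only [div_eq_mul_inv]
  refine h2.congr_deriv ?_
  have h3 : ∑ ν ∈ Finset.univ.erase μ, (u (xIdx μ) - u (xIdx ν)) / (x (xIdx μ) - x (xIdx ν))
      = u (xIdx μ) * ∑ ν ∈ Finset.univ.erase μ, 1 * (x (xIdx μ) - x (xIdx ν))⁻¹
        - ∑ ν ∈ Finset.univ.erase μ, u (xIdx ν) * (x (xIdx μ) - x (xIdx ν))⁻¹ := by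
    rw [Finset.mul_sum, ← Finset.sum_sub_distrib]
    exact Finset.sum_congr rfl fun _ _ => by ring
  simp only [← Finset.mul_sum, ← div_eq_mul_inv] at h3 ⊢
  rw [h3]
  field_simp
  ring

theorem theta_apply (μ : Fin n) (x v : Fin (n + (n + 1)) → ℝ) :
    theta μ x v = ∑ k : Fin n, sigmaErase μ k x * v (hatIdx k) := by
  simp [theta, coordForm, hatIdx, LinearMap.sum_apply]

theorem hasDirDeriv_theta {x : Fin (n + (n + 1)) → ℝ}
    (hne : ∀ μ ν : Fin n, μ ≠ ν → x (xIdx μ) ≠ x (xIdx ν)) (μ : Fin n)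
    (u v : Fin (n + (n + 1)) → ℝ) :
    HasDirDeriv (fun y => theta μ y v) x u (∑ ν ∈ Finset.univ.erase μ,
      u (xIdx ν) * ((theta ν x v - theta μ x v) / (x (xIdx μ) - x (xIdx ν)))) := by
  simp only [theta_apply]
  refine (HasDirDeriv.sum fun (k : Fin n) _ => (hasDirDeriv_sigmaErase μ k hne u).mul
    (HasDirDeriv.const (v (hatIdx k)))).congr_deriv ?_
  simp only [mul_zero, add_zero, Finset.sum_mul]
  rw [Finset.sum_comm]
  refine Finset.sum_congr rfl fun ν _ => ?_
  rw [← Finset.sum_sub_distrib, Finset.sum_div, Finset.mul_sum]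
  exact Finset.sum_congr rfl fun k _ => by ring

theorem sum_erase_comm {W : Type*} [AddCommMonoid W] (f : Fin n → Fin n → W) :
    ∑ μ, ∑ ν ∈ Finset.univ.erase μ, f μ ν = ∑ μ, ∑ ν ∈ Finset.univ.erase μ, f ν μ := by
  refine Finset.sum_comm' fun μ ν => ?_
  simp [ne_comm]

/-- The elementary symmetric part contributes Σ_μ dx_μ θ_μ. In the potential, for μ ≠ ν, the terms
with dx_ν θ_μ from differentiating N_μ/U_μ and from differentiating θ_μ cancel. What is left
multiplies dx_ν θ_ν, and its coefficients add up to ∂H/∂x_ν. -/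
theorem hasDirDeriv_contact {N : Fin n → ℝ → ℝ} {x : Fin (n + (n + 1)) → ℝ}
    (hne : ∀ μ ν : Fin n, μ ≠ ν → x (xIdx μ) ≠ x (xIdx ν))
    (hN : ∀ μ : Fin n, DifferentiableAt ℝ (N μ) (x (xIdx μ)))
    (u v : Fin (n + (n + 1)) → ℝ) :
    HasDirDeriv (fun y => contact N y v) x u (∑ μ : Fin n,
      (1 + fderiv ℝ (H N) x (coordVec (xIdx μ))) * (u (xIdx μ) * theta μ x v)) := by
  choose c hc using fun μ => hasDirDeriv_div_U hne μ (hN μ)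
  have hH (u) : HasDirDeriv (H N) x u (∑ μ, (c μ * u (xIdx μ) + ∑ ν ∈ Finset.univ.erase μ,
        N μ (x (xIdx μ)) / U μ x * (u (xIdx ν) / (x (xIdx μ) - x (xIdx ν))))) :=
    HasDirDeriv.sum fun μ _ => hc μ u
  have hH' (μ : Fin n) : fderiv ℝ (H N) x (coordVec (xIdx μ)) = c μ +
      ∑ ν ∈ Finset.univ.erase μ, N ν (x (xIdx ν)) / U ν x * (1 / (x (xIdx ν) - x (xIdx μ))) := by
    rw [(hH _).2, Finset.sum_add_distrib, sum_erase_comm]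
    congr 1
    · simp [coordVec, Pi.single_apply]
    · rw [Finset.sum_eq_single μ]
      · simp [coordVec]
      · intro ρ _ hρ
        simp [coordVec, hρ]
      · simp
  have happly (y : Fin (n + (n + 1)) → ℝ) : contact N y v
      = (∑ k : Fin n, sigma ((k : ℕ) + 1) y * v (hatIdx k) + v (psiIdx 0))
        + ∑ μ, N μ (y (xIdx μ)) / U μ y * theta μ y v := by
    simp only [contact, potentialA, LinearMap.add_apply, LinearMap.sum_apply,
      LinearMap.smul_apply, smul_eq_mul, coordForm, LinearMap.proj_apply]
    rw [Fin.sum_univ_succ]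
    have : sigma (n := n) 0 y = 1 := esym_zero _ y
    simp [this, hatIdx]
    ring
  simp only [happly]
  have h1 (k : Fin n) : HasDirDeriv (sigma ((k : ℕ) + 1)) x u
      (∑ μ, u (xIdx μ) * sigmaErase μ k x) := hasDirDeriv_esym Finset.univ k x u
  have h2 := ((HasDirDeriv.sum (s := Finset.univ) fun k _ => (h1 k).mul
    (HasDirDeriv.const (v (hatIdx k)))).add (HasDirDeriv.const (v (psiIdx 0)))).add
    (HasDirDeriv.sum (s := Finset.univ) fun μ _ => (hc μ u).mul (hasDirDeriv_theta hne μ u v))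
  refine h2.congr_deriv ?_
  simp only [hH', add_mul, one_mul, mul_zero, add_zero, Finset.sum_add_distrib, Finset.sum_mul,
    Finset.mul_sum]
  rw [sum_erase_comm (fun μ ν => N ν (x (xIdx ν)) / U ν x * (1 / (x (xIdx ν) - x (xIdx μ))) *
    (u (xIdx μ) * theta μ x v)), add_assoc, ← Finset.sum_add_distrib (s := Finset.univ)
    (f := fun μ => ∑ ν ∈ Finset.univ.erase μ, _ * _ * theta μ x v)]
  congr 1
  · rw [Finset.sum_comm]
    refine Finset.sum_congr rfl fun μ _ => ?_
    rw [theta_apply, Finset.mul_sum]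
    exact Finset.sum_congr rfl fun _ _ => by ring
  · congr 1
    · exact Finset.sum_congr rfl fun _ _ => by ring
    · refine Finset.sum_congr rfl fun μ _ => ?_
      rw [← Finset.sum_add_distrib]
      exact Finset.sum_congr rfl fun _ _ => by ring

end

section
variable {n : ℕ}

/-! ### The dual frame -/

/-- The vector in the span of `∂/∂ψ_1, …, ∂/∂ψ_n` dual to `theta μ`. -/
def thetaDual (μ : Fin n) (x : Fin (n + (n + 1)) → ℝ) : Fin (n + (n + 1)) → ℝ :=
  ∑ k : Fin n, ((-1) ^ (k : ℕ) * x (xIdx μ) ^ (n - 1 - k) / U μ x) • coordVec (hatIdx k)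

/-- The orthonormal frame dual to `coframe`. -/
def frame (X N : Fin n → ℝ → ℝ) (x : Fin (n + (n + 1)) → ℝ) :
    Fin (n + (n + 1)) → Fin (n + (n + 1)) → ℝ :=
  Fin.append (fun μ => Real.sqrt (Q X μ x) • coordVec (xIdx μ))
    (Fin.cons ((1 / 2 : ℝ) • coordVec (psiIdx 0)) fun μ => (1 / Real.sqrt (Q X μ x)) •
      (thetaDual μ x - contact N x (thetaDual μ x) • coordVec (psiIdx 0)))

theorem theta_coordVec_hatIdx (μ k : Fin n) (x : Fin (n + (n + 1)) → ℝ) :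
    theta μ x (coordVec (hatIdx k)) = sigmaErase μ k x := by
  rw [theta_apply]
  simp [coordVec, Pi.single_apply]

theorem theta_coordVec_of_forall_ne (μ : Fin n) (x : Fin (n + (n + 1)) → ℝ)
    {a : Fin (n + (n + 1))} (ha : ∀ k, a ≠ hatIdx k) : theta μ x (coordVec a) = 0 := by
  rw [theta_apply]
  refine Finset.sum_eq_zero fun k _ => ?_
  rw [coordVec, Pi.single_eq_of_ne (ha k).symm, mul_zero]

/-- Lagrange interpolation: pairing the signed elementary symmetric polynomials of `theta ν` with
powers of x_μ gives ∏_{ρ≠ν} (x_μ − x_ρ), which vanishes for μ ≠ ν and equals U_μ for μ = ν. -/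
theorem theta_thetaDual {x : Fin (n + (n + 1)) → ℝ}
    (hne : ∀ μ ν : Fin n, μ ≠ ν → x (xIdx μ) ≠ x (xIdx ν)) (ν μ : Fin n) :
    theta ν x (thetaDual μ x) = if ν = μ then 1 else 0 := by
  have hcard : (Finset.univ.erase ν : Finset (Fin n)).card = n - 1 := by simp
  have hn : n - 1 + 1 = n := by have := ν.pos; omega
  have h := prod_sub_eq_sum_esym (Finset.univ.erase ν) (x (xIdx μ)) x
  rw [hcard, hn, ← Fin.sum_univ_eq_sum_range
    (fun k => (-1) ^ k * esym (Finset.univ.erase ν) k x * x (xIdx μ) ^ (n - 1 - k))] at h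
  have h2 : theta ν x (thetaDual μ x)
      = (∏ ρ ∈ Finset.univ.erase ν, (x (xIdx μ) - x (xIdx ρ))) / U μ x := by
    rw [h, thetaDual, map_sum, Finset.sum_div]
    refine Finset.sum_congr rfl fun k _ => ?_
    rw [map_smul, theta_coordVec_hatIdx, smul_eq_mul]
    change _ * esym (Finset.univ.erase ν) k x = _
    ring
  rw [h2]
  split_ifs with hνμ
  · subst hνμ
    exact div_self (U_ne_zero hne ν)
  · rw [Finset.prod_eq_zero (i := μ) (by simp [Ne.symm hνμ]) (by simp), zero_div]

theorem contact_coordVec_xIdx (N : Fin n → ℝ → ℝ) (x : Fin (n + (n + 1)) → ℝ) (μ : Fin n) :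
    contact N x (coordVec (xIdx μ)) = 0 := by
  have h1 : ∀ ν : Fin n, theta ν x (coordVec (xIdx μ)) = 0 := fun ν =>
    theta_coordVec_of_forall_ne ν x fun k => xIdx_ne_hatIdx μ k
  simp only [contact, potentialA, LinearMap.add_apply, LinearMap.sum_apply, LinearMap.smul_apply,
    h1, coordForm, LinearMap.proj_apply, smul_zero, Finset.sum_const_zero, add_zero]
  refine Finset.sum_eq_zero fun k _ => ?_
  rw [coordVec, Pi.single_eq_of_ne (xIdx_ne_psiIdx μ k).symm, smul_zero]

theorem contact_coordVec_psiIdx_zero (N : Fin n → ℝ → ℝ) (x : Fin (n + (n + 1)) → ℝ) :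
    contact N x (coordVec (psiIdx 0)) = 1 := by
  have h1 : ∀ ν : Fin n, theta ν x (coordVec (psiIdx 0)) = 0 := fun ν =>
    theta_coordVec_of_forall_ne ν x fun k => psiIdx_zero_ne_hatIdx k
  have h2 : sigma (n := n) 0 x = 1 := esym_zero _ x
  simp only [contact, potentialA, LinearMap.add_apply, LinearMap.sum_apply, LinearMap.smul_apply,
    h1, coordForm, LinearMap.proj_apply, smul_zero, Finset.sum_const_zero, add_zero]
  rw [Finset.sum_eq_single 0]
  · simp [h2, coordVec]
  · intro k _ hk
    have : psiIdx k ≠ psiIdx (n := n) 0 := by simpa [psiIdx] using hk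
    rw [coordVec, Pi.single_eq_of_ne this, smul_zero]
  · simp

theorem isDualFrame_frame {X N : Fin n → ℝ → ℝ} {x : Fin (n + (n + 1)) → ℝ}
    (hne : ∀ μ ν : Fin n, μ ≠ ν → x (xIdx μ) ≠ x (xIdx ν)) (hQ : ∀ μ : Fin n, 0 < Q X μ x) :
    IsDualFrame (coframe X N x) (frame X N x) := by
  have hs (μ : Fin n) : Real.sqrt (Q X μ x) ≠ 0 := (Real.sqrt_pos.2 (hQ μ)).ne'
  have f1 (μ : Fin n) : frame X N x (xIdx μ) = Real.sqrt (Q X μ x) • coordVec (xIdx μ) := by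
    simp [frame, xIdx]
  have f2 : frame X N x (psiIdx 0) = (1 / 2 : ℝ) • coordVec (psiIdx 0) := by
    rw [frame, psiIdx, Fin.append_right, Fin.cons_zero]
  have f3 (μ : Fin n) : frame X N x (hatIdx μ) = (1 / Real.sqrt (Q X μ x)) •
      (thetaDual μ x - contact N x (thetaDual μ x) • coordVec (psiIdx 0)) := by
    rw [frame, hatIdx, psiIdx, psiIdx, Fin.append_right, Fin.cons_succ]
  have hx0 (ν : Fin n) : coordForm (xIdx ν) (coordVec (psiIdx 0)) = 0 := by
    rw [coordForm, LinearMap.proj_apply, coordVec, Pi.single_eq_of_ne (xIdx_ne_psiIdx ν 0)]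
  have hxx (ν μ : Fin n) : coordForm (xIdx ν) (coordVec (xIdx μ)) = if ν = μ then 1 else 0 := by
    rw [coordForm, LinearMap.proj_apply, coordVec, Pi.single_apply]
    simp
  have hxd (ν μ : Fin n) : coordForm (xIdx ν) (thetaDual μ x) = 0 := by
    rw [thetaDual, map_sum]
    refine Finset.sum_eq_zero fun k _ => ?_
    rw [map_smul, coordForm, LinearMap.proj_apply, coordVec,
      Pi.single_eq_of_ne (xIdx_ne_hatIdx ν k), smul_zero]
  have ht0 (ν : Fin n) : theta ν x (coordVec (psiIdx 0)) = 0 :=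
    theta_coordVec_of_forall_ne ν x fun k => psiIdx_zero_ne_hatIdx k
  have htx (ν μ : Fin n) : theta ν x (coordVec (xIdx μ)) = 0 :=
    theta_coordVec_of_forall_ne ν x fun k => xIdx_ne_hatIdx μ k
  intro a
  induction a using forall_frame_index with
  | h1 ν =>
    intro b
    induction b using forall_frame_index with
    | h1 μ =>
      rw [coframe_xIdx, f1, frameX, LinearMap.smul_apply, map_smul, hxx]
      by_cases h : ν = μ
      · subst h; simp [hs ν]
      · simp [h]
    | h2 => simp [f2, frameX, hx0]
    | h3 μ => simp [f3, frameX, hx0, hxd]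
  | h2 =>
    intro b
    induction b using forall_frame_index with
    | h1 μ => simp [f1, frameZero, contact_coordVec_xIdx, (xIdx_ne_psiIdx μ 0).symm]
    | h2 => simp [f2, frameZero, contact_coordVec_psiIdx_zero]
    | h3 μ => simp [f3, frameZero, contact_coordVec_psiIdx_zero]
  | h3 ν =>
    intro b
    induction b using forall_frame_index with
    | h1 μ => simp [f1, frameHat, htx, (xIdx_ne_hatIdx μ ν).symm]
    | h2 => simp [f2, frameHat, ht0, (psiIdx_zero_ne_hatIdx ν).symm]
    | h3 μ =>
      rw [coframe_hatIdx, f3, frameHat, LinearMap.smul_apply, map_smul, map_sub, map_smul, ht0,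
        theta_thetaDual hne]
      by_cases h : ν = μ
      · subst h; simp [hs ν]
      · simp [h]

theorem isOrthonormalCoframe_coframe {X : Fin n → ℝ → ℝ} (N : Fin n → ℝ → ℝ)
    {x : Fin (n + (n + 1)) → ℝ} (hQ : ∀ μ : Fin n, 0 < Q X μ x) :
    IsOrthonormalCoframe (stMetric X N) x (coframe X N x) := by
  intro u v
  rw [sum_frame_index]
  simp only [coframe_xIdx, coframe_psiIdx_zero, coframe_hatIdx, stMetric, LinearMap.add_apply,
    LinearMap.sum_apply, LinearMap.smul_apply, tensor, frameX, frameHat, frameZero,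
    LinearMap.smulRight_apply, smul_eq_mul]
  have h1 : ∀ μ : Fin n, 1 / Q X μ x = 1 / Real.sqrt (Q X μ x) * (1 / Real.sqrt (Q X μ x)) := by
    intro μ
    rw [div_mul_div_comm, Real.mul_self_sqrt (hQ μ).le, one_mul]
  have h2 : ∀ μ : Fin n, Q X μ x = Real.sqrt (Q X μ x) * Real.sqrt (Q X μ x) := fun μ =>
    (Real.mul_self_sqrt (hQ μ).le).symm
  have e1 : ∑ μ : Fin n, 1 / Q X μ x * (coordForm (xIdx μ) u * coordForm (xIdx μ) v)
      = ∑ μ : Fin n, 1 / Real.sqrt (Q X μ x) * coordForm (xIdx μ) u *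
        (1 / Real.sqrt (Q X μ x) * coordForm (xIdx μ) v) :=
    Finset.sum_congr rfl fun μ _ => by rw [h1]; ring
  have e2 : ∑ μ : Fin n, Q X μ x * (theta μ x u * theta μ x v)
      = ∑ μ : Fin n, Real.sqrt (Q X μ x) * theta μ x u *
        (Real.sqrt (Q X μ x) * theta μ x v) :=
    Finset.sum_congr rfl fun μ _ => by
      conv_lhs => rw [h2]
      ring
  rw [e1, e2]
  ring

/-! ### Recognizing a metric connection with skew torsion -/

/-- Uniqueness of the metric connection with given skew torsion. For constant fields, e^a(∇_u v) =
D_u(e^a(v)) − (∇_u e^a)(v), where `F` is the first term and `ω'` the candidate for the second.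
`hskew` says that the candidate is metric and `htor` is the first structure equation. -/
theorem coframe_torsionConn {D : ℕ} {g : TwoTensorField D} {T : FormField D 3} {x : Fin D → ℝ}
    {e : (Fin D → ℝ) → Fin D → Covector D} {E : Fin D → Fin D → ℝ} (hE : IsDualFrame (e x) E)
    (he : ∀ᶠ y in nhds x, IsOrthonormalCoframe g y (e y))
    {F : Fin D → (Fin D → ℝ) → (Fin D → ℝ) → ℝ}
    (hF : ∀ a u v, HasDirDeriv (fun y => e y a v) x u (F a u v))
    {ω' : Fin D → (Fin D → ℝ) → Covector D}
    (hskew : ∀ u v w, ∑ a, (ω' a u v * e x a w + e x a v * ω' a u w) = 0)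
    (htor : ∀ u v w, ∑ a, ((F a u v - ω' a u v) - (F a v u - ω' a v u)) * e x a w
      = T x ![u, v, w]) (a : Fin D) (u v : Fin D → ℝ) :
    e x a (torsionConn g T x u v) = F a u v - ω' a u v := by
  have heq (v w : Fin D → ℝ) : (fun y => g y v w) =ᶠ[nhds x] fun y => ∑ a, e y a v * e y a w :=
    he.mono fun y hy => hy v w
  have hg (u v w : Fin D → ℝ) : fderiv ℝ (fun y => g y v w) x u
      = ∑ a, (F a u v * e x a w + e x a v * F a u w) :=
    ((HasDirDeriv.sum fun a _ => (hF a u v).mul (hF a u w)).congr_of_eventuallyEq (heq v w)).2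
  -- `S u v w` is g(∇_u v, w) for the candidate. Once the derivatives of g and the torsion are
  -- written through `S`, the Koszul formula returns `S` minus half the torsion; constant fields
  -- have no bracket terms.
  let S (u v w : Fin D → ℝ) : ℝ := ∑ a, (F a u v - ω' a u v) * e x a w
  have hgS (u v w : Fin D → ℝ) : fderiv ℝ (fun y => g y v w) x u = S u v w + S u w v := by
    rw [hg, ← sub_eq_zero, ← hskew u v w]
    simp only [S, ← Finset.sum_add_distrib, ← Finset.sum_sub_distrib]
    exact Finset.sum_congr rfl fun a _ => by ring
  have hST (u v w : Fin D → ℝ) : S u v w - S v u w = T x ![u, v, w] := by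
    rw [← htor]
    simp only [S, ← Finset.sum_sub_distrib]
    exact Finset.sum_congr rfl fun a _ => by ring
  have hT1 (u v w : Fin D → ℝ) : T x ![u, w, v] = - T x ![u, v, w] := by
    have := (T x).map_swap ![u, v, w] (show (1 : Fin 3) ≠ 2 by decide)
    rw [← this]
    congr 1
    funext i
    fin_cases i <;> rfl
  have hT2 (u v w : Fin D → ℝ) : T x ![v, u, w] = - T x ![u, v, w] := by
    have := (T x).map_swap ![u, v, w] (show (0 : Fin 3) ≠ 1 by decide)
    rw [← this]
    congr 1
    funext i
    fin_cases i <;> rfl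
  let Tuv : Covector D := (((T x).curryLeft u).curryLeft v).toMultilinearMap.toLinearMap 0 0
  have hTuv (w : Fin D → ℝ) : Tuv w = T x ![u, v, w] := by
    change T x _ = T x _
    congr 1
    funext i
    fin_cases i <;> rfl
  let θ : Covector D := ∑ a, (F a u v - ω' a u v) • e x a - (1 / 2 : ℝ) • Tuv
  have hθ (w : Fin D → ℝ) : θ w = S u v w - 1 / 2 * T x ![u, v, w] := by
    simp [θ, S, hTuv, LinearMap.sum_apply]
  have hlc : leviCivita g x u v = sharp g x fun b => θ (coordVec b) := by
    rw [leviCivita]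
    congr 1
    funext c
    rw [hθ, hgS, hgS, hgS]
    have a1 := hST u v (coordVec c)
    have a2 := hST u (coordVec c) v
    have a3 := hST v (coordVec c) u
    rw [hT1] at a2
    rw [hT1, hT2] at a3
    linarith
  have hx := he.self_of_nhds
  have hTs : (sharp g x fun c => T x ![u, v, coordVec c]) = ∑ c, Tuv (E c) • E c := by
    rw [← hE.sharp_eq hx]
    simp only [hTuv]
  rw [torsionConn, hlc, hTs, hE.sharp_eq hx, map_add, map_smul, map_sum, map_sum]
  simp only [map_smul, hE a, smul_eq_mul, mul_ite, mul_one, mul_zero, Finset.sum_ite_eq,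
    Finset.mem_univ, if_true]
  rw [hθ, hTuv]
  simp only [S, hE _ a, mul_ite, mul_one, mul_zero, Finset.sum_ite_eq', Finset.mem_univ, if_true]
  ring

end

section
variable {n : ℕ}

/-- This reduces the identities of the connection, of ∇ĥ and of the Killing tensors to a computation
for one pair of indices. -/
theorem sum_erase_eq_zero {f : Fin n → Fin n → ℝ} (h : ∀ μ ν, μ ≠ ν → f μ ν + f ν μ = 0) :
    ∑ μ, ∑ ν ∈ Finset.univ.erase μ, f μ ν = 0 := by
  have h1 := sum_erase_comm f
  have h2 : ∑ μ, ∑ ν ∈ Finset.univ.erase μ, f μ ν + ∑ μ, ∑ ν ∈ Finset.univ.erase μ, f ν μ = 0 := by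
    simp only [← Finset.sum_add_distrib]
    exact Finset.sum_eq_zero fun μ _ => Finset.sum_eq_zero fun ν hν =>
      h μ ν (Finset.ne_of_mem_erase hν).symm
  linarith

/-! ### The connection in the orthonormal frame

Below `l μ = √x_μ`, `ξ μ = √Q_μ / (2 √x_μ)`, `d μ ν = 1 / (x_μ - x_ν)`, `e μ = e^μ`, `h μ = e^μ̂`,
`z = e^0`. -/

section Algebra

variable {D : ℕ} (l ξ : Fin n → ℝ) (d : Fin n → Fin n → ℝ) (e h : Fin n → Covector D)

/-- `∇_u e^μ`, where `r` is the rotation coefficient in the plane of `e^μ` and `e^μ̂`. -/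
def connX (μ : Fin n) (r : ℝ) (u : Fin D → ℝ) : Covector D :=
  -(r • h μ) + ∑ ν ∈ Finset.univ.erase μ,
    d μ ν • ((l μ * ξ μ * e ν u + l ν * ξ ν * e μ u) • e ν
      + (l μ * (ξ μ * h ν u - ξ ν * h μ u)) • h ν)

/-- `∇_u e^μ̂`. -/
def connHat (μ : Fin n) (r : ℝ) (u : Fin D → ℝ) : Covector D :=
  r • e μ + ∑ ν ∈ Finset.univ.erase μ,
    d μ ν • (-((l ν * (ξ μ * h ν u - ξ ν * h μ u)) • e ν)
      + (l ν * ξ μ * e ν u + l μ * ξ ν * e μ u) • h ν)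

/-- The rotation coefficient of the connection in the plane of `e^μ` and `e^μ̂`. -/
def spin (k b : Fin n → ℝ) (z : Covector D) (μ : Fin n) : Covector D :=
  -(k μ • h μ) - ∑ ν ∈ Finset.univ.erase μ, (d μ ν * ((l μ - 2 * l ν) * ξ ν)) • h ν - b μ • z

/-- `D_u (e^μ(v))`. -/
def derivX (k : Fin n → ℝ) (μ : Fin n) (u v : Fin D → ℝ) : ℝ :=
  -((k μ * e μ u + ∑ ν ∈ Finset.univ.erase μ, d μ ν * (l ν * ξ ν * e ν u)) * e μ v)

/-- `D_u (e^μ̂(v))`. -/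
def derivHat (k : Fin n → ℝ) (μ : Fin n) (u v : Fin D → ℝ) : ℝ :=
  (k μ * e μ u + ∑ ν ∈ Finset.univ.erase μ, d μ ν * (l ν * ξ ν * e ν u)) * h μ v
    + ∑ ν ∈ Finset.univ.erase μ,
        d μ ν * (e ν u * (2 * (l μ * ξ μ) * h ν v - 2 * (l ν * ξ ν) * h μ v))

variable {l ξ d e h}

theorem connX_apply (μ : Fin n) (r : ℝ) (u v : Fin D → ℝ) :
    connX l ξ d e h μ r u v = -(r * h μ v) + ∑ ν ∈ Finset.univ.erase μ,
    d μ ν * ((l μ * ξ μ * e ν u + l ν * ξ ν * e μ u) * e ν v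
      + (l μ * (ξ μ * h ν u - ξ ν * h μ u)) * h ν v) := by
  simp [connX, LinearMap.sum_apply, mul_add]

theorem connHat_apply (μ : Fin n) (r : ℝ) (u v : Fin D → ℝ) :
    connHat l ξ d e h μ r u v = r * e μ v + ∑ ν ∈ Finset.univ.erase μ,
    d μ ν * (-((l ν * (ξ μ * h ν u - ξ ν * h μ u)) * e ν v)
      + (l ν * ξ μ * e ν u + l μ * ξ ν * e μ u) * h ν v) := by
  simp [connHat, LinearMap.sum_apply, mul_add]

theorem spin_apply (k b : Fin n → ℝ) (z : Covector D) (μ : Fin n) (u : Fin D → ℝ) :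
    spin l ξ d h k b z μ u = -(k μ * h μ u)
      - ∑ ν ∈ Finset.univ.erase μ, d μ ν * ((l μ - 2 * l ν) * ξ ν) * h ν u - b μ * z u := by
  simp [spin, LinearMap.sum_apply]

theorem derivX_sub_connX (k b : Fin n → ℝ) (z : Covector D) (μ : Fin n) (u v : Fin D → ℝ) :
    derivX l ξ d e k μ u v - connX l ξ d e h μ (spin l ξ d h k b z μ u) u v
      = -(k μ * (e μ u * e μ v + h μ u * h μ v)) - b μ * (z u * h μ v)
        + ∑ ν ∈ Finset.univ.erase μ, d μ ν * (-(l ν * ξ ν * e ν u * e μ v)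
          - (l μ - 2 * l ν) * ξ ν * h ν u * h μ v
          - ((l μ * ξ μ * e ν u + l ν * ξ ν * e μ u) * e ν v
            + (l μ * (ξ μ * h ν u - ξ ν * h μ u)) * h ν v)) := by
  rw [derivX, connX_apply, spin_apply]
  have h1 : ∑ ν ∈ Finset.univ.erase μ, d μ ν * (-(l ν * ξ ν * e ν u * e μ v)
          - (l μ - 2 * l ν) * ξ ν * h ν u * h μ v
          - ((l μ * ξ μ * e ν u + l ν * ξ ν * e μ u) * e ν v
            + (l μ * (ξ μ * h ν u - ξ ν * h μ u)) * h ν v))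
      = (-1) * (∑ ν ∈ Finset.univ.erase μ, d μ ν * (l ν * ξ ν * e ν u)) * e μ v
        - (∑ ν ∈ Finset.univ.erase μ, d μ ν * ((l μ - 2 * l ν) * ξ ν) * h ν u) * h μ v
        - ∑ ν ∈ Finset.univ.erase μ, d μ ν * ((l μ * ξ μ * e ν u + l ν * ξ ν * e μ u) * e ν v
            + (l μ * (ξ μ * h ν u - ξ ν * h μ u)) * h ν v) := by
    simp only [Finset.mul_sum, Finset.sum_mul, ← Finset.sum_sub_distrib]
    exact Finset.sum_congr rfl fun ν _ => by ring
  rw [h1]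
  ring

theorem derivHat_sub_connHat (k b : Fin n → ℝ) (z : Covector D) (μ : Fin n) (u v : Fin D → ℝ) :
    derivHat l ξ d e h k μ u v - connHat l ξ d e h μ (spin l ξ d h k b z μ u) u v
      = k μ * (e μ u * h μ v + h μ u * e μ v) + b μ * (z u * e μ v)
        + ∑ ν ∈ Finset.univ.erase μ, d μ ν * (l ν * ξ ν * e ν u * h μ v
          + e ν u * (2 * (l μ * ξ μ) * h ν v - 2 * (l ν * ξ ν) * h μ v)
          + (l μ - 2 * l ν) * ξ ν * h ν u * e μ v
          - (-((l ν * (ξ μ * h ν u - ξ ν * h μ u)) * e ν v)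
            + (l ν * ξ μ * e ν u + l μ * ξ ν * e μ u) * h ν v)) := by
  rw [derivHat, connHat_apply, spin_apply]
  have h1 : ∑ ν ∈ Finset.univ.erase μ, d μ ν * (l ν * ξ ν * e ν u * h μ v
          + e ν u * (2 * (l μ * ξ μ) * h ν v - 2 * (l ν * ξ ν) * h μ v)
          + (l μ - 2 * l ν) * ξ ν * h ν u * e μ v
          - (-((l ν * (ξ μ * h ν u - ξ ν * h μ u)) * e ν v)
            + (l ν * ξ μ * e ν u + l μ * ξ ν * e μ u) * h ν v))
      = (∑ ν ∈ Finset.univ.erase μ, d μ ν * (l ν * ξ ν * e ν u)) * h μ v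
        + ∑ ν ∈ Finset.univ.erase μ,
          d μ ν * (e ν u * (2 * (l μ * ξ μ) * h ν v - 2 * (l ν * ξ ν) * h μ v))
        + (∑ ν ∈ Finset.univ.erase μ, d μ ν * ((l μ - 2 * l ν) * ξ ν) * h ν u) * e μ v
        - ∑ ν ∈ Finset.univ.erase μ, d μ ν * (-((l ν * (ξ μ * h ν u - ξ ν * h μ u)) * e ν v)
            + (l ν * ξ μ * e ν u + l μ * ξ ν * e μ u) * h ν v) := by
    simp only [Finset.sum_mul, ← Finset.sum_add_distrib, ← Finset.sum_sub_distrib]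
    exact Finset.sum_congr rfl fun ν _ => by ring
  rw [h1]
  ring

/-- The rotations `r` cancel inside each plane; the terms linking two planes cancel pairwise because
`d` is antisymmetric. -/
theorem conn_skew (hd : ∀ μ ν, d ν μ = -d μ ν) (r : Fin n → ℝ) (u v w : Fin D → ℝ) :
    ∑ μ, (connX l ξ d e h μ (r μ) u v * e μ w + e μ v * connX l ξ d e h μ (r μ) u w)
      + ∑ μ, (connHat l ξ d e h μ (r μ) u v * h μ w + h μ v * connHat l ξ d e h μ (r μ) u w)
      = 0 := by
  rw [← Finset.sum_add_distrib]
  simp only [connX_apply, connHat_apply]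
  have h1 (μ : Fin n) : ∀ a b c f : ℝ,
      (-(r μ * h μ v) + a) * e μ w + e μ v * (-(r μ * h μ w) + b)
        + ((r μ * e μ v + c) * h μ w + h μ v * (r μ * e μ w + f))
      = a * e μ w + b * e μ v + c * h μ w + f * h μ v := by intros; ring
  simp only [h1]
  simp only [Finset.sum_mul, ← Finset.sum_add_distrib]
  refine sum_erase_eq_zero fun μ ν _ => ?_
  rw [hd μ ν]
  ring

/-- The terms in `k` are symmetric in u and v and drop out, so the unknown radial derivatives of Q_μ
do not affect the torsion. The terms in `b` assemble to e^μ ∧ e^μ̂ ∧ e^0, and the rest cancels over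
pairs by antisymmetry of `d`; no relation between `l` and `d` is needed here. -/
theorem structure_equations (hd : ∀ μ ν, d ν μ = -d μ ν) (k b : Fin n → ℝ) (z : Covector D)
    (u v w : Fin D → ℝ) :
    ∑ μ, ((derivX l ξ d e k μ u v - connX l ξ d e h μ (spin l ξ d h k b z μ u) u v)
        - (derivX l ξ d e k μ v u - connX l ξ d e h μ (spin l ξ d h k b z μ v) v u)) * e μ w
      + (∑ μ, b μ * (e μ u * h μ v) - ∑ μ, b μ * (e μ v * h μ u)) * z w
      + ∑ μ, ((derivHat l ξ d e h k μ u v - connHat l ξ d e h μ (spin l ξ d h k b z μ u) u v)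
        - (derivHat l ξ d e h k μ v u - connHat l ξ d e h μ (spin l ξ d h k b z μ v) v u)) * h μ w
      = ∑ μ, ∑ ν ∈ Finset.univ.erase μ, (l μ - l ν) * d μ ν * (2 * ξ ν) *
          covWedge ![e μ, h μ, h ν] ![u, v, w]
        + ∑ μ, b μ * covWedge ![e μ, h μ, z] ![u, v, w] := by
  simp only [derivX_sub_connX, derivHat_sub_connHat]
  have hdet (α β γ : Covector D) : covWedge ![α, β, γ] ![u, v, w]
      = α u * β v * γ w - α u * γ v * β w - β u * α v * γ w + β u * γ v * α w + γ u * α v * β w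
        - γ u * β v * α w := by
    rw [covWedge_apply, Matrix.det_fin_three]
    simp [Matrix.of_apply]
  simp only [hdet]
  rw [← sub_eq_zero, ← Finset.sum_sub_distrib, Finset.sum_mul]
  simp only [← Finset.sum_add_distrib]
  rw [← Finset.sum_sub_distrib]
  have key := sum_erase_eq_zero (f := fun μ ν =>
      (d μ ν * (-(l ν * ξ ν * e ν u * e μ v)
          - (l μ - 2 * l ν) * ξ ν * h ν u * h μ v
          - ((l μ * ξ μ * e ν u + l ν * ξ ν * e μ u) * e ν v
            + (l μ * (ξ μ * h ν u - ξ ν * h μ u)) * h ν v))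
        - d μ ν * (-(l ν * ξ ν * e ν v * e μ u)
          - (l μ - 2 * l ν) * ξ ν * h ν v * h μ u
          - ((l μ * ξ μ * e ν v + l ν * ξ ν * e μ v) * e ν u
            + (l μ * (ξ μ * h ν v - ξ ν * h μ v)) * h ν u))) * e μ w
      + (d μ ν * (l ν * ξ ν * e ν u * h μ v
          + e ν u * (2 * (l μ * ξ μ) * h ν v - 2 * (l ν * ξ ν) * h μ v)
          + (l μ - 2 * l ν) * ξ ν * h ν u * e μ v
          - (-((l ν * (ξ μ * h ν u - ξ ν * h μ u)) * e ν v)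
            + (l ν * ξ μ * e ν u + l μ * ξ ν * e μ u) * h ν v))
        - d μ ν * (l ν * ξ ν * e ν v * h μ u
          + e ν v * (2 * (l μ * ξ μ) * h ν u - 2 * (l ν * ξ ν) * h μ u)
          + (l μ - 2 * l ν) * ξ ν * h ν v * e μ u
          - (-((l ν * (ξ μ * h ν v - ξ ν * h μ v)) * e ν u)
            + (l ν * ξ μ * e ν v + l μ * ξ ν * e μ v) * h ν u))) * h μ w
      - (l μ - l ν) * d μ ν * (2 * ξ ν) * (e μ u * h μ v * h ν w - e μ u * h ν v * h μ w
        - h μ u * e μ v * h ν w + h μ u * h ν v * e μ w + h ν u * e μ v * h μ w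
        - h ν u * h μ v * e μ w)) fun μ ν _ => by
    rw [hd μ ν]
    ring
  rw [← key]
  refine Finset.sum_congr rfl fun μ _ => ?_
  rw [Finset.sum_sub_distrib, Finset.sum_add_distrib, ← Finset.sum_mul, ← Finset.sum_mul,
    Finset.sum_sub_distrib, Finset.sum_sub_distrib]
  ring

end Algebra

end

/-! ### The connection of `torsionG` in the coframe at a regular point. -/

section
variable {n : ℕ}

/-- `√x_μ`. -/
def rootX (x : Fin (n + (n + 1)) → ℝ) (μ : Fin n) : ℝ := Real.sqrt (x (xIdx μ))

/-- `√Q_μ / (2 √x_μ)`. -/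
def xiCoef (X : Fin n → ℝ → ℝ) (x : Fin (n + (n + 1)) → ℝ) (μ : Fin n) : ℝ :=
  Real.sqrt (Q X μ x) / (2 * rootX x μ)

/-- `1 / (x_μ - x_ν)`. -/
def diffInv (x : Fin (n + (n + 1)) → ℝ) (μ ν : Fin n) : ℝ := 1 / (x (xIdx μ) - x (xIdx ν))

/-- `2 (1 + ∂H/∂x_μ)`. -/
def fluxCoef (N : Fin n → ℝ → ℝ) (x : Fin (n + (n + 1)) → ℝ) (μ : Fin n) : ℝ :=
  2 * (1 + fderiv ℝ (H N) x (coordVec (xIdx μ)))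

theorem diffInv_swap (x : Fin (n + (n + 1)) → ℝ) (μ ν : Fin n) :
    diffInv x ν μ = -diffInv x μ ν := by
  rw [diffInv, diffInv, ← neg_sub, div_neg]

namespace IsRegularPoint

variable {X N : Fin n → ℝ → ℝ} {x : Fin (n + (n + 1)) → ℝ}

theorem rootX_pos (hx : IsRegularPoint X N x) (μ : Fin n) : 0 < rootX x μ :=
  Real.sqrt_pos.2 (hx.pos μ)

theorem rootX_sq (hx : IsRegularPoint X N x) (μ : Fin n) : rootX x μ ^ 2 = x (xIdx μ) :=
  Real.sq_sqrt (hx.pos μ).le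

theorem sqrtQ_pos (hx : IsRegularPoint X N x) (μ : Fin n) : 0 < Real.sqrt (Q X μ x) :=
  Real.sqrt_pos.2 (hx.Q_pos μ)

theorem sqrtQ_eq (hx : IsRegularPoint X N x) (μ : Fin n) :
    Real.sqrt (Q X μ x) = 2 * (rootX x μ * xiCoef X x μ) := by
  have := (hx.rootX_pos μ).ne'
  rw [xiCoef]
  field_simp

theorem coord_eq (hx : IsRegularPoint X N x) (μ : Fin n) (u : Fin (n + (n + 1)) → ℝ) :
    u (xIdx μ) = Real.sqrt (Q X μ x) * frameX X μ x u := by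
  have := (hx.sqrtQ_pos μ).ne'
  rw [frameX, LinearMap.smul_apply, smul_eq_mul, coordForm, LinearMap.proj_apply]
  field_simp

/-- The derivative of X_μ enters only through `k`, whose value plays no role later. The other
coefficients come from differentiating 1/U_μ, with dx_ν = √Q_ν e^ν and √Q_ν = 2√x_ν ξ_ν. -/
theorem hasDirDeriv_sqrtQ (hx : IsRegularPoint X N x) (μ : Fin n) :
    ∃ k : ℝ, ∀ u, HasDirDeriv (fun y => Real.sqrt (Q X μ y)) x u (Real.sqrt (Q X μ x) *
      (k * frameX X μ x u + ∑ ν ∈ Finset.univ.erase μ,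
        diffInv x μ ν * (rootX x ν * xiCoef X x ν * frameX X ν x u))) := by
  obtain ⟨c, hc⟩ := hasDirDeriv_div_U hx.ne μ (hx.diffX μ)
  have hs := (hx.sqrtQ_pos μ).ne'
  refine ⟨c / (2 * Real.sqrt (Q X μ x)), fun u => ((hc u).sqrt (hx.Q_pos μ)).congr_deriv ?_⟩
  have h1 : ∑ ν ∈ Finset.univ.erase μ, X μ (x (xIdx μ)) / U μ x *
      (u (xIdx ν) / (x (xIdx μ) - x (xIdx ν)))
      = 2 * Real.sqrt (Q X μ x) ^ 2 * ∑ ν ∈ Finset.univ.erase μ,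
        diffInv x μ ν * (rootX x ν * xiCoef X x ν * frameX X ν x u) := by
    rw [Finset.mul_sum, Real.sq_sqrt (hx.Q_pos μ).le]
    refine Finset.sum_congr rfl fun ν _ => ?_
    rw [hx.coord_eq ν u, hx.sqrtQ_eq ν, diffInv, Q]
    ring
  rw [h1, hx.coord_eq μ u]
  change _ / (2 * Real.sqrt (Q X μ x)) = _
  field_simp

theorem theta_eq (hx : IsRegularPoint X N x) (μ : Fin n) (v : Fin (n + (n + 1)) → ℝ) :
    theta μ x v = frameHat X μ x v / Real.sqrt (Q X μ x) := by
  have := (hx.sqrtQ_pos μ).ne'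
  rw [frameHat, LinearMap.smul_apply, smul_eq_mul]
  field_simp

theorem hasDirDeriv_frameX (hx : IsRegularPoint X N x) {μ : Fin n} {k : Fin n → ℝ}
    (hk : ∀ u, HasDirDeriv (fun y => Real.sqrt (Q X μ y)) x u (Real.sqrt (Q X μ x) *
      (k μ * frameX X μ x u + ∑ ν ∈ Finset.univ.erase μ,
        diffInv x μ ν * (rootX x ν * xiCoef X x ν * frameX X ν x u))))
    (u v : Fin (n + (n + 1)) → ℝ) :
    HasDirDeriv (fun y => frameX X μ y v) x u
      (derivX (rootX x) (xiCoef X x) (diffInv x) (frameX X · x) k μ u v) := by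
  have hs := (hx.sqrtQ_pos μ).ne'
  have h1 := ((hk u).inv hs).mul (HasDirDeriv.const (v (xIdx μ)))
  have hfun : (fun y => frameX X μ y v) = fun y => (Real.sqrt (Q X μ y))⁻¹ * v (xIdx μ) := by
    funext y
    simp [frameX, coordForm]
  rw [hfun]
  refine h1.congr_deriv ?_
  rw [derivX, hx.coord_eq μ v]
  field_simp
  ring

theorem hasDirDeriv_frameHat (hx : IsRegularPoint X N x) {μ : Fin n} {k : Fin n → ℝ}
    (hk : ∀ u, HasDirDeriv (fun y => Real.sqrt (Q X μ y)) x u (Real.sqrt (Q X μ x) *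
      (k μ * frameX X μ x u + ∑ ν ∈ Finset.univ.erase μ,
        diffInv x μ ν * (rootX x ν * xiCoef X x ν * frameX X ν x u))))
    (u v : Fin (n + (n + 1)) → ℝ) :
    HasDirDeriv (fun y => frameHat X μ y v) x u
      (derivHat (rootX x) (xiCoef X x) (diffInv x) (frameX X · x) (frameHat X · x) k μ u v) := by
  have hs := (hx.sqrtQ_pos μ).ne'
  have h1 := (hk u).mul (hasDirDeriv_theta hx.ne μ u v)
  refine h1.congr_deriv ?_
  rw [derivHat, hx.theta_eq μ v, Finset.mul_sum]
  congr 1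
  · field_simp
  · refine Finset.sum_congr rfl fun ν _ => ?_
    have hs' := (hx.sqrtQ_pos ν).ne'
    rw [hx.coord_eq ν u, hx.theta_eq ν v, diffInv, ← hx.sqrtQ_eq μ, ← hx.sqrtQ_eq ν]
    field_simp

theorem hasDirDeriv_frameZero (hx : IsRegularPoint X N x) (u v : Fin (n + (n + 1)) → ℝ) :
    HasDirDeriv (fun y => frameZero N y v) x u
      (∑ μ, fluxCoef N x μ * (frameX X μ x u * frameHat X μ x v)) := by
  refine ((hasDirDeriv_contact hx.ne hx.diffN u v).const_mul 2).congr_deriv ?_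
  rw [Finset.mul_sum]
  refine Finset.sum_congr rfl fun μ _ => ?_
  have hs := (hx.sqrtQ_pos μ).ne'
  rw [hx.coord_eq μ u, hx.theta_eq μ v, fluxCoef]
  field_simp

end IsRegularPoint

theorem plane_eq (X : Fin n → ℝ → ℝ) (μ : Fin n) (x : Fin (n + (n + 1)) → ℝ) :
    plane X μ x = covWedge ![frameX X μ x, frameHat X μ x] := by
  rw [plane, oneForm_eq_covWedge, oneForm_eq_covWedge, wedge_covWedge]
  congr 1
  funext k
  fin_cases k <;> rfl

theorem wedge_plane_oneForm (X : Fin n → ℝ → ℝ) (μ : Fin n) (x : Fin (n + (n + 1)) → ℝ)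
    (α : Covector (n + (n + 1))) :
    (wedge rfl (plane X μ x) (oneForm α) : Form (n + (n + 1)) 3)
      = covWedge ![frameX X μ x, frameHat X μ x, α] := by
  rw [plane_eq, oneForm_eq_covWedge, wedge_covWedge]
  congr 1
  funext k
  fin_cases k <;> rfl

/-- The factorization x_μ − x_ν = (√x_μ − √x_ν)(√x_μ + √x_ν) makes the coefficients of G rational in
the roots, and √(Q_ν/x_ν) = 2ξ_ν; this is the form produced by `structure_equations`. -/
theorem torsionG_apply {X N : Fin n → ℝ → ℝ} {x : Fin (n + (n + 1)) → ℝ}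
    (hx : IsRegularPoint X N x) (v : Fin 3 → Fin (n + (n + 1)) → ℝ) :
    torsionG X N x v = ∑ μ, ∑ ν ∈ Finset.univ.erase μ,
      (rootX x μ - rootX x ν) * diffInv x μ ν * (2 * xiCoef X x ν) *
          covWedge ![frameX X μ x, frameHat X μ x, frameHat X ν x] v
        + ∑ μ, fluxCoef N x μ * covWedge ![frameX X μ x, frameHat X μ x, frameZero N x] v := by
  simp only [torsionG, wedge_plane_oneForm, AlternatingMap.add_apply, form_sum_apply,
    AlternatingMap.smul_apply, smul_eq_mul]
  congr 1
  refine Finset.sum_congr rfl fun μ _ => Finset.sum_congr rfl fun ν hν => ?_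
  congr 1
  have h1 := hx.rootX_pos μ
  have h2 := hx.rootX_pos ν
  have h3 := sub_ne_zero.2 (hx.ne μ ν (Finset.ne_of_mem_erase hν).symm)
  have h4 : x (xIdx μ) - x (xIdx ν) = (rootX x μ - rootX x ν) * (rootX x μ + rootX x ν) := by
    rw [← hx.rootX_sq μ, ← hx.rootX_sq ν]; ring
  rw [h4] at h3
  have h5 : rootX x μ - rootX x ν ≠ 0 := left_ne_zero_of_mul h3
  rw [diffInv, h4, xiCoef, Real.sqrt_div (hx.Q_pos ν).le]
  change 1 / (rootX x μ + rootX x ν) * (_ / rootX x ν) = _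
  have h6 : rootX x μ + rootX x ν ≠ 0 := by positivity
  field_simp

/-- The rotation coefficients of `∇^G` for suitable `k`. -/
abbrev spinG (X N : Fin n → ℝ → ℝ) (x : Fin (n + (n + 1)) → ℝ) (k : Fin n → ℝ) (μ : Fin n) :
    Covector (n + (n + 1)) :=
  spin (rootX x) (xiCoef X x) (diffInv x) (frameHat X · x) k (fluxCoef N x) (frameZero N x) μ

/-- `∇^G_u` of the elements of the coframe. -/
def connCoframe (X N : Fin n → ℝ → ℝ) (x : Fin (n + (n + 1)) → ℝ) (k : Fin n → ℝ)
    (a : Fin (n + (n + 1))) (u : Fin (n + (n + 1)) → ℝ) : Covector (n + (n + 1)) :=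
  Fin.append (fun μ => connX (rootX x) (xiCoef X x) (diffInv x) (frameX X · x) (frameHat X · x) μ
      (spinG X N x k μ u) u)
    (Fin.cons 0 fun μ => connHat (rootX x) (xiCoef X x) (diffInv x) (frameX X · x)
      (frameHat X · x) μ (spinG X N x k μ u) u) a

section
variable (X N : Fin n → ℝ → ℝ) (x : Fin (n + (n + 1)) → ℝ) (k : Fin n → ℝ)
  (u : Fin (n + (n + 1)) → ℝ)

theorem connCoframe_xIdx (μ : Fin n) : connCoframe X N x k (xIdx μ) u
    = connX (rootX x) (xiCoef X x) (diffInv x) (frameX X · x) (frameHat X · x) μ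
      (spinG X N x k μ u) u := by simp [connCoframe, xIdx]

theorem connCoframe_psiIdx_zero : connCoframe X N x k (psiIdx 0) u = 0 := by
  rw [connCoframe, psiIdx, Fin.append_right, Fin.cons_zero]

theorem connCoframe_hatIdx (μ : Fin n) : connCoframe X N x k (hatIdx μ) u
    = connHat (rootX x) (xiCoef X x) (diffInv x) (frameX X · x) (frameHat X · x) μ
      (spinG X N x k μ u) u := by
  rw [connCoframe, hatIdx, psiIdx, Fin.append_right, Fin.cons_succ]

theorem connCoframe_skew (v w : Fin (n + (n + 1)) → ℝ) :
    ∑ a, (connCoframe X N x k a u v * coframe X N x a w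
      + coframe X N x a v * connCoframe X N x k a u w) = 0 := by
  rw [sum_frame_index]
  simp only [connCoframe_xIdx, connCoframe_psiIdx_zero, connCoframe_hatIdx, coframe_xIdx,
    coframe_hatIdx, LinearMap.zero_apply, zero_mul, mul_zero, add_zero, zero_add]
  exact conn_skew (diffInv_swap x) (fun μ => spinG X N x k μ u) u v w

theorem connCoframe_add (u' : Fin (n + (n + 1)) → ℝ) (a : Fin (n + (n + 1))) :
    connCoframe X N x k a (u + u') = connCoframe X N x k a u + connCoframe X N x k a u' := by
  induction a using forall_frame_index with
  | h1 μ =>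
    refine LinearMap.ext fun v => ?_
    simp only [connCoframe_xIdx, LinearMap.add_apply, connX_apply, map_add]
    rw [add_add_add_comm, ← Finset.sum_add_distrib]
    congr 1
    · ring
    · exact Finset.sum_congr rfl fun ν _ => by ring
  | h2 => simp only [connCoframe_psiIdx_zero, add_zero]
  | h3 μ =>
    refine LinearMap.ext fun v => ?_
    simp only [connCoframe_hatIdx, LinearMap.add_apply, connHat_apply, map_add]
    rw [add_add_add_comm, ← Finset.sum_add_distrib]
    congr 1
    · ring
    · exact Finset.sum_congr rfl fun ν _ => by ring

theorem connCoframe_smul (r : ℝ) (a : Fin (n + (n + 1))) :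
    connCoframe X N x k a (r • u) = r • connCoframe X N x k a u := by
  induction a using forall_frame_index with
  | h1 μ =>
    refine LinearMap.ext fun v => ?_
    simp only [connCoframe_xIdx, LinearMap.smul_apply, connX_apply, map_smul, smul_eq_mul]
    rw [mul_add, Finset.mul_sum]
    congr 1
    · ring
    · exact Finset.sum_congr rfl fun ν _ => by ring
  | h2 => simp only [connCoframe_psiIdx_zero, smul_zero]
  | h3 μ =>
    refine LinearMap.ext fun v => ?_
    simp only [connCoframe_hatIdx, LinearMap.smul_apply, connHat_apply, map_smul, smul_eq_mul]
    rw [mul_add, Finset.mul_sum]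
    congr 1
    · ring
    · exact Finset.sum_congr rfl fun ν _ => by ring

end

/-- The coframe is fed into `coframe_torsionConn`. Linearity of ∇_u in u, not visible from the
coordinate formula, is read off from the coframe components, which determine a vector. -/
theorem exists_hasCov_coframe {X N : Fin n → ℝ → ℝ} {x : Fin (n + (n + 1)) → ℝ}
    (hx : IsRegularPoint X N x) (hev : ∀ᶠ y in nhds x, ∀ μ : Fin n, 0 < Q X μ y) :
    ∃ k : Fin n → ℝ,
      (∀ a u, HasCov (torsionConn (stMetric X N) (torsionG X N) x u) x u
        (fun y => coframe X N y a) (connCoframe X N x k a u)) ∧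
      (∀ u u' v, torsionConn (stMetric X N) (torsionG X N) x (u + u') v
        = torsionConn (stMetric X N) (torsionG X N) x u v
          + torsionConn (stMetric X N) (torsionG X N) x u' v) ∧
      ∀ (r : ℝ) u v, torsionConn (stMetric X N) (torsionG X N) x (r • u) v
        = r • torsionConn (stMetric X N) (torsionG X N) x u v := by
  choose k hk using hx.hasDirDeriv_sqrtQ
  let F (a : Fin (n + (n + 1))) (u v : Fin (n + (n + 1)) → ℝ) : ℝ :=
    fderiv ℝ (fun y => coframe X N y a v) x u
  have hFx (μ : Fin n) (u v) : HasDirDeriv (fun y => coframe X N y (xIdx μ) v) x u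
      (derivX (rootX x) (xiCoef X x) (diffInv x) (frameX X · x) k μ u v) := by
    simpa only [coframe_xIdx] using hx.hasDirDeriv_frameX (hk μ) u v
  have hFh (μ : Fin n) (u v) : HasDirDeriv (fun y => coframe X N y (hatIdx μ) v) x u
      (derivHat (rootX x) (xiCoef X x) (diffInv x) (frameX X · x) (frameHat X · x) k μ u v) := by
    simpa only [coframe_hatIdx] using hx.hasDirDeriv_frameHat (hk μ) u v
  have hF0 (u v) : HasDirDeriv (fun y => coframe X N y (psiIdx 0) v) x u
      (∑ μ, fluxCoef N x μ * (frameX X μ x u * frameHat X μ x v)) := by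
    simpa only [coframe_psiIdx_zero] using hx.hasDirDeriv_frameZero u v
  have hF (a u v) : HasDirDeriv (fun y => coframe X N y a v) x u (F a u v) := by
    refine HasDirDeriv.of_differentiableAt ?_
    induction a using forall_frame_index with
    | h1 μ => exact (hFx μ u v).1
    | h2 => exact (hF0 u v).1
    | h3 μ => exact (hFh μ u v).1
  have hE := isDualFrame_frame (N := N) hx.ne hx.Q_pos
  have hconn := coframe_torsionConn (T := torsionG X N) hE
    (hev.mono fun y hy => isOrthonormalCoframe_coframe N hy) hF
    (ω' := connCoframe X N x k) (fun u v w => connCoframe_skew X N x k u v w) (by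
      intro u v w
      rw [sum_frame_index, torsionG_apply hx,
        ← structure_equations (diffInv_swap x) k (fluxCoef N x) (frameZero N x) u v w]
      simp only [connCoframe_xIdx, connCoframe_psiIdx_zero, connCoframe_hatIdx, coframe_xIdx,
        coframe_hatIdx, coframe_psiIdx_zero, LinearMap.zero_apply, sub_zero, F, (hFx _ _ _).2,
        (hFh _ _ _).2, (hF0 _ _).2]
      ring)
  have hinj {v w : Fin (n + (n + 1)) → ℝ} (h : ∀ a, coframe X N x a v = coframe X N x a w) :
      v = w := by
    rw [← hE.sum_smul v, ← hE.sum_smul w]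
    simp only [h]
  refine ⟨k, fun a u v => ?_, fun u u' v => hinj fun a => ?_, fun r u v => hinj fun a => ?_⟩
  · rw [hconn, add_sub_cancel]
    exact hF a u v
  · rw [map_add, hconn, hconn, hconn, connCoframe_add]
    simp only [F, map_add, LinearMap.add_apply]
    ring
  · rw [map_smul, hconn, hconn, connCoframe_smul]
    simp only [F, map_smul, LinearMap.smul_apply, smul_eq_mul]
    ring

end

section
variable {n : ℕ}

/-! ### The covariant derivative of `h^{(j)}` -/

/-- The central computation, ∇_u(Σ l_μ e^μ ∧ e^μ̂) = (u^♭ without its e^0 component) ∧ Σ ξ_ν e^ν̂.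
An alternating `L` stands for the exterior product with all other factors frozen. Rotations within a
plane preserve e^μ ∧ e^μ̂, so `r` disappears. For a pair of planes everything reduces to (l_μ² −
l_ν²) d_μν = 1, which is where l_μ = √x_μ is essential. -/
theorem sum_conn_pair {D : ℕ} {l ξ : Fin n → ℝ} {d : Fin n → Fin n → ℝ} {e h : Fin n → Covector D}
    (hd : ∀ μ ν, d ν μ = -d μ ν) (hl : ∀ μ ν, μ ≠ ν → d μ ν * (l μ ^ 2 - l ν ^ 2) = 1)
    (r : Fin n → ℝ) (u : Fin D → ℝ) (L : Covector D →ₗ[ℝ] Covector D →ₗ[ℝ] ℝ)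
    (hL : ∀ α, L α α = 0) :
    ∑ μ, (L ((ξ μ * e μ u) • e μ + l μ • connX l ξ d e h μ (r μ) u) (h μ)
      + L (l μ • e μ) (connHat l ξ d e h μ (r μ) u))
      = L (∑ μ, (e μ u • e μ + h μ u • h μ)) (∑ ν, ξ ν • h ν) := by
  have hanti (α β : Covector D) : L β α = -L α β := by
    have := hL (α + β)
    simp only [map_add, LinearMap.add_apply, hL] at this
    linarith
  have hR : L (∑ μ, (e μ u • e μ + h μ u • h μ)) (∑ ν, ξ ν • h ν)
      = ∑ μ, (ξ μ * e μ u * L (e μ) (h μ) + ∑ ν ∈ Finset.univ.erase μ,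
        ξ ν * (e μ u * L (e μ) (h ν) + h μ u * L (h μ) (h ν))) := by
    rw [map_sum L, LinearMap.sum_apply]
    refine Finset.sum_congr rfl fun μ _ => ?_
    rw [map_sum, ← Finset.add_sum_erase _ _ (Finset.mem_univ μ)]
    simp only [map_add, map_smul, LinearMap.add_apply, LinearMap.smul_apply, smul_eq_mul, hL]
    congr 1
    ring
  have hLHS (μ : Fin n) : L ((ξ μ * e μ u) • e μ + l μ • connX l ξ d e h μ (r μ) u) (h μ)
      + L (l μ • e μ) (connHat l ξ d e h μ (r μ) u)
      = ξ μ * e μ u * L (e μ) (h μ) + ∑ ν ∈ Finset.univ.erase μ,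
        l μ * (d μ ν * ((l μ * ξ μ * e ν u + l ν * ξ ν * e μ u) * L (e ν) (h μ)
            + (l μ * (ξ μ * h ν u - ξ ν * h μ u)) * L (h ν) (h μ))
          + d μ ν * (-((l ν * (ξ μ * h ν u - ξ ν * h μ u)) * L (e μ) (e ν))
            + (l ν * ξ μ * e ν u + l μ * ξ ν * e μ u) * L (e μ) (h ν))) := by
    rw [← Finset.mul_sum, Finset.sum_add_distrib]
    simp only [map_add, map_smul, LinearMap.add_apply, LinearMap.smul_apply]
    simp only [connX, connHat, map_add, map_smul, map_neg, map_sum, LinearMap.add_apply,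
      LinearMap.smul_apply, LinearMap.neg_apply, LinearMap.sum_apply, smul_eq_mul, hL]
    ring
  rw [hR, ← sub_eq_zero, ← Finset.sum_sub_distrib]
  simp only [hLHS, add_sub_add_left_eq_sub, ← Finset.sum_sub_distrib]
  refine sum_erase_eq_zero fun μ ν hμν => ?_
  have h1 := hl μ ν hμν
  rw [hd μ ν, hanti (h μ) (h ν), hanti (e μ) (e ν)]
  linear_combination (ξ μ * e ν u * L (e ν) (h μ) + ξ ν * e μ u * L (e μ) (h ν)
    + (ξ ν * h μ u - ξ μ * h ν u) * L (h μ) (h ν)) * h1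

/-- The span of the decomposable forms with the factor `β`. -/
def divisibleSpan {D : ℕ} (p : ℕ) (β : Covector D) : Submodule ℝ (Form D p) :=
  Submodule.span ℝ {η | ∃ (α : Fin p → Covector D) (i : Fin p), α i = β ∧ η = covWedge α}

theorem wedgeOne_eq_zero_of_mem_divisibleSpan {D p : ℕ} {β : Covector D} {η : Form D p}
    (hη : η ∈ divisibleSpan p β) (v : Fin (p + 1) → Fin D → ℝ) : wedgeOne β η v = 0 := by
  induction hη using Submodule.span_induction with
  | mem η h =>
    obtain ⟨α, i, hi, rfl⟩ := h
    rw [covWedge_cons_left, covWedge_apply']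
    refine Matrix.det_zero_of_row_eq (i := 0) (j := i.succ) (Fin.succ_ne_zero i).symm ?_
    funext k
    simp [hi]
  | zero => simp [wedgeOne]
  | add η η' _ _ h h' =>
    simp only [wedgeOne, AlternatingMap.add_apply, mul_add, Finset.sum_add_distrib] at h h' ⊢
    rw [h, h', add_zero]
  | smul c η _ h =>
    have : wedgeOne β (c • η) v = c * wedgeOne β η v := by
      simp only [wedgeOne, AlternatingMap.smul_apply, smul_eq_mul, Finset.mul_sum]
      exact Finset.sum_congr rfl fun _ _ => by ring
    rw [this, h, mul_zero]

/-- The star inserts the vectors dual to the factors into the volume form; a factor u^♭ inserts `u`,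
which then occurs twice. -/
theorem starLin_eq_zero_of_mem_divisibleSpan {D p q : ℕ} (h : p + q = D) {e : Fin D → Covector D}
    {E : Fin D → Fin D → ℝ} {g : TwoTensorField D} {x : Fin D → ℝ} (hE : IsDualFrame e E)
    (he : IsOrthonormalCoframe g x e) {u : Fin D → ℝ} {η : Form D p}
    (hη : η ∈ divisibleSpan p (g x u)) (v : Fin q → Fin D → ℝ) (k : Fin q) (hk : v k = u) :
    starLin h e E η v = 0 := by
  induction hη using Submodule.span_induction with
  | mem η hη =>
    obtain ⟨α, i, hi, rfl⟩ := hη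
    have h1 : ∑ c, α i (E c) • E c = u := by
      conv_rhs => rw [← hE.sum_smul u]
      refine Finset.sum_congr rfl fun c _ => ?_
      rw [hi, he]
      simp [hE _ c]
    rw [starLin_covWedge, insertFirst_apply]
    refine (covWedge e).map_eq_zero_of_eq (i := finCongr h (Fin.castAdd q i))
      (j := finCongr h (Fin.natAdd p k)) _ ?_ ?_
    · simp only [Equiv.symm_apply_apply, Fin.append_left, Fin.append_right, h1, hk]
    · intro h
      have := congrArg Fin.val h
      simp at this
      omega
  | zero => simp
  | add η η' _ _ h h' => rw [map_add, AlternatingMap.add_apply, h, h', add_zero]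
  | smul c η _ h => rw [map_smul, AlternatingMap.smul_apply, h, smul_zero]

/-- A sum over `Fin (2 j)` in pairs. -/
theorem sum_fin_pairs {W : Type*} [AddCommMonoid W] {j : ℕ} (f : Fin (2 * j) → W) :
    ∑ k, f k = ∑ i : Fin j, (f ⟨2 * i, by omega⟩ + f ⟨2 * i + 1, by omega⟩) := by
  rw [← (finProdFinEquiv.trans (finCongr (Nat.mul_comm j 2))).sum_comp, Fintype.sum_prod_type]
  refine Finset.sum_congr rfl fun i _ => ?_
  rw [Fin.sum_univ_two]
  congr 2
  · ext; simp [finProdFinEquiv]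
  · ext; simp [finProdFinEquiv]; ring

theorem prod_fin_pairs {W : Type*} [CommMonoid W] {j : ℕ} (f : Fin (2 * j) → W) :
    ∏ k, f k = ∏ i : Fin j, (f ⟨2 * i, by omega⟩ * f ⟨2 * i + 1, by omega⟩) := by
  rw [← (finProdFinEquiv.trans (finCongr (Nat.mul_comm j 2))).prod_comp, Fintype.prod_prod_type]
  refine Finset.prod_congr rfl fun i _ => ?_
  rw [Fin.prod_univ_two]
  congr 2
  · ext; simp [finProdFinEquiv]
  · ext; simp [finProdFinEquiv]; ring

theorem interleave_even {T : Type*} {j : ℕ} (a b : Fin j → T) (i : Fin j) :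
    interleave rfl a b ⟨2 * i, by omega⟩ = a i := by simp [interleave]

theorem interleave_odd {T : Type*} {j : ℕ} (a b : Fin j → T) (i : Fin j) :
    interleave rfl a b ⟨2 * i + 1, by omega⟩ = b i := by
  have h1 : (2 * (i : ℕ) + 1) / 2 = i := by omega
  have h2 : (2 * (i : ℕ) + 1) % 2 = 1 := by omega
  simp [interleave, h1, h2]

theorem interleave_update {T : Type*} {j : ℕ} {κ : Type*} (a b : κ → T) (m : Fin j → κ) (i : Fin j)
    (μ : κ) :
    interleave rfl (a ∘ Function.update m i μ) (b ∘ Function.update m i μ)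
      = Function.update (Function.update (interleave rfl (a ∘ m) (b ∘ m))
          ⟨2 * i, by omega⟩ (a μ)) ⟨2 * i + 1, by omega⟩ (b μ) := by
  funext k
  by_cases hk : (k : ℕ) / 2 = i
  · rcases Nat.mod_two_eq_zero_or_one k with h | h
    · have hk' : k = ⟨2 * i, by omega⟩ := Fin.ext (by simp; omega)
      rw [hk', interleave_even, Function.update_of_ne (by simp [Fin.ext_iff])]
      simp
    · have hk' : k = ⟨2 * i + 1, by omega⟩ := Fin.ext (by simp; omega)
      rw [hk', interleave_odd]
      simp
  · rw [Function.update_of_ne (by simp [Fin.ext_iff]; omega),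
      Function.update_of_ne (by simp [Fin.ext_iff]; omega)]
    have : (⟨k / 2, by omega⟩ : Fin j) ≠ i := by simpa [Fin.ext_iff] using hk
    simp [interleave, Function.update_of_ne this]

/-- The involution exchanging `m i` with a free index lets the i-th index be summed on its own, at
the cost of the factor `Fintype.card κ`. -/
theorem card_smul_sum_update {W κ : Type*} [AddCommGroup W] [Fintype κ] [DecidableEq κ] {j : ℕ}
    (i : Fin j) (P : (Fin j → κ) → W) :
    Fintype.card κ • ∑ m, P m = ∑ m, ∑ μ, P (Function.update m i μ) := by
  have hinv : Function.Involutive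
      (fun p : (Fin j → κ) × κ => (Function.update p.1 i p.2, p.1 i)) := by
    rintro ⟨m, μ⟩
    simp
  have := Equiv.sum_comp hinv.toPerm (fun p : (Fin j → κ) × κ => P p.1)
  rw [Fintype.sum_prod_type, Fintype.sum_prod_type] at this
  simp only [Finset.sum_const, Finset.card_univ, ← Finset.smul_sum] at this
  rw [← this]
  rfl

theorem covWedge_cons_eq {D p : ℕ} (θ : Covector D) (α : Fin p → Covector D) :
    covWedge (Fin.cons θ α) = (covWedgeAlt D (p + 1)).curryLeft θ α := rfl

/-- The terms of `∇_u (z ∧ (∑ a_μ ∧ b_μ)^j)` collected by the rule `∇_u (∑ a_μ ∧ b_μ) = β ∧ γ`. -/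
theorem sum_covWedge_update_mem {D j : ℕ} (hn : n ≠ 0) (z : Covector D)
    (a b a' b' : Fin n → Covector D) (β γ δ : Covector D) (c : ℝ) (hβ : β = δ - c • z)
    (hpair : ∀ L : Covector D →ₗ[ℝ] Covector D →ₗ[ℝ] ℝ, (∀ α, L α α = 0) →
      ∑ μ, (L (a' μ) (b μ) + L (a μ) (b' μ)) = L β γ) :
    ∑ m : Fin j → Fin n, ∑ i, covWedge (Function.update
        (Fin.cons z (interleave rfl (a ∘ m) (b ∘ m)) : Fin (2 * j + 1) → Covector D) i
        ((Fin.cons 0 (interleave rfl (a' ∘ m) (b' ∘ m)) : Fin (2 * j + 1) → Covector D) i))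
      ∈ divisibleSpan (2 * j + 1) δ := by
  have h0 (m : Fin j → Fin n) : ∑ i, covWedge (Function.update
        (Fin.cons z (interleave rfl (a ∘ m) (b ∘ m)) : Fin (2 * j + 1) → Covector D) i
        ((Fin.cons 0 (interleave rfl (a' ∘ m) (b' ∘ m)) : Fin (2 * j + 1) → Covector D) i))
      = ∑ i : Fin j,
        (covWedge (Fin.cons z (Function.update (interleave rfl (a ∘ m) (b ∘ m))
          ⟨2 * i, by omega⟩ (a' (m i))) : Fin (2 * j + 1) → Covector D)
        + covWedge (Fin.cons z (Function.update (interleave rfl (a ∘ m) (b ∘ m))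
          ⟨2 * i + 1, by omega⟩ (b' (m i))) : Fin (2 * j + 1) → Covector D)) := by
    rw [Fin.sum_univ_succ, sum_fin_pairs]
    -- This term differentiates the leading factor `z`, whose derivative is zero.
    have : covWedge (Function.update
        (Fin.cons z (interleave rfl (a ∘ m) (b ∘ m)) : Fin (2 * j + 1) → Covector D) 0
        ((Fin.cons 0 (interleave rfl (a' ∘ m) (b' ∘ m)) : Fin (2 * j + 1) → Covector D) 0)) = 0 :=
      (covWedgeAlt D _).map_coord_zero 0 (by simp)
    rw [this, zero_add]
    refine Finset.sum_congr rfl fun i _ => ?_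
    simp only [Fin.cons_succ, ← Fin.cons_update, interleave_even, interleave_odd,
      Function.comp_apply]
  simp only [h0]
  rw [Finset.sum_comm]
  refine Submodule.sum_mem _ fun i _ => ?_
  -- Membership may be tested after multiplication by n, so that by `card_smul_sum_update` the i-th
  -- index runs over all planes while the others stay fixed.
  have hn' : ((n : ℕ) : ℝ) ≠ 0 := by exact_mod_cast hn
  rw [← Submodule.smul_mem_iff _ hn', Nat.cast_smul_eq_nsmul]
  have hcard := card_smul_sum_update i (fun m : Fin j → Fin n =>
    (covWedge (Fin.cons z (Function.update (interleave rfl (a ∘ m) (b ∘ m))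
          ⟨2 * i, by omega⟩ (a' (m i))) : Fin (2 * j + 1) → Covector D)
        + covWedge (Fin.cons z (Function.update (interleave rfl (a ∘ m) (b ∘ m))
          ⟨2 * i + 1, by omega⟩ (b' (m i))) : Fin (2 * j + 1) → Covector D)))
  rw [Fintype.card_fin] at hcard
  rw [hcard]
  refine Submodule.sum_mem _ fun m _ => ?_
  have hne : (⟨2 * i, by omega⟩ : Fin (2 * j)) ≠ ⟨2 * i + 1, by omega⟩ := by simp [Fin.ext_iff]
  set c₀ := interleave rfl (a ∘ m) (b ∘ m)
  -- All factors except the i-th pair are frozen, leaving an alternating bilinear form to which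
  -- `hpair` applies.
  let L₀ (v : Fin (2 * j + 1) → Fin D → ℝ) : Covector D →ₗ[ℝ] Covector D →ₗ[ℝ] ℝ :=
    LinearMap.mk₂ ℝ (fun α β => covWedge (Fin.cons z (Function.update (Function.update c₀
        ⟨2 * i, by omega⟩ α) ⟨2 * i + 1, by omega⟩ β) : Fin (2 * j + 1) → Covector D) v)
      (fun α α' β => by
        simp only [Function.update_comm hne, covWedge_cons_eq, AlternatingMap.map_update_add,
          AlternatingMap.add_apply])
      (fun r α β => by
        simp only [Function.update_comm hne, covWedge_cons_eq, AlternatingMap.map_update_smul,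
          AlternatingMap.smul_apply])
      (fun α β β' => by
        simp only [covWedge_cons_eq, AlternatingMap.map_update_add, AlternatingMap.add_apply])
      (fun r α β => by
        simp only [covWedge_cons_eq, AlternatingMap.map_update_smul, AlternatingMap.smul_apply])
  have hsum : ∑ μ, (covWedge (Fin.cons z (Function.update (interleave rfl
          (a ∘ Function.update m i μ) (b ∘ Function.update m i μ))
          ⟨2 * i, by omega⟩ (a' (Function.update m i μ i))) : Fin (2 * j + 1) → Covector D)
        + covWedge (Fin.cons z (Function.update (interleave rfl
          (a ∘ Function.update m i μ) (b ∘ Function.update m i μ))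
          ⟨2 * i + 1, by omega⟩ (b' (Function.update m i μ i))) : Fin (2 * j + 1) → Covector D))
      = covWedge (Fin.cons z (Function.update (Function.update c₀
        ⟨2 * i, by omega⟩ δ) ⟨2 * i + 1, by omega⟩ γ) : Fin (2 * j + 1) → Covector D) := by
    ext v
    have h1 := hpair (L₀ v) (fun α => by
      change covWedgeAlt D (2 * j + 1) _ v = 0
      rw [AlternatingMap.map_eq_zero_of_eq (covWedgeAlt D (2 * j + 1)) _
        (i := Fin.succ ⟨2 * i, by omega⟩) (j := Fin.succ ⟨2 * i + 1, by omega⟩)]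
      · rfl
      · simp
      · simp)
    -- Since `z` is already a factor, β may be replaced by δ, which differs from it by a multiple of
    -- `z`.
    have h2 : L₀ v z γ = 0 := by
      change covWedgeAlt D (2 * j + 1) _ v = 0
      rw [AlternatingMap.map_eq_zero_of_eq (covWedgeAlt D (2 * j + 1)) _
        (i := 0) (j := Fin.succ ⟨2 * i, by omega⟩)]
      · rfl
      · simp
      · exact (Fin.succ_ne_zero _).symm
    have h3 : L₀ v β γ = L₀ v δ γ := by
      rw [hβ, map_sub, map_smul, LinearMap.sub_apply, LinearMap.smul_apply, h2, smul_zero, sub_zero]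
    rw [h3] at h1
    refine Eq.trans ?_ h1
    rw [form_sum_apply]
    refine Finset.sum_congr rfl fun μ _ => ?_
    rw [AlternatingMap.add_apply]
    simp only [interleave_update, Function.update_self, Function.update_idem]
    rw [Function.update_comm hne.symm, Function.update_idem]
    rfl
  rw [hsum]
  refine Submodule.subset_span ⟨_, Fin.succ ⟨2 * i, by omega⟩, ?_, rfl⟩
  simp

end

section
variable {n : ℕ}

/-! ### The forms `h^{(j)}` -/

theorem hHat_eq (X : Fin n → ℝ → ℝ) (x : Fin (n + (n + 1)) → ℝ) :
    hHat X x = ∑ μ, covWedge ![rootX x μ • frameX X μ x, frameHat X μ x] := by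
  refine Finset.sum_congr rfl fun μ _ => ?_
  rw [plane_eq]
  ext v
  simp only [AlternatingMap.smul_apply, covWedge_apply, Matrix.det_fin_two, smul_eq_mul, rootX]
  simp
  ring

theorem hForm_eq (X N : Fin n → ℝ → ℝ) (j : ℕ) (x : Fin (n + (n + 1)) → ℝ) :
    hForm X N j x = ∑ m : Fin j → Fin n, covWedge (Fin.cons (frameZero N x)
      (interleave rfl ((fun μ => rootX x μ • frameX X μ x) ∘ m) ((frameHat X · x) ∘ m))) := by
  rw [hForm, hHat_eq, wedgePow_sum (fun μ => rootX x μ • frameX X μ x) (frameHat X · x),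
    wedge_sum_right]
  refine Finset.sum_congr rfl fun m _ => ?_
  rw [oneForm_eq_covWedge, wedge_covWedge, Fin.append_left_eq_cons]
  rfl

theorem IsRegularPoint.hasDirDeriv_rootX {X N : Fin n → ℝ → ℝ} {x : Fin (n + (n + 1)) → ℝ}
    (hx : IsRegularPoint X N x) (μ : Fin n) (u : Fin (n + (n + 1)) → ℝ) :
    HasDirDeriv (fun y => rootX y μ) x u (xiCoef X x μ * frameX X μ x u) := by
  refine ((HasDirDeriv.coord (xIdx μ)).sqrt (hx.pos μ)).congr_deriv ?_
  rw [hx.coord_eq μ u, xiCoef]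
  change _ / (2 * rootX x μ) = _
  ring

theorem exists_hasCovForm_hForm {X N : Fin n → ℝ → ℝ} {x : Fin (n + (n + 1)) → ℝ}
    (hx : IsRegularPoint X N x) (hn : n ≠ 0) {k : Fin n → ℝ}
    {G : (Fin (n + (n + 1)) → ℝ) → (Fin (n + (n + 1)) → ℝ) → Fin (n + (n + 1)) → ℝ}
    (hk : ∀ a u, HasCov (G u) x u (fun y => coframe X N y a) (connCoframe X N x k a u)) (j : ℕ)
    (u : Fin (n + (n + 1)) → ℝ) :
    ∃ η ∈ divisibleSpan (2 * j + 1) (stMetric X N x u), HasCovForm (G u) x u (hForm X N j) η := by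
  have he := isOrthonormalCoframe_coframe N hx.Q_pos
  have hE := isDualFrame_frame (N := N) hx.ne hx.Q_pos
  have hF : hForm X N j = fun y => ∑ m : Fin j → Fin n, covWedge fun i =>
      (Fin.cons (frameZero N y) (interleave rfl ((fun μ => rootX y μ • frameX X μ y) ∘ m)
        ((frameHat X · y) ∘ m)) : Fin (2 * j + 1) → Covector (n + (n + 1))) i :=
    funext fun y => hForm_eq X N j y
  rw [hF]
  refine ⟨_, sum_covWedge_update_mem hn (frameZero N x) (fun μ => rootX x μ • frameX X μ x)
    (frameHat X · x)
    (fun μ => (xiCoef X x μ * frameX X μ x u) • frameX X μ x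
      + rootX x μ • connCoframe X N x k (xIdx μ) u)
    (fun μ => connCoframe X N x k (hatIdx μ) u)
    (∑ μ, (frameX X μ x u • frameX X μ x + frameHat X μ x u • frameHat X μ x))
    (∑ ν, xiCoef X x ν • frameHat X ν x) (stMetric X N x u) (frameZero N x u) ?_ ?_,
    HasCovForm.sum fun m _ => HasCovForm.covWedge fun i => ?_⟩
  · refine LinearMap.ext fun v => ?_
    rw [LinearMap.sub_apply, he, sum_frame_index]
    simp [Finset.sum_add_distrib, LinearMap.sum_apply]
    ring
  · intro L hL
    simp only [connCoframe_xIdx, connCoframe_hatIdx]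
    refine sum_conn_pair (diffInv_swap x) (fun μ ν hμν => ?_) _ u L hL
    rw [hx.rootX_sq, hx.rootX_sq, diffInv, one_div,
      inv_mul_cancel₀ (sub_ne_zero.2 (hx.ne μ ν hμν))]
  · refine Fin.cases ?_ (fun i => ?_) i
    · simpa only [Fin.cons_zero, coframe_psiIdx_zero, connCoframe_psiIdx_zero] using hk (psiIdx 0) u
    · simp only [Fin.cons_succ, interleave, Function.comp_apply]
      split_ifs
      · have := (hk (xIdx (m ⟨i / 2, by omega⟩)) u).smul
          (hx.hasDirDeriv_rootX (m ⟨i / 2, by omega⟩) u)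
        simpa only [coframe_xIdx] using this
      · simpa only [coframe_hatIdx] using hk (hatIdx (m ⟨i / 2, by omega⟩)) u

theorem gccky_hForm {X N : Fin n → ℝ → ℝ} {x : Fin (n + (n + 1)) → ℝ}
    (hx : IsRegularPoint X N x) (hev : ∀ᶠ y in nhds x, ∀ μ : Fin n, 0 < Q X μ y) (hn : n ≠ 0)
    {j : ℕ} (hj : j ≤ n) :
    (∀ v, covExt (torsionConn (stMetric X N) (torsionG X N)) (hForm X N j) x v = 0) ∧
    ∀ (u : Fin (n + (n + 1)) → ℝ) v,
      covDeriv (torsionConn (stMetric X N) (torsionG X N)) (hForm X N j) x u v =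
        1 / (((2 * j + 1 : ℕ) : ℝ) + 1) *
          covExt (torsionConn (stMetric X N) (torsionG X N)) (hForm X N j) x (Fin.cons u v)
        - 1 / (((n + (n + 1) : ℕ) : ℝ) - ((2 * j + 1 : ℕ) : ℝ) + 1) * flatWedgeCodiff
          (stMetric X N) (torsionConn (stMetric X N) (torsionG X N)) (2 * j + 1) (hForm X N j) x u v := by
  obtain ⟨k, hk, hadd, hsmul⟩ := exists_hasCov_coframe hx hev
  choose η hη hcov using exists_hasCovForm_hForm hx hn hk j
  obtain ⟨B, hB, hB'⟩ := exists_linear_covDeriv hadd hsmul η hcov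
  exact gccky_of_wedge (isDualFrame_frame (N := N) hx.ne hx.Q_pos)
    (isOrthonormalCoframe_coframe N hx.Q_pos) (by omega) hB' fun u v =>
      wedgeOne_eq_zero_of_mem_divisibleSpan (hB u ▸ hη u) v

end

section
variable {n : ℕ}

/-! ### The forms `f^{(j)}` -/

theorem exists_interleave_left {T : Type*} {j q : ℕ} (hq : q = 2 * j) (a b : Fin j → T) (i : Fin j) :
    ∃ k, interleave hq a b k = a i :=
  ⟨⟨2 * i, by omega⟩, by simp [interleave]⟩

theorem exists_interleave_right {T : Type*} {j q : ℕ} (hq : q = 2 * j) (a b : Fin j → T)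
    (i : Fin j) : ∃ k, interleave hq a b k = b i := by
  subst hq
  exact ⟨_, interleave_odd a b i⟩

/-- The frame indices `0, μ_1, μ̂_1, …, μ_j, μ̂_j` of `S = {μ_1, …, μ_j}`. -/
def hIdx {j : ℕ} (S : {S : Finset (Fin n) // S.card = j}) : Fin (2 * j + 1) → Fin (n + (n + 1)) :=
  Fin.cons (psiIdx 0) (interleave rfl (xIdx ∘ enum S) (hatIdx ∘ enum S))

/-- The complement of a `j`-element set. -/
def complSet {j : ℕ} (S : {S : Finset (Fin n) // S.card = j}) :
    {S : Finset (Fin n) // S.card = n - j} :=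
  ⟨S.1ᶜ, by rw [Finset.card_compl, S.2, Fintype.card_fin]⟩

/-- The frame indices `ν_1, ν̂_1, …` of the complement `{ν_1, …, ν_{n-j}}` of `S`. -/
def fIdx {j : ℕ} (S : {S : Finset (Fin n) // S.card = j}) : Fin (2 * n - 2 * j) → Fin (n + (n + 1)) :=
  interleave (by omega) (xIdx ∘ enum (complSet S)) (hatIdx ∘ enum (complSet S))

/-- The frame indices split into those of `S` with `0` and those of the complement. -/
def frameSplit {j : ℕ} (hj : j ≤ n) (S : {S : Finset (Fin n) // S.card = j}) :
    Fin (2 * j + 1) ⊕ Fin (2 * n - 2 * j) ≃ Fin (n + (n + 1)) :=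
  Equiv.ofBijective (Sum.elim (hIdx S) (fIdx S)) (by
    rw [Fintype.bijective_iff_surjective_and_card]
    have hmem (μ : Fin n) : (∃ i, enum S i = μ) ∨ ∃ i, enum (complSet S) i = μ := by
      have h1 : μ ∈ Set.range (enum S) ∨ μ ∈ Set.range (enum (complSet S)) := by
        rw [range_enum, range_enum]
        simp [complSet, em]
      exact h1
    refine ⟨fun a => ?_, by simp; omega⟩
    induction a using forall_frame_index with
    | h1 μ =>
      rcases hmem μ with ⟨i, rfl⟩ | ⟨i, rfl⟩
      · obtain ⟨k, hk⟩ := exists_interleave_left rfl (xIdx ∘ enum S) (hatIdx ∘ enum S) i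
        exact ⟨Sum.inl k.succ, hk⟩
      · obtain ⟨k, hk⟩ := exists_interleave_left (q := 2 * n - 2 * j) (by omega) (xIdx ∘ enum (complSet S))
          (hatIdx ∘ enum (complSet S)) i
        exact ⟨Sum.inr k, hk⟩
    | h2 => exact ⟨Sum.inl 0, rfl⟩
    | h3 μ =>
      rcases hmem μ with ⟨i, rfl⟩ | ⟨i, rfl⟩
      · obtain ⟨k, hk⟩ := exists_interleave_right rfl (xIdx ∘ enum S) (hatIdx ∘ enum S) i
        exact ⟨Sum.inl k.succ, hk⟩
      · obtain ⟨k, hk⟩ := exists_interleave_right (q := 2 * n - 2 * j) (by omega) (xIdx ∘ enum (complSet S))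
          (hatIdx ∘ enum (complSet S)) i
        exact ⟨Sum.inr k, hk⟩)

/-- `∏_{μ ∈ S} √x_μ`. -/
def rootProd {j : ℕ} (S : {S : Finset (Fin n) // S.card = j}) (x : Fin (n + (n + 1)) → ℝ) : ℝ :=
  ∏ i, rootX x (enum S i)

/-- Noninjective choices repeat a factor and vanish; the rest group into subsets, with √x_μ pulled
out of the first member of each pair. In this basis of coframe products the Hodge star acts
termwise. -/
theorem hForm_eq_sum_subsets (X N : Fin n → ℝ → ℝ) (j : ℕ) (x : Fin (n + (n + 1)) → ℝ) :
    hForm X N j x = (j ! : ℝ) • ∑ S : {S : Finset (Fin n) // S.card = j},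
      rootProd S x • covWedge (fun i => coframe X N x (hIdx S i)) := by
  rw [hForm_eq]
  simp only [covWedge_cons_eq]
  rw [sum_interleave rfl ((covWedgeAlt _ (2 * j + 1)).curryLeft (frameZero N x))]
  congr 1
  refine Finset.sum_congr rfl fun S _ => ?_
  have h1 : interleave rfl ((fun μ => rootX x μ • frameX X μ x) ∘ enum S) ((frameHat X · x) ∘ enum S)
      = fun k : Fin (2 * j) => interleave rfl (rootX x ∘ enum S) (fun _ => 1) k •
        coframe X N x (interleave rfl (xIdx ∘ enum S) (hatIdx ∘ enum S) k) := by
    funext k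
    simp only [interleave]
    split_ifs <;> simp
  have h2 : (fun i => coframe X N x (hIdx S i)) = Fin.cons (frameZero N x)
      (fun k => coframe X N x (interleave rfl (xIdx ∘ enum S) (hatIdx ∘ enum S) k)) := by
    funext i
    refine Fin.cases ?_ (fun i => ?_) i
    · simp [hIdx]
    · simp [hIdx]
  rw [h1, h2, covWedge_cons_eq]
  refine (((covWedgeAlt _ (2 * j + 1)).curryLeft (frameZero N x)).toMultilinearMap.map_smul_univ
    _ _).trans ?_
  rw [prod_fin_pairs]
  simp only [interleave_even, interleave_odd, mul_one]
  rfl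

/-- The dual of `h^{(j)}` in the orientation of the coframe. -/
def dualForm (X N : Fin n → ℝ → ℝ) {j : ℕ} (hj : j ≤ n) :
    FormField (n + (n + 1)) (2 * n - 2 * j) := fun x =>
  (j ! : ℝ) • ∑ S : {S : Finset (Fin n) // S.card = j}, rootProd S x •
    splitSign (by omega) (frameSplit hj S) • covWedge (fun i => coframe X N x (fIdx S i))

/-- The orientation sign is locally constant, so it can be treated as a constant when the Hodge dual
is differentiated. -/
theorem abs_div_eventuallyEq {Y : Type*} [TopologicalSpace Y] {f : Y → ℝ} {x : Y}
    (hf : ContinuousAt f x) (h0 : f x ≠ 0) : ∀ᶠ y in nhds x, |f y| / f y = |f x| / f x := by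
  rcases lt_or_gt_of_ne h0 with h | h
  · filter_upwards [hf.eventually_lt_const h] with y hy
    rw [abs_of_neg hy, abs_of_neg h, neg_div, neg_div, div_self hy.ne, div_self h0]
  · filter_upwards [hf.eventually_const_lt h] with y hy
    rw [abs_of_pos hy, abs_of_pos h, div_self hy.ne', div_self h0]

variable {X N : Fin n → ℝ → ℝ} {x : Fin (n + (n + 1)) → ℝ}

theorem starLin_hForm (hx : IsRegularPoint X N x) {j : ℕ} (hj : j ≤ n) :
    starLin (by omega) (coframe X N x) (frame X N x) (hForm X N j x) = dualForm X N hj x := by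
  rw [hForm_eq_sum_subsets, map_smul, map_sum]
  simp only [map_smul]
  congr 1
  refine Finset.sum_congr rfl fun S _ => ?_
  congr 1
  exact starLin_split _ (isDualFrame_frame (N := N) hx.ne hx.Q_pos) (frameSplit hj S)

theorem IsRegularPoint.differentiableAt_coframe (hx : IsRegularPoint X N x)
    (a : Fin (n + (n + 1))) (v : Fin (n + (n + 1)) → ℝ) :
    DifferentiableAt ℝ (fun y => coframe X N y a v) x := by
  choose k hk using hx.hasDirDeriv_sqrtQ
  induction a using forall_frame_index with
  | h1 μ => simpa only [coframe_xIdx] using (hx.hasDirDeriv_frameX (hk μ) 0 v).1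
  | h2 => simpa only [coframe_psiIdx_zero] using (hx.hasDirDeriv_frameZero 0 v).1
  | h3 μ => simpa only [coframe_hatIdx] using (hx.hasDirDeriv_frameHat (hk μ) 0 v).1

theorem exists_fForm_eventuallyEq (hev : ∀ᶠ y in nhds x, IsRegularPoint X N y) {j : ℕ}
    (hj : j ≤ n) : ∃ s : ℝ, s ^ 2 = 1 ∧ fForm X N j hj =ᶠ[nhds x] fun y => s • dualForm X N hj y := by
  have hx := hev.self_of_nhds
  have hE := isDualFrame_frame (N := N) hx.ne hx.Q_pos
  let d (y : Fin (n + (n + 1)) → ℝ) : ℝ :=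
    (Matrix.of fun a k => coframe X N y a (coordVec k)).det
  have hd : ContinuousAt d x := by
    refine (Continuous.matrix_det continuous_id).continuousAt.comp ?_
    exact continuousAt_pi.2 fun a => continuousAt_pi.2 fun k =>
      (hx.differentiableAt_coframe a (coordVec k)).continuousAt
  refine ⟨|d x| / d x, ?_, ?_⟩
  · rw [div_pow, sq_abs, div_self (pow_ne_zero 2 hE.det_ne_zero)]
  · filter_upwards [hev, abs_div_eventuallyEq hd hE.det_ne_zero] with y hy hdy
    rw [fForm, hodge_eq (isDualFrame_frame (N := N) hy.ne hy.Q_pos)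
      (isOrthonormalCoframe_coframe N hy.Q_pos), starLin_hForm hy hj, ← hdy]

theorem HasCovForm.unique {D p : ℕ} {G : (Fin D → ℝ) → Fin D → ℝ} {x u : Fin D → ℝ}
    {θ : FormField D p} {η η' : Form D p} (h : HasCovForm G x u θ η) (h' : HasCovForm G x u θ η') :
    η = η' := by
  ext v
  have := (h v).2.symm.trans (h' v).2
  linarith

/-- The subset expansions of h and of its dual are differentiated with the same coefficients
`rootProd`. The star matches the scalar parts by `starLin_split` and the connection parts by
`starLin_split_update`, the connection matrix being skew. -/
theorem hasCovForm_dualForm (hx : IsRegularPoint X N x) {j : ℕ} (hj : j ≤ n) {k : Fin n → ℝ}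
    {G : (Fin (n + (n + 1)) → ℝ) → (Fin (n + (n + 1)) → ℝ) → Fin (n + (n + 1)) → ℝ}
    (hk : ∀ a u, HasCov (G u) x u (fun y => coframe X N y a) (connCoframe X N x k a u))
    {u : Fin (n + (n + 1)) → ℝ} {η : Form (n + (n + 1)) (2 * j + 1)}
    (hη : HasCovForm (G u) x u (hForm X N j) η) :
    HasCovForm (G u) x u (dualForm X N hj)
      (starLin (by omega) (coframe X N x) (frame X N x) η) := by
  have hE := isDualFrame_frame (N := N) hx.ne hx.Q_pos
  have hr (S : {S : Finset (Fin n) // S.card = j}) := HasDirDeriv.prod (s := Finset.univ)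
    fun i (_ : i ∈ Finset.univ) => hx.hasDirDeriv_rootX (enum S i) u
  have h1 := HasCovForm.const_smul (j ! : ℝ) (HasCovForm.sum (s := Finset.univ)
    fun S (_ : S ∈ Finset.univ) => HasCovForm.smul (hr S)
      (HasCovForm.covWedge fun i => hk (hIdx S i) u))
  have h2 := HasCovForm.const_smul (j ! : ℝ) (HasCovForm.sum (s := Finset.univ)
    fun S (_ : S ∈ Finset.univ) => HasCovForm.smul (hr S) (HasCovForm.const_smul
      (splitSign (by omega : (2 * j + 1) + (2 * n - 2 * j) = n + (n + 1)) (frameSplit hj S))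
      (HasCovForm.covWedge fun i => hk (fIdx S i) u)))
  rw [show hForm X N j = _ from funext fun y => hForm_eq_sum_subsets X N j y] at hη
  -- The given derivative, known to be divisible by u^♭, coincides with the one from the subset
  -- expansion because ∇_u h is unique.
  rw [hη.unique h1]
  convert h2 using 1
  · rfl
  rw [map_smul, map_sum]
  congr 1
  refine Finset.sum_congr rfl fun S _ => ?_
  rw [map_add, map_smul, map_smul]
  congr 2
  · exact starLin_split _ hE (frameSplit hj S)
  · have hskew (a b : Fin (n + (n + 1))) : connCoframe X N x k a u (frame X N x b)
        = -connCoframe X N x k b u (frame X N x a) := by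
      have := connCoframe_skew X N x k u (frame X N x a) (frame X N x b)
      simp only [hE _ _, mul_ite, ite_mul, mul_one, mul_zero, one_mul, zero_mul,
        Finset.sum_add_distrib, Finset.sum_ite_eq', Finset.mem_univ, if_true] at this
      linarith
    have := starLin_split_update (by omega) hE (frameSplit hj S)
      (fun a b => connCoframe X N x k a u (frame X N x b)) hskew
    simp only [hE.covector_sum] at this
    exact this

theorem gky_fForm (hev : ∀ᶠ y in nhds x, IsRegularPoint X N y) (hn : n ≠ 0)
    {j : ℕ} (hj : j ≤ n) :
    (∀ v, codiff (stMetric X N) (torsionConn (stMetric X N) (torsionG X N)) (2 * n - 2 * j)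
      (fForm X N j hj) x v = 0) ∧
    ∀ (u : Fin (n + (n + 1)) → ℝ) v,
      covDeriv (torsionConn (stMetric X N) (torsionG X N)) (fForm X N j hj) x u v =
        1 / (((2 * n - 2 * j : ℕ) : ℝ) + 1) *
          covExt (torsionConn (stMetric X N) (torsionG X N)) (fForm X N j hj) x (Fin.cons u v)
        - 1 / (((n + (n + 1) : ℕ) : ℝ) - ((2 * n - 2 * j : ℕ) : ℝ) + 1) * flatWedgeCodiff
          (stMetric X N) (torsionConn (stMetric X N) (torsionG X N)) (2 * n - 2 * j)
          (fForm X N j hj) x u v := by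
  have hx := hev.self_of_nhds
  have he := isOrthonormalCoframe_coframe N hx.Q_pos
  have hE := isDualFrame_frame (N := N) hx.ne hx.Q_pos
  obtain ⟨k, hk, hadd, hsmul⟩ := exists_hasCov_coframe hx (hev.mono fun y hy => hy.Q_pos)
  choose η hη hcov using exists_hasCovForm_hForm hx hn hk j
  obtain ⟨s, -, hs⟩ := exists_fForm_eventuallyEq hev hj
  obtain ⟨B, hB, hB'⟩ := exists_linear_covDeriv hadd hsmul _ fun u =>
    ((hasCovForm_dualForm hx hj hk (hcov u)).const_smul s).congr_of_eventuallyEq hs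
  refine gky_of_skew hE he hB' fun u v i hi => ?_
  rw [hB, AlternatingMap.smul_apply,
    starLin_eq_zero_of_mem_divisibleSpan _ hE he (hη u) v i hi, smul_zero]

end

section
/-! ### The contraction of `f^{(j)}` with itself -/

section
variable {D p : ℕ} {e : Fin D → Covector D} {E : Fin D → Fin D → ℝ} {g : TwoTensorField D}
  {x : Fin D → ℝ}

theorem IsDualFrame.covWedge_eq_zero (hE : IsDualFrame e E) {a b : Fin p → Fin D} (k : Fin p)
    (h : ∀ r, a k ≠ b r) : covWedge (fun i => e (a i)) (fun i => E (b i)) = 0 := by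
  rw [covWedge_apply']
  refine Matrix.det_eq_zero_of_row_eq_zero k fun r => ?_
  simp [hE _ _, h]

theorem IsDualFrame.covWedge_self (hE : IsDualFrame e E) {a : Fin p → Fin D}
    (ha : Function.Injective a) : covWedge (fun i => e (a i)) (fun i => E (a i)) = 1 := by
  rw [covWedge_apply', ← Matrix.det_one (n := Fin p)]
  congr 1
  ext i k
  simp [hE _ _, Matrix.one_apply, ha.eq_iff]

/-- Cross terms vanish by `hcc`: the single free slot can absorb only one of the two indices of `c
S'` missing from `c S`. On the diagonal the expansion signs square to one, and the sum over the p −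
1 contracted indices gives the factorial. -/
theorem formSquare_eq (hE : IsDualFrame e E) (he : IsOrthonormalCoframe g x e) {ι : Type*}
    [Fintype ι] {c : ι → Fin p → Fin D} (hc : ∀ S, Function.Injective (c S))
    (hcc : ∀ S S', S' ≠ S → ∃ k k', k ≠ k' ∧ (∀ r, c S' k ≠ c S r) ∧ ∀ r, c S' k' ≠ c S r)
    {w : ι → ℝ} {f : FormField D p} (hf : f x = ∑ S, w S • covWedge (fun i => e (c S i)))
    (u v : Fin D → ℝ) :
    formSquare g p f x u v = ((p - 1)! : ℝ) * ∑ S, w S ^ 2 * ∑ i, e (c S i) u * e (c S i) v := by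
  classical
  rcases p with _ | p
  · simp [formSquare]
  have hdiag (S : ι) (i : Fin (p + 1)) : covWedge (fun r => e (c S r))
      (Fin.cons v fun k => E (c S (i.succAbove k))) = (-1) ^ (i : ℕ) * e (c S i) v := by
    rw [covWedge_apply_cons, Finset.sum_eq_single i]
    · have := hE.covWedge_self ((hc S).comp i.succAbove_right_injective)
      simp only [Function.comp_apply] at this
      rw [this, mul_one]
    · intro k _ hk
      obtain ⟨m, hm⟩ := Fin.exists_succAbove_eq hk.symm
      rw [hE.covWedge_eq_zero m, mul_zero]
      intro r hr
      rw [hm] at hr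
      exact i.succAbove_ne r ((hc S) hr).symm
    · simp
  have hoff (S S' : ι) (h : S' ≠ S) (i : Fin (p + 1)) : covWedge (fun r => e (c S' r))
      (Fin.cons v fun k => E (c S (i.succAbove k))) = 0 := by
    obtain ⟨k₁, k₂, hk, h1, h2⟩ := hcc S S' h
    rw [covWedge_apply_cons]
    refine Finset.sum_eq_zero fun k _ => ?_
    by_cases hk1 : k₁ = k
    · obtain ⟨m, hm⟩ := Fin.exists_succAbove_eq (hk1 ▸ hk.symm : k₂ ≠ k)
      rw [hE.covWedge_eq_zero m (fun r => by rw [hm]; exact h2 _), mul_zero]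
    · obtain ⟨m, hm⟩ := Fin.exists_succAbove_eq hk1
      rw [hE.covWedge_eq_zero m (fun r => by rw [hm]; exact h1 _), mul_zero]
  have hval (S : ι) (i : Fin (p + 1)) : f x (Fin.cons v fun k => E (c S (i.succAbove k)))
      = w S * ((-1) ^ (i : ℕ) * e (c S i) v) := by
    rw [hf, form_sum_apply, Finset.sum_eq_single S]
    · rw [AlternatingMap.smul_apply, hdiag, smul_eq_mul]
    · intro S' _ h
      rw [AlternatingMap.smul_apply, hoff S S' h, smul_zero]
    · simp
  have hexp (m : Fin p → Fin D) : f x (Fin.cons u fun i => coordVec (m i))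
      = ∑ S, ∑ i : Fin (p + 1), w S * ((-1) ^ (i : ℕ) * e (c S i) u) *
        covWedge (fun k => e (c S (i.succAbove k))) (fun i => coordVec (m i)) := by
    rw [hf, form_sum_apply]
    refine Finset.sum_congr rfl fun S _ => ?_
    rw [AlternatingMap.smul_apply, covWedge_apply_cons, smul_eq_mul, Finset.mul_sum]
    exact Finset.sum_congr rfl fun i _ => by ring
  simp only [formSquare, hexp, Finset.sum_mul, hE.sharp_coordForm he]
  rw [Finset.sum_comm, Nat.add_sub_cancel, Finset.mul_sum]
  refine Finset.sum_congr rfl fun S _ => ?_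
  rw [Finset.sum_comm, Finset.mul_sum, Finset.mul_sum]
  refine Finset.sum_congr rfl fun i _ => ?_
  simp only [mul_assoc, ← Finset.mul_sum]
  have := sum_covWedge_mul coordVec (fun a => ∑ d, E d a • E d)
    (fun k => e (c S (i.succAbove k))) ((f x).curryLeft v)
  have h2 (k : Fin p) : ∑ d, e (c S (i.succAbove k)) (E d) • E d = E (c S (i.succAbove k)) := by
    simp [hE _ _]
  simp only [sum_coordVec_smul_sum, h2] at this
  rw [show ∑ m : Fin p → Fin D, covWedge (fun k => e (c S (i.succAbove k)))
      (fun i => coordVec (m i)) * f x (Fin.cons v fun i => ∑ d, E d (m i) • E d)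
      = (p ! : ℝ) * f x (Fin.cons v fun k => E (c S (i.succAbove k))) from this, hval]
  have h3 : ((-1 : ℝ) ^ (i : ℕ)) * (-1) ^ (i : ℕ) = 1 := by
    rw [← mul_pow]; simp
  linear_combination (w S ^ 2 * e (c S i) u * e (c S i) v * (p ! : ℝ)) * h3

end

variable {n : ℕ}

theorem sum_interleave_eq {j q : ℕ} (hq : q = 2 * j) (a b : Fin j → ℝ) :
    ∑ k, interleave hq a b k = ∑ i, (a i + b i) := by
  subst hq
  rw [sum_fin_pairs]
  simp only [interleave_even, interleave_odd]

theorem sum_enum {j : ℕ} (S : {S : Finset (Fin n) // S.card = j}) (F : Fin n → ℝ) :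
    ∑ i, F (enum S i) = ∑ μ ∈ S.1, F μ := by
  conv_rhs => rw [← S.1.map_orderEmbOfFin_univ S.2, Finset.sum_map]
  rfl

theorem prod_enum {j : ℕ} (S : {S : Finset (Fin n) // S.card = j}) (F : Fin n → ℝ) :
    ∏ i, F (enum S i) = ∏ μ ∈ S.1, F μ := by
  conv_rhs => rw [← S.1.map_orderEmbOfFin_univ S.2, Finset.prod_map]
  rfl

/-- After exchanging the sums, the sets contributing to a fixed μ are the j-element sets avoiding μ,
whose products sum to σ_μ^{(j)}. -/
theorem sum_subsets_compl (j : ℕ) (x : Fin (n + (n + 1)) → ℝ) (F : Fin n → ℝ) :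
    ∑ S : {S : Finset (Fin n) // S.card = j}, (∏ μ ∈ S.1, x (xIdx μ)) * ∑ μ ∈ S.1ᶜ, F μ
      = ∑ μ, sigmaErase μ j x * F μ := by
  have h1 : ∑ S : {S : Finset (Fin n) // S.card = j}, (∏ μ ∈ S.1, x (xIdx μ)) * ∑ μ ∈ S.1ᶜ, F μ
      = ∑ S ∈ Finset.powersetCard j Finset.univ, (∏ μ ∈ S, x (xIdx μ)) * ∑ μ ∈ Sᶜ, F μ :=
    (Finset.sum_subtype (p := fun S : Finset (Fin n) => S.card = j)
      (Finset.powersetCard j Finset.univ) (fun S => by simp)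
      (fun S => (∏ μ ∈ S, x (xIdx μ)) * ∑ μ ∈ Sᶜ, F μ)).symm
  have h2 (μ : Fin n) : (Finset.univ.erase μ).powersetCard j
      = {S ∈ Finset.powersetCard j (Finset.univ : Finset (Fin n)) | μ ∈ Sᶜ} := by
    ext S
    simp [Finset.mem_powersetCard, Finset.subset_erase, and_comm]
  rw [h1]
  simp only [sigmaErase, h2, Finset.sum_filter, Finset.sum_mul, Finset.mul_sum]
  rw [Finset.sum_comm' (s := Finset.univ) (t := fun _ => Finset.powersetCard j Finset.univ)
    (t' := Finset.powersetCard j Finset.univ) (s' := fun _ => Finset.univ) (by simp)]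
  refine Finset.sum_congr rfl fun S _ => ?_
  rw [← Finset.sum_filter_add_sum_filter_not Finset.univ (fun μ => μ ∈ Sᶜ)]
  rw [Finset.sum_eq_zero (s := {μ | ¬ μ ∈ Sᶜ}) (fun μ hμ => by
    rw [if_neg (Finset.mem_filter.1 hμ).2, zero_mul]), add_zero]
  refine Finset.sum_congr (by ext; simp) fun μ hμ => ?_
  rw [if_pos (Finset.mem_filter.1 hμ).2]

theorem interleave_eq_or {T : Type*} {j q : ℕ} (hq : q = 2 * j) (a b : Fin j → T) (k : Fin q) :
    (∃ i, interleave hq a b k = a i) ∨ ∃ i, interleave hq a b k = b i := by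
  simp only [interleave]
  split_ifs
  exacts [Or.inl ⟨_, rfl⟩, Or.inr ⟨_, rfl⟩]

theorem KTensor_apply (X : Fin n → ℝ → ℝ) (j : ℕ) (x u v : Fin (n + (n + 1)) → ℝ) :
    KTensor X j x u v = ∑ μ, sigmaErase μ j x *
      (frameX X μ x u * frameX X μ x v + frameHat X μ x u * frameHat X μ x v) := by
  simp only [KTensor, LinearMap.sum_apply, LinearMap.smul_apply, LinearMap.add_apply, smul_eq_mul]
  rfl

theorem formSquare_fForm {X N : Fin n → ℝ → ℝ} {x : Fin (n + (n + 1)) → ℝ}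
    (hev : ∀ᶠ y in nhds x, IsRegularPoint X N y) {j : ℕ} (hj : j ≤ n)
    (u v : Fin (n + (n + 1)) → ℝ) :
    formSquare (stMetric X N) (2 * n - 2 * j) (fForm X N j hj) x u v
      = ((j ! : ℝ) ^ 2 * ((2 * n - 2 * j - 1)! : ℝ)) * KTensor X j x u v := by
  have hx := hev.self_of_nhds
  have he := isOrthonormalCoframe_coframe N hx.Q_pos
  have hE := isDualFrame_frame (N := N) hx.ne hx.Q_pos
  obtain ⟨s, hs, hf⟩ := exists_fForm_eventuallyEq hev hj
  have hfx : fForm X N j hj x = ∑ S : {S : Finset (Fin n) // S.card = j},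
      (s * ((j ! : ℝ) * (rootProd S x * splitSign (by omega) (frameSplit hj S)))) •
        covWedge (fun i => coframe X N x (fIdx S i)) := by
    rw [hf.self_of_nhds]
    simp only [dualForm, Finset.smul_sum, smul_smul]
  have hinj (S : {S : Finset (Fin n) // S.card = j}) : Function.Injective (fIdx S) := fun a b hab =>
    Sum.inr_injective ((frameSplit hj S).injective hab)
  rw [formSquare_eq hE he hinj (fun S S' h => ?_) hfx]
  · have hsum (S : {S : Finset (Fin n) // S.card = j}) :
        ∑ i, coframe X N x (fIdx S i) u * coframe X N x (fIdx S i) v = ∑ μ ∈ S.1ᶜ,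
          (frameX X μ x u * frameX X μ x v + frameHat X μ x u * frameHat X μ x v) := by
      simp only [fIdx, comp_interleave _ (fun a => coframe X N x a u * coframe X N x a v)]
      rw [sum_interleave_eq, show S.1ᶜ = (complSet S).1 from rfl, ← sum_enum (complSet S)]
      simp
    have hw (S : {S : Finset (Fin n) // S.card = j}) :
        (s * ((j ! : ℝ) * (rootProd S x * splitSign (by omega) (frameSplit hj S)))) ^ 2
          = (j ! : ℝ) ^ 2 * ∏ μ ∈ S.1, x (xIdx μ) := by
      rw [mul_pow, mul_pow, mul_pow, hs, splitSign_sq, ← prod_enum S, rootProd,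
        ← Finset.prod_pow]
      simp only [hx.rootX_sq]
      ring
    simp only [hsum, hw, mul_assoc, ← Finset.mul_sum]
    rw [sum_subsets_compl, KTensor_apply]
    ring
  -- Distinct complements of equal cardinality are not nested, so some ν belongs to that of `S'`
  -- alone; its two indices ν and ν̂ are the required pair.
  · obtain ⟨ν, hν, hν'⟩ : ∃ ν ∈ S'.1ᶜ, ν ∉ S.1ᶜ := by
      by_contra! hcon
      refine h (Subtype.ext (compl_injective ?_))
      exact Finset.eq_of_subset_of_card_le hcon (by simp [Finset.card_compl, S.2, S'.2])
    obtain ⟨i, hi⟩ : ν ∈ Set.range (enum (complSet S')) := by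
      rw [range_enum]; exact hν
    have hS (r) : enum (complSet S) r ≠ ν := fun hr => hν' (by
      have : ν ∈ Set.range (enum (complSet S)) := ⟨r, hr⟩
      rw [range_enum] at this
      exact this)
    obtain ⟨k, hk⟩ := exists_interleave_left (q := 2 * n - 2 * j) (by omega)
      (xIdx ∘ enum (complSet S')) (hatIdx ∘ enum (complSet S')) i
    obtain ⟨k', hk'⟩ := exists_interleave_right (q := 2 * n - 2 * j) (by omega)
      (xIdx ∘ enum (complSet S')) (hatIdx ∘ enum (complSet S')) i
    rw [Function.comp_apply, hi] at hk hk'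
    refine ⟨k, k', fun hkk => ?_, fun r => ?_, fun r => ?_⟩
    · rw [hkk, hk'] at hk
      exact xIdx_ne_hatIdx _ _ hk.symm
    · rw [fIdx, hk]
      rcases interleave_eq_or (q := 2 * n - 2 * j) (by omega) (xIdx ∘ enum (complSet S))
        (hatIdx ∘ enum (complSet S)) r with ⟨m, hm⟩ | ⟨m, hm⟩
      · rw [fIdx, hm, Function.comp_apply, Ne, xIdx_inj]
        exact (hS m).symm
      · rw [fIdx, hm]
        exact xIdx_ne_hatIdx _ _
    · rw [fIdx, hk']
      rcases interleave_eq_or (q := 2 * n - 2 * j) (by omega) (xIdx ∘ enum (complSet S))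
        (hatIdx ∘ enum (complSet S)) r with ⟨m, hm⟩ | ⟨m, hm⟩
      · rw [fIdx, hm]
        exact (xIdx_ne_hatIdx _ _).symm
      · rw [fIdx, hm, Function.comp_apply, Ne, hatIdx_inj]
        exact (hS m).symm

end

section
variable {n : ℕ}

/-! ### The Killing tensors -/

/-- `B` is ∇K for K = Σ s_μ (e^μ ⊗ e^μ + e^μ̂ ⊗ e^μ̂). About `s` only the divided-difference formula
for its derivative enters, through `hB`. The rotations `r` cancel within each plane, and the cyclic
sum vanishes pair by pair. -/
theorem cyclic_sum_eq_zero {l ξ s : Fin n → ℝ} {d : Fin n → Fin n → ℝ}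
    {D : ℕ} {e h : Fin n → Covector D} (hd : ∀ μ ν, d ν μ = -d μ ν) (r : Fin n → Covector D)
    (B : (Fin D → ℝ) → (Fin D → ℝ) → (Fin D → ℝ) → ℝ)
    (hB : ∀ u v w, B u v w = ∑ μ,
      ((∑ ν ∈ Finset.univ.erase μ, 2 * (l ν * ξ ν * e ν u) * ((s ν - s μ) * d μ ν)) *
          (e μ v * e μ w + h μ v * h μ w)
        + s μ * (connX l ξ d e h μ (r μ u) u v * e μ w + e μ v * connX l ξ d e h μ (r μ u) u w
          + (connHat l ξ d e h μ (r μ u) u v * h μ w + h μ v * connHat l ξ d e h μ (r μ u) u w))))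
    (u v w : Fin D → ℝ) : B u v w + B v w u + B w u v = 0 := by
  have hB' (u v w) : B u v w = ∑ μ, ∑ ν ∈ Finset.univ.erase μ, d μ ν *
      (2 * (l ν * ξ ν * e ν u) * (s ν - s μ) * (e μ v * e μ w + h μ v * h μ w)
        + s μ * (((l μ * ξ μ * e ν u + l ν * ξ ν * e μ u) * e ν v
            + (l μ * (ξ μ * h ν u - ξ ν * h μ u)) * h ν v) * e μ w
          + e μ v * ((l μ * ξ μ * e ν u + l ν * ξ ν * e μ u) * e ν w
            + (l μ * (ξ μ * h ν u - ξ ν * h μ u)) * h ν w)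
          + (-((l ν * (ξ μ * h ν u - ξ ν * h μ u)) * e ν v)
            + (l ν * ξ μ * e ν u + l μ * ξ ν * e μ u) * h ν v) * h μ w
          + h μ v * (-((l ν * (ξ μ * h ν u - ξ ν * h μ u)) * e ν w)
            + (l ν * ξ μ * e ν u + l μ * ξ ν * e μ u) * h ν w))) := by
    rw [hB]
    refine Finset.sum_congr rfl fun μ _ => ?_
    simp only [connX_apply, connHat_apply]
    have h1 : ∀ P C : Fin n → ℝ, ∀ c : ℝ, ∀ A A' B B' : Fin n → ℝ,
        ∑ ν ∈ Finset.univ.erase μ, d μ ν * (P ν * C ν * c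
          + s μ * (A ν * e μ w + e μ v * A' ν + B ν * h μ w + h μ v * B' ν))
        = (∑ ν ∈ Finset.univ.erase μ, P ν * (C ν * d μ ν)) * c
          + s μ * ((∑ ν ∈ Finset.univ.erase μ, d μ ν * A ν) * e μ w
            + e μ v * (∑ ν ∈ Finset.univ.erase μ, d μ ν * A' ν)
            + (∑ ν ∈ Finset.univ.erase μ, d μ ν * B ν) * h μ w
            + h μ v * ∑ ν ∈ Finset.univ.erase μ, d μ ν * B' ν) := by
      intro P C c A A' B B'
      simp only [Finset.sum_mul, Finset.mul_sum, ← Finset.sum_add_distrib]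
      exact Finset.sum_congr rfl fun ν _ => by ring
    rw [h1]
    ring
  simp only [hB', ← Finset.sum_add_distrib]
  refine sum_erase_eq_zero fun μ ν _ => ?_
  rw [hd μ ν]
  ring

theorem torsion_sharp_swap {D : ℕ} (g : TwoTensorField D) (T : Form D 3) (x u v : Fin D → ℝ) :
    sharp g x (fun c => T ![v, u, coordVec c]) = -sharp g x (fun c => T ![u, v, coordVec c]) := by
  rw [sharp, sharp, ← Matrix.mulVec_neg]
  congr 1
  funext c
  have := T.map_swap ![u, v, coordVec c] (i := 0) (j := 1) (by decide)
  rw [Pi.neg_apply, ← this]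
  congr 1
  funext i
  fin_cases i <;> rfl

theorem KTensor_symm (X : Fin n → ℝ → ℝ) (j : ℕ) (x v w : Fin (n + (n + 1)) → ℝ) :
    KTensor X j x v w = KTensor X j x w v := by
  rw [KTensor_apply, KTensor_apply]
  exact Finset.sum_congr rfl fun μ _ => by ring

/-- Passing from ∇^G to the Levi-Civita connection adds terms K(t(u, v), w), with t antisymmetric;
as K is symmetric, they cancel in the cyclic sum. -/
theorem killing_KTensor {X N : Fin n → ℝ → ℝ} {x : Fin (n + (n + 1)) → ℝ}
    (hx : IsRegularPoint X N x) (hev : ∀ᶠ y in nhds x, ∀ μ : Fin n, 0 < Q X μ y) (j : ℕ)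
    (u v w : Fin (n + (n + 1)) → ℝ) :
    covDerivTwo (stMetric X N) (KTensor X j) x u v w
      + covDerivTwo (stMetric X N) (KTensor X j) x v w u
      + covDerivTwo (stMetric X N) (KTensor X j) x w u v = 0 := by
  obtain ⟨k, hk, -, -⟩ := exists_hasCov_coframe hx hev
  set Γ := torsionConn (stMetric X N) (torsionG X N) x with hΓ
  let t (u v : Fin (n + (n + 1)) → ℝ) : Fin (n + (n + 1)) → ℝ :=
    sharp (stMetric X N) x (fun c => torsionG X N x ![u, v, coordVec c])
  have ht (u v) : t v u = -t u v := torsion_sharp_swap _ _ x u v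
  have hLC (u v) : leviCivita (stMetric X N) x u v = Γ u v - (1 / 2 : ℝ) • t u v := by
    rw [hΓ, torsionConn, add_sub_cancel_right]
  let B (u v w : Fin (n + (n + 1)) → ℝ) : ℝ := fderiv ℝ (fun y => KTensor X j y v w) x u
    - KTensor X j x (Γ u v) w - KTensor X j x v (Γ u w)
  have hcov (u v w) : covDerivTwo (stMetric X N) (KTensor X j) x u v w
      = B u v w + 1 / 2 * (KTensor X j x (t u v) w + KTensor X j x v (t u w)) := by
    simp only [covDerivTwo, hLC, B, map_sub, map_smul, LinearMap.sub_apply, LinearMap.smul_apply,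
      smul_eq_mul]
    ring
  have hB (u v w) : B u v w = ∑ μ,
      ((∑ ν ∈ Finset.univ.erase μ, 2 * (rootX x ν * xiCoef X x ν * frameX X ν x u) *
            ((sigmaErase ν j x - sigmaErase μ j x) * diffInv x μ ν)) *
          (frameX X μ x v * frameX X μ x w + frameHat X μ x v * frameHat X μ x w)
        + sigmaErase μ j x * (connCoframe X N x k (xIdx μ) u v * frameX X μ x w
          + frameX X μ x v * connCoframe X N x k (xIdx μ) u w
          + (connCoframe X N x k (hatIdx μ) u v * frameHat X μ x w
          + frameHat X μ x v * connCoframe X N x k (hatIdx μ) u w))) := by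
    have hX (μ v) := hk (xIdx μ) u v
    have hH (μ v) := hk (hatIdx μ) u v
    simp only [coframe_xIdx] at hX
    simp only [coframe_hatIdx] at hH
    have hK := HasDirDeriv.sum (s := Finset.univ) fun μ (_ : μ ∈ Finset.univ) =>
      (hasDirDeriv_sigmaErase μ j hx.ne u).mul
        (((hX μ v).mul (hX μ w)).add ((hH μ v).mul (hH μ w)))
    simp only [← KTensor_apply] at hK
    simp only [B, hK.2]
    rw [KTensor_apply, KTensor_apply, ← Finset.sum_sub_distrib, ← Finset.sum_sub_distrib]
    refine Finset.sum_congr rfl fun μ _ => ?_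
    have hσ : ∑ ν ∈ Finset.univ.erase μ, u (xIdx ν) *
        ((sigmaErase ν j x - sigmaErase μ j x) / (x (xIdx μ) - x (xIdx ν)))
        = ∑ ν ∈ Finset.univ.erase μ, 2 * (rootX x ν * xiCoef X x ν * frameX X ν x u) *
            ((sigmaErase ν j x - sigmaErase μ j x) * diffInv x μ ν) :=
      Finset.sum_congr rfl fun ν _ => by
        rw [hx.coord_eq ν u, hx.sqrtQ_eq ν, diffInv]
        ring
    rw [hσ]
    ring
  have hcyc := cyclic_sum_eq_zero (diffInv_swap x) (fun μ => spinG X N x k μ) B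
    (fun u v w => by simpa only [connCoframe_xIdx, connCoframe_hatIdx] using hB u v w) u v w
  rw [hcov, hcov, hcov, ht u v, ht u w, ht v w, KTensor_symm X j x v (t u w),
    KTensor_symm X j x w, KTensor_symm X j x u]
  simp only [map_neg, LinearMap.neg_apply]
  linear_combination hcyc

end

section
/-! ### Smoothness -/

theorem contDiffAt_covWedge {D p : ℕ} {x : Fin D → ℝ} {α : Fin p → (Fin D → ℝ) → Covector D}
    (h : ∀ i v, ContDiffAt ℝ ∞ (fun y => α i y v) x) (v : Fin p → Fin D → ℝ) :
    ContDiffAt ℝ ∞ (fun y => covWedge (fun i => α i y) v) x := by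
  simp only [covWedge_eq_sum, Units.smul_def, zsmul_eq_mul]
  exact ContDiffAt.sum fun s _ => contDiffAt_const.mul (contDiffAt_prod fun i _ => h _ _)

variable {n : ℕ}

/-- Regular points at which the functions `X_μ` and `N_μ` are smooth. -/
structure IsSmoothPoint (X N : Fin n → ℝ → ℝ) (x : Fin (n + (n + 1)) → ℝ) : Prop where
  pos : ∀ μ : Fin n, 0 < x (xIdx μ)
  ne : ∀ μ ν : Fin n, μ ≠ ν → x (xIdx μ) ≠ x (xIdx ν)
  Q_pos : ∀ μ : Fin n, 0 < Q X μ x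
  smoothX : ∀ μ : Fin n, ContDiffAt ℝ ∞ (X μ) (x (xIdx μ))
  smoothN : ∀ μ : Fin n, ContDiffAt ℝ ∞ (N μ) (x (xIdx μ))

namespace IsSmoothPoint

variable {X N : Fin n → ℝ → ℝ} {x : Fin (n + (n + 1)) → ℝ}

theorem isRegularPoint (hx : IsSmoothPoint X N x) : IsRegularPoint X N x where
  pos := hx.pos
  ne := hx.ne
  Q_pos := hx.Q_pos
  diffX μ := (hx.smoothX μ).differentiableAt (by simp)
  diffN μ := (hx.smoothN μ).differentiableAt (by simp)

theorem contDiffAt_coord (a : Fin (n + (n + 1))) :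
    ContDiffAt ℝ ∞ (fun y : Fin (n + (n + 1)) → ℝ => y a) x :=
  (contDiff_apply ℝ ℝ a).contDiffAt

theorem contDiffAt_U (μ : Fin n) : ContDiffAt ℝ ∞ (U μ) x :=
  contDiffAt_prod fun _ _ => (contDiffAt_coord _).sub (contDiffAt_coord _)

theorem contDiffAt_sqrtQ (hx : IsSmoothPoint X N x) (μ : Fin n) :
    ContDiffAt ℝ ∞ (fun y => Real.sqrt (Q X μ y)) x :=
  (((hx.smoothX μ).comp x (contDiffAt_coord (xIdx μ))).div (contDiffAt_U μ)
    (U_ne_zero hx.ne μ)).sqrt (hx.Q_pos μ).ne'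

theorem contDiffAt_esym (s : Finset (Fin n)) (k : ℕ) :
    ContDiffAt ℝ ∞ (fun y => ∑ t ∈ s.powersetCard k, ∏ ν ∈ t, y (xIdx ν)) x :=
  ContDiffAt.sum fun _ _ => contDiffAt_prod fun _ _ => contDiffAt_coord _

theorem contDiffAt_theta (μ : Fin n) (v : Fin (n + (n + 1)) → ℝ) :
    ContDiffAt ℝ ∞ (fun y => theta μ y v) x := by
  simp only [theta, LinearMap.sum_apply, LinearMap.smul_apply, smul_eq_mul]
  exact ContDiffAt.sum fun k _ => (contDiffAt_esym _ _).mul contDiffAt_const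

theorem contDiffAt_coframe (hx : IsSmoothPoint X N x) (a : Fin (n + (n + 1)))
    (v : Fin (n + (n + 1)) → ℝ) : ContDiffAt ℝ ∞ (fun y => coframe X N y a v) x := by
  induction a using forall_frame_index with
  | h1 μ =>
    simp only [coframe_xIdx, frameX, LinearMap.smul_apply, smul_eq_mul]
    exact (contDiffAt_const.div (hx.contDiffAt_sqrtQ μ)
      (hx.isRegularPoint.sqrtQ_pos μ).ne').mul contDiffAt_const
  | h2 =>
    simp only [coframe_psiIdx_zero, frameZero, contact, potentialA, LinearMap.smul_apply,
      LinearMap.add_apply, LinearMap.sum_apply, smul_eq_mul]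
    exact contDiffAt_const.mul ((ContDiffAt.sum fun k _ => (contDiffAt_esym _ _).mul
      contDiffAt_const).add (ContDiffAt.sum fun μ _ => (((hx.smoothN μ).comp x
        (contDiffAt_coord (xIdx μ))).div (contDiffAt_U μ) (U_ne_zero hx.ne μ)).mul
          (contDiffAt_theta μ v)))
  | h3 μ =>
    simp only [coframe_hatIdx, frameHat, LinearMap.smul_apply, smul_eq_mul]
    exact (hx.contDiffAt_sqrtQ μ).mul (contDiffAt_theta μ v)

theorem contDiffAt_rootProd (hx : IsSmoothPoint X N x) {j : ℕ}
    (S : {S : Finset (Fin n) // S.card = j}) : ContDiffAt ℝ ∞ (rootProd S) x :=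
  contDiffAt_prod fun _ _ => (contDiffAt_coord _).sqrt (hx.pos _).ne'

theorem contDiffAt_hForm (hx : IsSmoothPoint X N x) (j : ℕ)
    (v : Fin (2 * j + 1) → Fin (n + (n + 1)) → ℝ) :
    ContDiffAt ℝ ∞ (fun y => hForm X N j y v) x := by
  simp only [hForm_eq_sum_subsets, AlternatingMap.smul_apply, form_sum_apply, smul_eq_mul]
  exact contDiffAt_const.mul (ContDiffAt.sum fun S _ => (hx.contDiffAt_rootProd S).mul
    (contDiffAt_covWedge (fun i w => hx.contDiffAt_coframe (hIdx S i) w) v))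

/-- Smoothness is read off from `dualForm`, of which `fForm` is locally a constant multiple. -/
theorem contDiffAt_fForm (hx : ∀ᶠ y in nhds x, IsSmoothPoint X N y) {j : ℕ} (hj : j ≤ n)
    (v : Fin (2 * n - 2 * j) → Fin (n + (n + 1)) → ℝ) :
    ContDiffAt ℝ ∞ (fun y => fForm X N j hj y v) x := by
  obtain ⟨s, -, hs⟩ := exists_fForm_eventuallyEq (hx.mono fun y hy => hy.isRegularPoint) hj
  refine ContDiffAt.congr_of_eventuallyEq (f := fun y => (s • dualForm X N hj y) v) ?_
    (hs.mono fun y hy => congrArg (· v) hy)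
  have hx := hx.self_of_nhds
  have h (y) : (s • dualForm X N hj y) v = s * ((j ! : ℝ) *
      ∑ S : {S : Finset (Fin n) // S.card = j}, rootProd S y *
        (splitSign (by omega) (frameSplit hj S) * covWedge (fun i => coframe X N y (fIdx S i)) v)) := by
    rw [AlternatingMap.smul_apply, dualForm, AlternatingMap.smul_apply, form_sum_apply]
    rfl
  simp only [h]
  exact contDiffAt_const.mul (contDiffAt_const.mul (ContDiffAt.sum fun S _ =>
    (hx.contDiffAt_rootProd S).mul (contDiffAt_const.mul
      (contDiffAt_covWedge (fun i w => hx.contDiffAt_coframe (fIdx S i) w) v))))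

theorem contDiffAt_KTensor (hx : IsSmoothPoint X N x) (j : ℕ) (v w : Fin (n + (n + 1)) → ℝ) :
    ContDiffAt ℝ ∞ (fun y => KTensor X j y v w) x := by
  have hX (μ v) := hx.contDiffAt_coframe (xIdx μ) v
  have hH (μ v) := hx.contDiffAt_coframe (hatIdx μ) v
  simp only [coframe_xIdx] at hX
  simp only [coframe_hatIdx] at hH
  simp only [KTensor_apply]
  exact ContDiffAt.sum fun μ _ => (contDiffAt_esym _ _).mul
    (((hX μ v).mul (hX μ w)).add ((hH μ v).mul (hH μ w)))

end IsSmoothPoint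

end

end

end KillingYano

/-! ### The four claims on the open set `M`. -/

theorem mainTheorem7 (n : ℕ) (X N : Fin n → ℝ → ℝ) (M : Set (Fin (n + (n + 1)) → ℝ))
    (hM : IsOpen M)
    (hpos : ∀ x ∈ M, ∀ μ : Fin n, 0 < x (KillingYano.xIdx μ))
    (hne : ∀ x ∈ M, ∀ μ ν : Fin n, μ ≠ ν → x (KillingYano.xIdx μ) ≠ x (KillingYano.xIdx ν))
    (hQ : ∀ x ∈ M, ∀ μ : Fin n, 0 < KillingYano.Q X μ x)
    (hX : ∀ μ : Fin n, ContDiffOn ℝ ∞ (X μ) ((fun x => x (KillingYano.xIdx μ)) '' M))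
    (hN : ∀ μ : Fin n, ContDiffOn ℝ ∞ (N μ) ((fun x => x (KillingYano.xIdx μ)) '' M))
    (j : ℕ) (hj : 1 ≤ j) (hjn : j ≤ n) :
    KillingYano.IsGCCKY M (KillingYano.stMetric X N) (KillingYano.torsionG X N)
        (KillingYano.hForm X N j) ∧
      KillingYano.IsGKY M (KillingYano.stMetric X N) (KillingYano.torsionG X N)
        (KillingYano.fForm X N j hjn) ∧
      (∀ x ∈ M, ∀ u v : Fin (n + (n + 1)) → ℝ,
        ((j ! : ℝ) ^ 2 * ((2 * n - 2 * j - 1)! : ℝ))⁻¹ *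
            KillingYano.formSquare (KillingYano.stMetric X N) (2 * n - 2 * j)
              (KillingYano.fForm X N j hjn) x u v =
          KillingYano.KTensor X j x u v) ∧
      KillingYano.IsKillingTensor M (KillingYano.stMetric X N) (KillingYano.KTensor X j) := by
  have hn : n ≠ 0 := by omega
  -- Coordinate projections are open maps, so smoothness of `X μ` and `N μ` on the projected set is
  -- smoothness at each of its points.
  have himage (μ : Fin n) : IsOpen ((fun x => x (KillingYano.xIdx μ)) '' M) :=
    isOpenMap_eval (KillingYano.xIdx μ) M hM
  have hs (x) (hx : x ∈ M) : KillingYano.IsSmoothPoint X N x :=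
    ⟨hpos x hx, hne x hx, hQ x hx,
      fun μ => (hX μ).contDiffAt ((himage μ).mem_nhds ⟨x, hx, rfl⟩),
      fun μ => (hN μ).contDiffAt ((himage μ).mem_nhds ⟨x, hx, rfl⟩)⟩
  have hev (x) (hx : x ∈ M) : ∀ᶠ y in nhds x, KillingYano.IsSmoothPoint X N y :=
    Filter.mem_of_superset (hM.mem_nhds hx) hs
  have hreg (x) (hx : x ∈ M) : ∀ᶠ y in nhds x, KillingYano.IsRegularPoint X N y :=
    (hev x hx).mono fun y hy => hy.isRegularPoint
  have hQev (x) (hx : x ∈ M) : ∀ᶠ y in nhds x, ∀ μ : Fin n, 0 < KillingYano.Q X μ y :=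
    (hev x hx).mono fun y hy => hy.Q_pos
  refine ⟨⟨⟨fun v x hx => ((hs x hx).contDiffAt_hForm j v).contDiffWithinAt, fun x hx => ?_⟩,
    fun x hx => ?_⟩, ⟨⟨fun v x hx => ?_, fun x hx => ?_⟩, fun x hx => ?_⟩, fun x hx u v => ?_,
    ⟨fun v w x hx => ((hs x hx).contDiffAt_KTensor j v w).contDiffWithinAt,
      fun x _ v w => KillingYano.KTensor_symm X j x v w, fun x hx u v w => ?_⟩⟩
  · exact (KillingYano.gccky_hForm (hreg x hx).self_of_nhds (hQev x hx) hn hjn).2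
  · exact (KillingYano.gccky_hForm (hreg x hx).self_of_nhds (hQev x hx) hn hjn).1
  · exact (KillingYano.IsSmoothPoint.contDiffAt_fForm (hev x hx) hjn v).contDiffWithinAt
  · exact (KillingYano.gky_fForm (hreg x hx) hn hjn).2
  · exact (KillingYano.gky_fForm (hreg x hx) hn hjn).1
  -- For j = n the truncated subtraction gives 0! = 1, so the normalizing factor is nonzero in this
  -- case as well.
  · rw [KillingYano.formSquare_fForm (hreg x hx) hjn]
    exact inv_mul_cancel_left₀ (by positivity) _
  · exact KillingYano.killing_KTensor (hreg x hx).self_of_nhds (hQev x hx) j u v w
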